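/- Fix the propositional variables $x_0, x_1, x_2, \dots$ with this order. A (strict) $\wedge$-decomposition of a formula $\varphi$ is a set $\Psi$ of (more than one) formulas with $\varphi \equiv \bigwedge_{\psi\in\Psi}\psi$ such that the sets $Vars(\psi)$, $\psi\in\Psi$, partition $Vars(\varphi)$; for $0\le i\le\infty$ it is a $\wedge_i$-decomposition if at most one $\psi\in\Psi$ has more than $i$ variables, and the $\wedge_{\hat i}$-decomposition is the finest $\wedge_i$-decomposition (its partition refines that of every other one). A BDD[$\wedge$] is a finite rooted acyclic graph with leaves $\bot,\top$, decision vertices $\langle x, lo, hi\rangle$ representing $(\neg x\wedge\vartheta(lo))\vee(x\wedge\vartheta(hi))$, and $\wedge$-vertices $v$ representing the conjunction of the formulas $\vartheta(w)$ of their children $w$, which must form a strict $\wedge$-decomposition of $\vartheta(v)$; it represents the formula of its root, and its size is its number of edges. It is an OBDD[$\wedge_i$] if the variable of every decision vertex precedes those of its decision descendants and each $\wedge$-vertex is a $\wedge_i$-decomposition. It is an ROBDD[$\wedge_{\hat i}$] if moreover no two vertices are identical (same symbol and children), no decision vertex has two identical children, each $\wedge$-vertex is a $\wedge_{\hat i}$-decomposition,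 and the $\wedge_{\hat i}$-decomposition of (the formula of) each decision vertex $v$ is $\{v\}$. Write $L\le_s L'$ ($L$ is not more succinct than $L'$) if there is a polynomial $p$ such that every $G\in L$ has an equivalent $G'\in L'$ with $|G'|\le p(|G|)$. (1) For all $0\le i,j\le\infty$: ROBDD[$\wedge_{\hat i}$] $\le_s$ ROBDD[$\wedge_{\hat j}$] if and only if $i\le j$. (2) There is a polynomial $p$ such that for all $0\le i\le j\le\infty$ and every OBDD[$\wedge_i$] $G$, the algorithm Decompose with bound $j$ turns $G$ into an equivalent ROBDD[$\wedge_{\hat j}$] in at most $p(|G|)$ steps (in particular, for $j=i$, into the equivalent ROBDD[$\wedge_{\hat i}$]). Here Decompose computes, for each vertex $u$ of $G$ once and after the children of $u$, an output vertex as follows, identifying identical vertices, writing $\langle\wedge,\{w\}\rangle=w$ and $\langle\wedge,\emptyset\rangle=\top$, and, in conjunctions, omitting $\top$ and replacing $\langle\wedge,V\rangle$ by $\bot$ if $\bot\in V$. A leaf is kept. For a $\wedge$-vertex, take the conjunction of the output vertices of its children and replace every child that is a $\wedge$-vertex by the children of that child (flattening). For a decision vertex with variable $x$ whose children have output vertices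 $l,h$, let $u'=\langle x,l,h\rangle$ and return: (a) if $\bot\in\{l,h\}$ and $|Vars(u')|>1$: $u'$ if the bound is $0$, and otherwise the flattened conjunction of the literal $\langle x,\bot,\top\rangle$ (if $l=\bot$) or $\langle x,\top,\bot\rangle$ (if $h=\bot$) with the other child; (b) else, if one of $l,h$, say $v_1$, is a child of the other one, $v_2$, and $v_2$ is a $\wedge$-vertex: let $v$ arise from $u'$ by replacing $v_1$ by $\top$ and $v_2$ by $\langle\wedge,Ch(v_2)\setminus\{v_1\}\rangle$; return $u'$ if both $v_1$ and $v$ have more variables than the bound, and $\langle\wedge,\{v_1,v\}\rangle$ otherwise; (c) else, if $l,h$ are $\wedge$-vertices with a non-empty set $V$ of common children: return $l$ if $l=h$; otherwise, if $Vars(u')\setminus Vars(V)$ is larger than the bound, remove from $V$ the vertex with more variables than the bound, if there is one; return $u'$ if now $V=\emptyset$, and otherwise $\langle\wedge,V\cup\{v\}\rangle$ with $v=\langle x,\langle\wedge,Ch(l)\setminus V\rangle,\langle\wedge,Ch(h)\setminus V\rangle\rangle$; (d) else return $l$ if $l=h$, and $u'$ otherwise. The result is the part of the graph reachable from the output vertex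 of the root. Steps are counted with unit cost for operations on numbers, list cells and vertices, and every traversal of a list is charged. (3) For integers $j\ge0$, $n\ge1$ let $$\varphi_{j,n}=\bigwedge_{1\le k\le n}\bigl(x_{k+0\cdot n}\leftrightarrow x_{k+1\cdot n}\leftrightarrow\cdots\leftrightarrow x_{k+(j+1)\cdot n}\bigr),$$ where $\leftrightarrow$ is the associative binary biconditional. For every $j$ there is a constant $C$ such that for all $j<i\le\infty$ and all $n\ge1$ the formula $\varphi_{j,n}$ is represented by an ROBDD[$\wedge_{\hat i}$] of size at most $Cn$, whereas $\varphi_{j,n}$ is represented by some ROBDD[$\wedge_{\hat j}$] and every such ROBDD[$\wedge_{\hat j}$] has size at least $2^n$. -/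

import Mathlib

namespace AndBDD

/-! ### Propositional formulas and conjunctive decompositions

The propositional variables are the natural numbers in their usual order. -/

/-- Propositional formulas. -/
inductive Formula where
  | tru : Formula
  | fls : Formula
  | var : ℕ → Formula
  | neg : Formula → Formula
  | and : Formula → Formula → Formula
  | or : Formula → Formula → Formula

namespace Formula

/-- The truth value of a formula under an assignment. -/
def eval (ω : ℕ → Bool) : Formula → Bool
  | tru => true
  | fls => false
  | var x => ω x
  | neg φ => !(eval ω φ)
  | and φ ψ => eval ω φ && eval ω ψ
  | or φ ψ => eval ω φ || eval ω ψ

/-- The set of variables occurring in a formula. -/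
def vars : Formula → Finset ℕ
  | tru => ∅
  | fls => ∅
  | var x => {x}
  | neg φ => vars φ
  | and φ ψ => vars φ ∪ vars ψ
  | or φ ψ => vars φ ∪ vars ψ

/-- Logical equivalence. -/
def Equivalent (φ ψ : Formula) : Prop := ∀ ω : ℕ → Bool, eval ω φ = eval ω ψ

/-- The conjunction of a list of formulas. -/
def bigAnd : List Formula → Formula
  | [] => tru
  | φ :: l => and φ (bigAnd l)

/-- The biconditional. -/
def iff (φ ψ : Formula) : Formula := or (and φ ψ) (and (neg φ) (neg ψ))

/-- The chain `φ₁ ↔ (φ₂ ↔ (⋯ ↔ φₘ))`; the biconditional is associative up to equivalence. -/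
def bigIff : List Formula → Formula
  | [] => tru
  | [φ] => φ
  | φ :: ψ :: l => iff φ (bigIff (ψ :: l))

/-- `φ ◇ₓ ψ`, that is, `(¬x ∧ φ) ∨ (x ∧ ψ)`. -/
def choice (x : ℕ) (φ ψ : Formula) : Formula := or (and (neg (var x)) φ) (and (var x) ψ)

/-- `⋀_{1 ≤ k ≤ n} (x_{k + 0·n} ↔ x_{k + 1·n} ↔ ⋯ ↔ x_{k + (j+1)·n})`. -/
def chains (j n : ℕ) : Formula :=
  bigAnd ((List.range n).map fun k =>
    bigIff ((List.range (j + 2)).map fun m => var ((k + 1) + m * n)))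

end Formula

/-- `Ψ` is a `∧`-decomposition of `φ`: the conjunction of `Ψ` is equivalent to `φ`, and the
variable sets of the members of `Ψ` partition the variable set of `φ`.  (The members are then
pairwise distinct, so that the list `Ψ` stands for a set of formulas.) -/
structure IsDecomposition (Ψ : List Formula) (φ : Formula) : Prop where
  equiv : φ.Equivalent (Formula.bigAnd Ψ)
  nonempty : ∀ ψ ∈ Ψ, ψ.vars.Nonempty
  disjoint : Ψ.Pairwise fun ψ χ => Disjoint ψ.vars χ.vars
  cover : ∀ x, x ∈ φ.vars ↔ ∃ ψ ∈ Ψ, x ∈ ψ.vars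

/-- `Ψ` is finer than `Ψ'`: the partition given by `Ψ` refines the one given by `Ψ'`. -/
def Finer (Ψ Ψ' : List Formula) : Prop := ∀ ψ ∈ Ψ, ∃ ψ' ∈ Ψ', ψ.vars ⊆ ψ'.vars

/-- `Ψ` is a `∧ᵢ`-decomposition of `φ`: a `∧`-decomposition with at most one member that has
more than `i` variables. -/
def IsBoundedDecomposition (i : ℕ∞) (Ψ : List Formula) (φ : Formula) : Prop :=
  IsDecomposition Ψ φ ∧
    ∀ ψ ∈ Ψ, ∀ χ ∈ Ψ, i < (ψ.vars.card : ℕ∞) → i < (χ.vars.card : ℕ∞) → ψ = χ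

/-- `Ψ` is a finest `∧ᵢ`-decomposition of `φ`. -/
def IsFinestDecomposition (i : ℕ∞) (Ψ : List Formula) (φ : Formula) : Prop :=
  IsBoundedDecomposition i Ψ φ ∧ ∀ Ψ', IsBoundedDecomposition i Ψ' φ → Finer Ψ Ψ'

/-! ### Binary decision diagrams with conjunctive decomposition -/

/-- The label of a vertex together with its outgoing edges: a leaf `⊥` (`false`) or `⊤` (`true`),
a decision vertex with its variable and its low and high child, or a decomposition vertex with
its children. -/
inductive Node where
  | leaf (b : Bool) : Node
  | dec (x lo hi : ℕ) : Node
  | conj (ch : List ℕ) : Node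

/-- The heads of the outgoing edges. -/
def Node.children : Node → List ℕ
  | .leaf _ => []
  | .dec _ lo hi => [lo, hi]
  | .conj ch => ch

/-- A finite vertex-labelled graph: the list of its vertices, each given by a name and a node.
The first vertex is the root, and every vertex is listed before its children (see
`Diagram.WellFormed`); each finite rooted acyclic graph has such a listing. -/
abbrev Diagram := List (ℕ × Node)

namespace Diagram

/-- The names of the vertices. -/
def names (G : Diagram) : List ℕ := G.map Prod.fst

/-- Names are not repeated, and the children of a vertex are vertices listed after it. -/
def WellFormed : Diagram → Prop
  | [] => True
  | (u, nd) :: G => u ∉ names G ∧ (∀ w ∈ nd.children, w ∈ names G) ∧ WellFormed G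

/-- There is an edge from `u` to `w`. -/
def Edge (G : Diagram) (u w : ℕ) : Prop := ∃ nd, (u, nd) ∈ G ∧ w ∈ nd.children

/-- There is a first vertex, the root, and every vertex is reachable from it. -/
def Rooted (G : Diagram) : Prop :=
  ∃ r, (names G).head? = some r ∧ ∀ v ∈ names G, Relation.ReflTransGen (Edge G) r v

/-- The formula `ϑ(v)` represented by the vertex `v`. -/
def theta : Diagram → ℕ → Formula
  | [], _ => .fls
  | (u, nd) :: G, v =>
    if v = u then
      match nd with
      | .leaf false => .fls
      | .leaf true => .tru
      | .dec x lo hi => .choice x (theta G lo) (theta G hi)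
      | .conj ch => .bigAnd (ch.map fun w => theta G w)
    else theta G v

/-- The formula represented by a diagram, which is the one represented by its root. -/
def formula : Diagram → Formula
  | [] => .fls
  | (r, nd) :: G => theta ((r, nd) :: G) r

/-- `G` represents `φ`. -/
def Represents (G : Diagram) (φ : Formula) : Prop := (formula G).Equivalent φ

/-- The size of a diagram is the number of its edges. -/
def size (G : Diagram) : ℕ := (G.map fun e => e.2.children.length).sum

/-- `G` is a BDD[∧]. -/
structure IsBDD (G : Diagram) : Prop where
  wellFormed : WellFormed G
  rooted : Rooted G
  decomposition : ∀ v ch, (v, Node.conj ch) ∈ G →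
    IsDecomposition (ch.map (theta G)) (theta G v) ∧ 1 < ch.length

/-- Each decision vertex precedes its decision descendants in the order of the variables. -/
def Ordered (G : Diagram) : Prop :=
  ∀ u x lo hi v y lo' hi', (u, Node.dec x lo hi) ∈ G → (v, Node.dec y lo' hi') ∈ G →
    Relation.TransGen (Edge G) u v → x < y

/-- Two nodes have the same symbol and the same children. -/
def Identical : Node → Node → Prop
  | .leaf b, .leaf b' => b = b'
  | .dec x lo hi, .dec x' lo' hi' => x = x' ∧ lo = lo' ∧ hi = hi'
  | .conj ch, .conj ch' => ∀ w, w ∈ ch ↔ w ∈ ch'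
  | _, _ => False

/-- No two vertices are identical, and no decision vertex has two identical children. -/
def Reduced (G : Diagram) : Prop :=
  (∀ u v nd nd', (u, nd) ∈ G → (v, nd') ∈ G → Identical nd nd' → u = v) ∧
    ∀ u x lo hi, (u, Node.dec x lo hi) ∈ G → lo ≠ hi

end Diagram

/-- The language OBDD[∧ᵢ]. -/
def OBDDAnd (i : ℕ∞) : Set Diagram :=
  {G | G.IsBDD ∧ G.Ordered ∧
    ∀ v ch, (v, Node.conj ch) ∈ G → IsBoundedDecomposition i (ch.map G.theta) (G.theta v)}

/-- The language ROBDD[∧_î]. -/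
def ROBDDHat (i : ℕ∞) : Set Diagram :=
  {G | G.IsBDD ∧ G.Ordered ∧ G.Reduced ∧
    (∀ v ch, (v, Node.conj ch) ∈ G →
      IsFinestDecomposition i (ch.map G.theta) (G.theta v)) ∧
    ∀ v x lo hi, (v, Node.dec x lo hi) ∈ G → IsFinestDecomposition i [G.theta v] (G.theta v)}

/-- `L` is not more succinct than `L'`: for some polynomial `p`, each member `G` of `L` has an
equivalent member of `L'` of size at most `p(|G|)`. -/
def NotMoreSuccinct (L L' : Set Diagram) : Prop :=
  ∃ p : Polynomial ℕ, ∀ G ∈ L, ∃ G' ∈ L', G'.formula.Equivalent G.formula ∧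
    G'.size ≤ p.eval G.size

/-! ### Computations with a step count -/

/-- A result together with the number of steps that were spent on it. -/
structure Timed (α : Type) where
  val : α
  time : ℕ

instance : Monad Timed where
  pure a := ⟨a, 0⟩
  bind m f := ⟨(f m.val).val, m.time + (f m.val).time⟩

/-- One step. -/
def tick : Timed Unit := ⟨(), 1⟩

/-! ### The algorithm Decompose

Cost model: every call of every procedure below, recursive calls included, is charged one step by
a `tick`.  Apart from its calls of other procedures, a call does only a bounded number of
elementary operations: comparing numbers, incrementing a number, and reading or building a list
cell, a pair, a node or a store entry.  No list is traversed, searched or concatenated without a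
charge. -/

/-- Is `a` in the list? -/
def isMem (a : ℕ) : List ℕ → Timed Bool
  | [] => do
    tick
    return false
  | b :: l => do
    tick
    if a = b then return true else isMem a l

/-- Is the first list contained in `m`? -/
def isSub (m : List ℕ) : List ℕ → Timed Bool
  | [] => do
    tick
    return true
  | a :: l => do
    tick
    if (← isMem a m) then isSub m l else return false

/-- The union of a list and `m`. -/
def union (m : List ℕ) : List ℕ → Timed (List ℕ)
  | [] => do
    tick
    return m
  | a :: l => do
    tick
    let r ← union m l
    if (← isMem a r) then return r else return a :: r

/-- The members of a list that are in `m`. -/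
def inter (m : List ℕ) : List ℕ → Timed (List ℕ)
  | [] => do
    tick
    return []
  | a :: l => do
    tick
    let r ← inter m l
    if (← isMem a m) then return a :: r else return r

/-- The members of a list that are not in `m`. -/
def diff (m : List ℕ) : List ℕ → Timed (List ℕ)
  | [] => do
    tick
    return []
  | a :: l => do
    tick
    let r ← diff m l
    if (← isMem a m) then return r else return a :: r

/-- The length of a list. -/
def len : List ℕ → Timed ℕ
  | [] => do
    tick
    return 0
  | _ :: l => do
    tick
    return (← len l) + 1

/-- A vertex of the output under construction, with the list of its variables. -/
structure Entry where
  name : ℕ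
  node : Node
  vars : List ℕ

/-- The vertices constructed so far, the latest one first. -/
abbrev Store := List Entry

/-- The entry of the vertex `v` (with a dummy value if there is none). -/
def find (v : ℕ) : Store → Timed Entry
  | [] => do
    tick
    return ⟨v, .leaf false, []⟩
  | e :: S => do
    tick
    if v = e.name then return e else find v S

/-- The variables of a list of vertices. -/
def varsOf (S : Store) : List ℕ → Timed (List ℕ)
  | [] => do
    tick
    return []
  | v :: l => do
    tick
    let e ← find v S
    union (← varsOf S l) e.vars

/-- The variables of a node over the store. -/
def nodeVars (S : Store) : Node → Timed (List ℕ)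
  | .leaf _ => do
    tick
    return []
  | .dec x lo hi => do
    tick
    union (← varsOf S [lo, hi]) [x]
  | .conj ch => do
    tick
    varsOf S ch

/-- Do two nodes have the same symbol and the same children? -/
def isIdentical : Node → Node → Timed Bool
  | .leaf b, .leaf b' => do
    tick
    return b == b'
  | .dec x lo hi, .dec x' lo' hi' => do
    tick
    return x == x' && lo == lo' && hi == hi'
  | .conj ch, .conj ch' => do
    tick
    if (← isSub ch ch') then isSub ch' ch else return false
  | _, _ => do
    tick
    return false

/-- A vertex identical with the given node, if there is one. -/
def findNode (nd : Node) : Store → Timed (Option ℕ)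
  | [] => do
    tick
    return none
  | e :: S => do
    tick
    if (← isIdentical nd e.node) then return some e.name else findNode nd S

/-- A name that is larger than the latest one. -/
def freshName : Store → Timed ℕ
  | [] => do
    tick
    return 0
  | e :: _ => do
    tick
    return e.name + 1

/-- The vertex with the given node: a previous one if there is an identical one, and else a
new one. -/
def vertex (S : Store) (nd : Node) : Timed (ℕ × Store) := do
  tick
  match ← findNode nd S with
  | some v => return (v, S)
  | none =>
    let vs ← nodeVars S nd
    let v ← freshName S
    return (v, ⟨v, nd, vs⟩ :: S)

/-- The vertex `⟨∧, ch⟩`, which is `⟨⊤⟩` if `ch` is empty and `w` if `ch = {w}`. -/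
def conjVertex (S : Store) : List ℕ → Timed (ℕ × Store)
  | [] => do
    tick
    vertex S (.leaf true)
  | [w] => do
    tick
    return (w, S)
  | w :: w' :: l => do
    tick
    vertex S (.conj (w :: w' :: l))

/-- Is the node `⟨⊥⟩`? -/
def isBot : Node → Timed Bool
  | .leaf false => do
    tick
    return true
  | _ => do
    tick
    return false

/-- Is `⟨⊥⟩` among the vertices of the list? -/
def hasBot (S : Store) : List ℕ → Timed Bool
  | [] => do
    tick
    return false
  | v :: l => do
    tick
    let e ← find v S
    if (← isBot e.node) then return true else hasBot S l

/-- Replace each `∧`-vertex in the list by its children, and delete `⟨⊤⟩`. -/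
def flatten (S : Store) : List ℕ → Timed (List ℕ)
  | [] => do
    tick
    return []
  | v :: l => do
    tick
    let r ← flatten S l
    let e ← find v S
    match e.node with
    | .leaf true => return r
    | .conj ch => union r ch
    | _ => union r [v]

/-- The vertex equivalent to `⟨∧, ch⟩` without `∧`-vertices among its children; it is `⟨⊥⟩` if
`⟨⊥⟩` is in `ch`. -/
def finest (S : Store) (ch : List ℕ) : Timed (ℕ × Store) := do
  tick
  if (← hasBot S ch) then vertex S (.leaf false)
  else conjVertex S (← flatten S ch)

/-- The decision vertex `⟨x, lo, hi⟩`, where one of `lo`, `hi` is `⟨⊥⟩` and the other one is not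
a leaf; `loBot` tells whether `lo` is `⟨⊥⟩`. -/
def extractLeaf (i : ℕ∞) (S : Store) (x lo hi : ℕ) (loBot : Bool) : Timed (ℕ × Store) := do
  tick
  if i = 0 then vertex S (.dec x lo hi)
  else
    let (t, S) ← vertex S (.leaf true)
    if loBot then
      let (v, S) ← vertex S (.dec x lo t)
      finest S [v, hi]
    else
      let (v, S) ← vertex S (.dec x t hi)
      finest S [v, lo]

/-- The decision vertex `⟨x, lo, hi⟩`, where `lo` (if `loPart`) or `hi` (otherwise) is one of the
children `ch` of the other one, which is a `∧`-vertex. -/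
def extractPart (i : ℕ∞) (S : Store) (x lo hi : ℕ) (loPart : Bool) (ch : List ℕ) :
    Timed (ℕ × Store) := do
  tick
  let v₁ := if loPart then lo else hi
  let rest ← diff [v₁] ch
  let (r, S) ← conjVertex S rest
  let (t, S) ← vertex S (.leaf true)
  let (v, S) ← vertex S (if loPart then .dec x t r else .dec x r t)
  let e₁ ← find v₁ S
  let e ← find v S
  let k₁ ← len e₁.vars
  let k ← len e.vars
  if i < (k₁ : ℕ∞) ∧ i < (k : ℕ∞) then vertex S (.dec x lo hi)
  else conjVertex S [v₁, v]

/-- Delete the vertices with more than `i` variables from a list. -/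
def dropLarge (i : ℕ∞) (S : Store) : List ℕ → Timed (List ℕ)
  | [] => do
    tick
    return []
  | v :: l => do
    tick
    let r ← dropLarge i S l
    let e ← find v S
    let k ← len e.vars
    if i < (k : ℕ∞) then return r else return v :: r

/-- The decision vertex `⟨x, lo, hi⟩`, where `lo` and `hi` are `∧`-vertices with the children
`a` and `b` and the non-empty list `V` of common children. -/
def extractShare (i : ℕ∞) (S : Store) (x lo hi : ℕ) (a b V : List ℕ) : Timed (ℕ × Store) := do
  tick
  if lo = hi then return (lo, S)
  else
    let w ← nodeVars S (.dec x lo hi)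
    let k ← len (← diff (← varsOf S V) w)
    let V' ← if i < (k : ℕ∞) then dropLarge i S V else pure V
    match V' with
    | [] => vertex S (.dec x lo hi)
    | v₀ :: l =>
      let (lo', S) ← conjVertex S (← diff (v₀ :: l) a)
      let (hi', S) ← conjVertex S (← diff (v₀ :: l) b)
      let (v, S) ← vertex S (.dec x lo' hi')
      conjVertex S (v :: v₀ :: l)

/-- Is `v` a child of the node, and the node a `∧`-node? -/
def isPart (v : ℕ) : Node → Timed Bool
  | .conj ch => do
    tick
    isMem v ch
  | _ => do
    tick
    return false

/-- The children of a `∧`-node, and the empty list for other nodes. -/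
def conjChildren : Node → Timed (List ℕ)
  | .conj ch => do
    tick
    return ch
  | _ => do
    tick
    return []

/-- The vertex equivalent to `⟨x, lo, hi⟩`, where `lo` and `hi` are vertices of the store. -/
def decompDecision (i : ℕ∞) (S : Store) (x lo hi : ℕ) : Timed (ℕ × Store) := do
  tick
  let el ← find lo S
  let eh ← find hi S
  let k ← len (← nodeVars S (.dec x lo hi))
  let loBot ← isBot el.node
  let hiBot ← isBot eh.node
  let a ← conjChildren el.node
  let b ← conjChildren eh.node
  let loPart ← isPart lo eh.node
  let hiPart ← isPart hi el.node
  let V ← inter b a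
  if (loBot || hiBot) && 1 < k then extractLeaf i S x lo hi loBot
  else if loPart then extractPart i S x lo hi true b
  else if hiPart then extractPart i S x lo hi false a
  else if !V.isEmpty then extractShare i S x lo hi a b V
  else if lo = hi then return (lo, S)
  else vertex S (.dec x lo hi)

/-- The output vertex recorded for the input vertex `u`. -/
def lookup (u : ℕ) : List (ℕ × ℕ) → Timed ℕ
  | [] => do
    tick
    return 0
  | (u', v) :: H => do
    tick
    if u = u' then return v else lookup u H

/-- The output vertices recorded for a list of input vertices. -/
def lookupAll (H : List (ℕ × ℕ)) : List ℕ → Timed (List ℕ)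
  | [] => do
    tick
    return []
  | u :: l => do
    tick
    let v ← lookup u H
    return v :: (← lookupAll H l)

/-- The output vertex for an input vertex whose children have been treated. -/
def decompNode (i : ℕ∞) (H : List (ℕ × ℕ)) (S : Store) : Node → Timed (ℕ × Store)
  | .leaf b => do
    tick
    vertex S (.leaf b)
  | .dec x lo hi => do
    tick
    let lo' ← lookup lo H
    let hi' ← lookup hi H
    decompDecision i S x lo' hi'
  | .conj ch => do
    tick
    finest S (← lookupAll H ch)

/-- Treat every input vertex once, children before parents.  The first component of the result
is the table of the output vertices, with the latest input vertex first. -/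
def decompAll (i : ℕ∞) : Diagram → Timed (List (ℕ × ℕ) × Store)
  | [] => do
    tick
    return ([], [])
  | (u, nd) :: G => do
    tick
    let (H, S) ← decompAll i G
    let (v, S) ← decompNode i H S nd
    return ((u, v) :: H, S)

/-- The part of the store that is reachable from the marked vertices. -/
def collect (marks : List ℕ) : Store → Timed Diagram
  | [] => do
    tick
    return []
  | e :: S => do
    tick
    if (← isMem e.name marks) then
      return (e.name, e.node) :: (← collect (← union marks e.node.children) S)
    else collect marks S

/-- The algorithm Decompose with bound `i`. -/
def decompose (i : ℕ∞) (G : Diagram) : Timed Diagram := do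
  tick
  let (H, S) ← decompAll i G
  match H with
  | [] => return []
  | (_, v) :: _ => collect [v] S

end AndBDD

open AndBDD

/-!
A set `B` of variables *splits* a formula if its models form a product of a set of assignments to
`B` and a set of assignments to the other variables.  The members of a conjunctive decomposition
are splitting sets, and splitting is invariant under equivalence, so that the whole theory can be
developed for splitting sets.  A formula is *rigid* for the bound `j` if all its non-trivial
splitting sets have more than `j` variables.  Rigid formulas without common variables, at most one
of them with more than `j` variables, form the finest `∧ⱼ`-decomposition of their conjunction
(`Formula.isFinestDecomposition`).  This yields a local criterion (`Diagram.Good`) for a diagram to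
be a ROBDD[∧_ĵ]: decision vertices are rigid, and the children of a `∧`-vertex are decision
vertices.  Conversely, in every ROBDD[∧_ĵ] all occurring variables are essential, and equivalent
vertices are equal (`Diagram.Canon.tight_and_injective`).

Decompose keeps its store of output vertices `Good`.  The point is that each decision vertex which
it creates is rigid.  By `Formula.rigid_choice`, a decision between two conjunctions of rigid
factors without a common factor is rigid; `extractLeaf`, `extractPart` and `extractShare` deal with
the decisions where a factor can be split off, and where nothing is split off because of the bound,
the decision is rigid nevertheless.  Every vertex of the input adds at most five vertices to the
store, and the lists that occur are no longer than the store and its variables allow, which bounds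
the number of steps by a polynomial of degree four.

For the formulas `chains j n`, observe that a splitting set does not cut a chain: a change of one
variable of a chain has to be compensated by a change of another one
(`Proper.subset_of_splits`).  With the bound `j`, systems of chains with more than `j` variables
are therefore rigid and are never represented by `∧`-vertices.  A path from the root that follows
the first variables of the `n` chains, which are the least variables, leads through decision
vertices only, and its `2 ^ n` continuations end in inequivalent systems (`two_pow_le_size`).  With
a larger bound, either all chains are factors of the root, or the chain that remains when its first
variable is decided is a factor; both lead to diagrams of linear size
(`exists_mem_robddHat_chains`).  The comparison of an exponential with a polynomial then gives the
failure of succinctness for `j < i`, while Decompose gives the simulation for `i ≤ j`.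
-/

namespace AndBDD

/-! ### Splitting sets of a formula -/

namespace Formula

theorem eval_congr {φ : Formula} {ω ω' : ℕ → Bool} (h : ∀ x ∈ φ.vars, ω x = ω' x) :
    eval ω φ = eval ω' φ := by
  induction φ with
  | tru => rfl
  | fls => rfl
  | var x => exact h x (by simp [vars])
  | neg φ ih => simp only [eval, ih h]
  | and φ ψ ih ih' =>
    simp only [vars, Finset.mem_union] at h
    simp only [eval, ih fun x hx => h x (Or.inl hx), ih' fun x hx => h x (Or.inr hx)]
  | or φ ψ ih ih' =>
    simp only [vars, Finset.mem_union] at h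
    simp only [eval, ih fun x hx => h x (Or.inl hx), ih' fun x hx => h x (Or.inr hx)]

theorem Equivalent.symm {φ ψ : Formula} (h : φ.Equivalent ψ) : ψ.Equivalent φ :=
  fun ω => (h ω).symm

theorem Equivalent.trans {φ ψ χ : Formula} (h : φ.Equivalent ψ) (h' : ψ.Equivalent χ) :
    φ.Equivalent χ :=
  fun ω => (h ω).trans (h' ω)

theorem equivalent_of_imp {φ ψ : Formula} (h : ∀ ω, eval ω φ = true → eval ω ψ = true)
    (h' : ∀ ω, eval ω ψ = true → eval ω φ = true) : φ.Equivalent ψ :=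
  fun ω => Bool.eq_iff_iff.2 ⟨h ω, h' ω⟩

theorem eval_bigAnd {l : List Formula} {ω : ℕ → Bool} :
    eval ω (bigAnd l) = true ↔ ∀ ψ ∈ l, eval ω ψ = true := by
  induction l with
  | nil => simp [bigAnd, eval]
  | cons φ l ih => simp [bigAnd, eval, ih]

theorem mem_vars_bigAnd {l : List Formula} {x : ℕ} :
    x ∈ (bigAnd l).vars ↔ ∃ ψ ∈ l, x ∈ ψ.vars := by
  induction l with
  | nil => simp [bigAnd, vars]
  | cons φ l ih => simp [bigAnd, vars, ih]

theorem eval_choice {x : ℕ} {φ ψ : Formula} {ω : ℕ → Bool} :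
    eval ω (choice x φ ψ) = if ω x then eval ω ψ else eval ω φ := by
  cases h : ω x <;> simp [choice, eval, h]

theorem vars_choice {x : ℕ} {φ ψ : Formula} :
    (choice x φ ψ).vars = insert x (φ.vars ∪ ψ.vars) := by
  ext y
  simp only [choice, vars, Finset.mem_union, Finset.mem_insert, Finset.mem_singleton]
  tauto

theorem Equivalent.choice {x : ℕ} {φ φ' ψ ψ' : Formula} (h : φ.Equivalent φ')
    (h' : ψ.Equivalent ψ') : (choice x φ ψ).Equivalent (choice x φ' ψ') := fun ω => by
  rw [eval_choice, eval_choice, h ω, h' ω]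

/-- The formula has a model. -/
def Sat (φ : Formula) : Prop := ∃ ω, eval ω φ = true

/-- Every variable that occurs in the formula is essential: some model is destroyed by a change
of this variable alone. -/
def Tight (φ : Formula) : Prop :=
  ∀ x ∈ φ.vars, ∃ ω b, eval ω φ = true ∧ eval (Function.update ω x b) φ = false

theorem Tight.mem_of_equivalent {φ ψ : Formula} (h : φ.Tight) (e : φ.Equivalent ψ) {x : ℕ}
    (hx : x ∈ φ.vars) : x ∈ ψ.vars := by
  obtain ⟨ω, b, h1, h2⟩ := h x hx
  by_contra hn
  have h3 : eval (Function.update ω x b) ψ = eval ω ψ := eval_congr fun y hy => by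
    rw [Function.update_of_ne]
    rintro rfl
    exact hn hy
  rw [← e, ← e, h1, h2] at h3
  cases h3

theorem Tight.vars_subset {φ ψ : Formula} (h : φ.Tight) (e : φ.Equivalent ψ) :
    φ.vars ⊆ ψ.vars :=
  fun _ => h.mem_of_equivalent e

theorem Tight.vars_eq {φ ψ : Formula} (h : φ.Tight) (h' : ψ.Tight) (e : φ.Equivalent ψ) :
    φ.vars = ψ.vars :=
  (h.vars_subset e).antisymm (h'.vars_subset e.symm)

theorem tight_of_ne {φ : Formula}
    (h : ∀ x ∈ φ.vars, ∃ ω b, eval ω φ ≠ eval (Function.update ω x b) φ) : φ.Tight := by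
  intro x hx
  obtain ⟨ω, b, hω⟩ := h x hx
  cases h1 : eval ω φ
  · refine ⟨Function.update ω x b, ω x, ?_, ?_⟩
    · rw [h1] at hω
      simpa using hω.symm
    · simpa using h1
  · refine ⟨ω, b, h1, ?_⟩
    rw [h1] at hω
    simpa using hω.symm

/-- The set `B` splits `φ`: the models of `φ` form a product of a set of assignments to `B` and
a set of assignments to the other variables. -/
def Splits (φ : Formula) (B : Finset ℕ) : Prop :=
  ∀ ω ω', eval ω φ = true → eval ω' φ = true → eval (B.piecewise ω ω') φ = true

/-- Every non-trivial set of variables of `φ` that splits `φ` has more than `j` members.  This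
says that the `∧_ĵ`-decomposition of `φ` is `{φ}`. -/
def Rigid (j : ℕ∞) (φ : Formula) : Prop :=
  ∀ B ⊆ φ.vars, φ.Splits B → B.Nonempty → B ≠ φ.vars → j < (B.card : ℕ∞)

theorem Splits.sdiff {φ : Formula} {B : Finset ℕ} (h : φ.Splits B) : φ.Splits (φ.vars \ B) := by
  intro ω ω' hω hω'
  rw [← h ω' ω hω' hω]
  refine eval_congr fun x hx => ?_
  by_cases hB : x ∈ B <;> simp [hx, hB, Finset.piecewise]

theorem Splits.congr {φ ψ : Formula} {B : Finset ℕ} (h : φ.Splits B) (e : φ.Equivalent ψ) :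
    ψ.Splits B := by
  intro ω ω' hω hω'
  rw [← e] at hω hω' ⊢
  exact h ω ω' hω hω'

theorem Rigid.congr {j : ℕ∞} {φ ψ : Formula} (h : φ.Rigid j) (e : φ.Equivalent ψ)
    (hv : φ.vars = ψ.vars) : ψ.Rigid j := by
  intro B hB hs hn hne
  rw [← hv] at hB hne
  exact h B hB (hs.congr e.symm) hn hne

theorem rigid_zero (φ : Formula) : φ.Rigid 0 := by
  intro B _ _ hn _
  simpa [pos_iff_ne_zero, Finset.nonempty_iff_ne_empty] using hn

theorem rigid_of_vars_eq_singleton {j : ℕ∞} {φ : Formula} {x : ℕ} (h : φ.vars = {x}) :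
    φ.Rigid j := by
  intro B hB _ hn hne
  rw [h] at hB hne
  exact absurd ((Finset.subset_singleton_iff.1 hB).resolve_left hn.ne_empty) hne

/-- The members of `F` have pairwise disjoint sets of variables. -/
def Apart (F : List Formula) : Prop :=
  ∀ ψ ∈ F, ∀ χ ∈ F, ψ ≠ χ → Disjoint ψ.vars χ.vars

/-- At most one member of `F` has more than `j` variables. -/
def AtMostOneLarge (j : ℕ∞) (F : List Formula) : Prop :=
  ∀ ψ ∈ F, ∀ χ ∈ F, j < (ψ.vars.card : ℕ∞) → j < (χ.vars.card : ℕ∞) → ψ = χ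

theorem eval_piecewise_vars {φ : Formula} {ω ω' : ℕ → Bool} :
    eval (φ.vars.piecewise ω ω') φ = eval ω φ :=
  eval_congr fun x hx => by simp [Finset.piecewise, hx]

theorem eval_piecewise_of_disjoint {φ : Formula} {B : Finset ℕ} {ω ω' : ℕ → Bool}
    (h : Disjoint B φ.vars) : eval (B.piecewise ω ω') φ = eval ω' φ :=
  eval_congr fun x hx => by simp [Finset.piecewise, Finset.disjoint_right.1 h hx]

theorem Apart.eval_piecewise {F : List Formula} (hF : Apart F) {ψ : Formula} (hψ : ψ ∈ F)
    {ω ω' : ℕ → Bool} (hω : eval ω ψ = true) (hω' : eval ω' (bigAnd F) = true) :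
    eval (ψ.vars.piecewise ω ω') (bigAnd F) = true := by
  rw [eval_bigAnd] at hω' ⊢
  intro χ hχ
  by_cases h : ψ = χ
  · subst h
    rw [eval_piecewise_vars, hω]
  · rw [eval_piecewise_of_disjoint (hF ψ hψ χ hχ h), hω' χ hχ]

theorem Apart.splits {F : List Formula} (hF : Apart F) {ψ : Formula} (hψ : ψ ∈ F) :
    (bigAnd F).Splits ψ.vars :=
  fun _ _ hω hω' => hF.eval_piecewise hψ (eval_bigAnd.1 hω ψ hψ) hω'

theorem Apart.sat {F : List Formula} (hF : Apart F) (h : ∀ ψ ∈ F, ψ.Sat) : (bigAnd F).Sat := by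
  induction F with
  | nil => exact ⟨fun _ => true, rfl⟩
  | cons φ F ih =>
    obtain ⟨ω, hω⟩ := ih (fun ψ hψ χ hχ => hF ψ (List.mem_cons_of_mem _ hψ) χ
      (List.mem_cons_of_mem _ hχ)) fun ψ hψ => h ψ (List.mem_cons_of_mem _ hψ)
    obtain ⟨ω₁, hω₁⟩ := h φ List.mem_cons_self
    refine ⟨φ.vars.piecewise ω₁ ω, eval_bigAnd.2 fun χ hχ => ?_⟩
    by_cases h : φ = χ
    · subst h
      rw [eval_piecewise_vars, hω₁]
    · rw [eval_piecewise_of_disjoint (hF φ List.mem_cons_self χ hχ h)]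
      exact eval_bigAnd.1 hω χ ((List.mem_cons.1 hχ).resolve_left (Ne.symm h))

theorem Apart.splits_inter {F : List Formula} (hF : Apart F) (hs : (bigAnd F).Sat) {ψ : Formula}
    (hψ : ψ ∈ F) {B : Finset ℕ} (hB : (bigAnd F).Splits B) : ψ.Splits (B ∩ ψ.vars) := by
  intro ω ω' hω hω'
  obtain ⟨ω₀, h₀⟩ := hs
  have h := eval_bigAnd.1 (hB _ _ (hF.eval_piecewise hψ hω h₀) (hF.eval_piecewise hψ hω' h₀)) ψ hψ
  rw [← h]
  refine eval_congr fun x hx => ?_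
  by_cases hB : x ∈ B <;> simp [hx, hB, Finset.piecewise]

theorem Apart.tight {F : List Formula} (hF : Apart F) (hs : ∀ ψ ∈ F, ψ.Sat)
    (ht : ∀ ψ ∈ F, ψ.Tight) : (bigAnd F).Tight := by
  intro x hx
  obtain ⟨ψ, hψ, hxψ⟩ := mem_vars_bigAnd.1 hx
  obtain ⟨ω, b, h1, h2⟩ := ht ψ hψ x hxψ
  obtain ⟨ω₀, h₀⟩ := hF.sat hs
  refine ⟨ψ.vars.piecewise ω ω₀, b, hF.eval_piecewise hψ h1 h₀, ?_⟩
  rw [← Bool.not_eq_true, eval_bigAnd]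
  intro h
  have h3 := h ψ hψ
  rw [eval_congr (ω' := Function.update ω x b), h2] at h3
  · cases h3
  · intro y hy
    by_cases hyx : y = x
    · subst hyx
      simp
    · simp [hyx, Finset.piecewise, hy]

/-- A conjunction of rigid formulas without common variables, all with more than `j` variables,
is rigid. -/
theorem rigid_bigAnd {j : ℕ∞} {F : List Formula} (hF : Apart F) (hs : ∀ ψ ∈ F, ψ.Sat)
    (hr : ∀ ψ ∈ F, ψ.Rigid j) (hl : ∀ ψ ∈ F, j < (ψ.vars.card : ℕ∞)) : (bigAnd F).Rigid j := by
  intro B hBF hB hn _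
  obtain ⟨x, hx⟩ := hn
  obtain ⟨ψ, hψ, hxψ⟩ := mem_vars_bigAnd.1 (hBF hx)
  have key : j < ((B ∩ ψ.vars).card : ℕ∞) := by
    by_cases h : B ∩ ψ.vars = ψ.vars
    · rw [h]
      exact hl ψ hψ
    · exact hr ψ hψ _ Finset.inter_subset_right (hF.splits_inter (hF.sat hs) hψ hB)
        ⟨x, Finset.mem_inter.2 ⟨hx, hxψ⟩⟩ h
  exact key.trans_le (by exact_mod_cast Finset.card_le_card Finset.inter_subset_left)

theorem pairwise_disjoint_apart {F : List Formula}
    (h : F.Pairwise fun ψ χ => Disjoint ψ.vars χ.vars) : Apart F := by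
  have : Std.Symm fun ψ χ : Formula => Disjoint ψ.vars χ.vars := ⟨fun _ _ h => h.symm⟩
  exact fun _ hψ _ hχ hne => h.forall hψ hχ hne

/-- The members of a decomposition split the formula. -/
theorem _root_.AndBDD.IsDecomposition.splits {Ψ : List Formula} {φ : Formula}
    (h : IsDecomposition Ψ φ) {ψ : Formula} (hψ : ψ ∈ Ψ) : φ.Splits ψ.vars := by
  exact Splits.congr (Apart.splits (pairwise_disjoint_apart h.disjoint) hψ) h.equiv.symm

/-- Rigid formulas without common variables, at most one of them with more than `j` variables,
form the finest `∧ⱼ`-decomposition of their conjunction. -/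
theorem isFinestDecomposition {j : ℕ∞} {F : List Formula} {φ : Formula}
    (hF : F.Pairwise fun ψ χ => Disjoint ψ.vars χ.vars) (hs : ∀ ψ ∈ F, ψ.Sat)
    (hn : ∀ ψ ∈ F, ψ.vars.Nonempty) (hr : ∀ ψ ∈ F, ψ.Rigid j) (hl : AtMostOneLarge j F)
    (e : φ.Equivalent (bigAnd F)) (hv : φ.vars = (bigAnd F).vars) :
    IsFinestDecomposition j F φ := by
  have hA := pairwise_disjoint_apart hF
  refine ⟨⟨⟨e, hn, hF, fun x => by rw [hv, mem_vars_bigAnd]⟩, hl⟩, ?_⟩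
  intro Ψ hΨ ψ hψ
  -- A member of `Ψ` that cuts `ψ` has more than `j` variables by rigidity.
  have large : ∀ χ ∈ Ψ, (χ.vars ∩ ψ.vars).Nonempty → ¬ ψ.vars ⊆ χ.vars →
      j < (χ.vars.card : ℕ∞) := by
    intro χ hχ hne hsub
    refine (hr ψ hψ (χ.vars ∩ ψ.vars) Finset.inter_subset_right
      (hA.splits_inter (hA.sat hs) hψ ((hΨ.1.splits hχ).congr e)) hne
      fun h => hsub (Finset.inter_eq_right.1 h)).trans_le ?_
    exact_mod_cast Finset.card_le_card Finset.inter_subset_left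
  have cov : ∀ x ∈ ψ.vars, ∃ χ ∈ Ψ, x ∈ χ.vars := fun x hx =>
    (hΨ.1.cover x).1 (by rw [hv]; exact mem_vars_bigAnd.2 ⟨ψ, hψ, hx⟩)
  obtain ⟨x, hx⟩ := hn ψ hψ
  obtain ⟨χ, hχ, hxχ⟩ := cov x hx
  refine ⟨χ, hχ, ?_⟩
  by_contra hsub
  obtain ⟨y, hy, hyχ⟩ := Finset.not_subset.1 hsub
  obtain ⟨χ', hχ', hyχ'⟩ := cov y hy
  have hne : χ ≠ χ' := by
    rintro rfl
    exact hyχ hyχ'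
  have hdis := pairwise_disjoint_apart hΨ.1.disjoint χ hχ χ' hχ' hne
  exact hne (hΨ.2 χ hχ χ' hχ' (large χ hχ ⟨x, Finset.mem_inter.2 ⟨hxχ, hx⟩⟩ hsub)
    (large χ' hχ' ⟨y, Finset.mem_inter.2 ⟨hyχ', hy⟩⟩
      fun h => Finset.disjoint_left.1 hdis hxχ (h hx)))

/-! ### Rigidity of a decision formula -/

/-- The part on `D` of a model of `φ` can be transplanted into every model of `ψ`. -/
def Transplants (D : Finset ℕ) (φ ψ : Formula) : Prop :=
  ∀ ω ω', eval ω φ = true → eval ω' ψ = true → eval (D.piecewise ω ω') ψ = true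

/-- If the parts on `D` of the models of `φ` and of `ψ` are the same, then so are their essential
variables in `D`. -/
theorem Transplants.mem_vars {D : Finset ℕ} {φ ψ : Formula} (h : Transplants D φ ψ)
    (h' : Transplants D ψ φ) (ht : φ.Tight) (hs : ψ.Sat) {x : ℕ} (hx : x ∈ D)
    (hxφ : x ∈ φ.vars) : x ∈ ψ.vars := by
  obtain ⟨ω, b, h1, h2⟩ := ht x hxφ
  obtain ⟨ω₀, h₀⟩ := hs
  by_contra hn
  have h3 : eval (D.piecewise (Function.update ω x b) ω₀) ψ = true := by
    rw [← h ω ω₀ h1 h₀]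
    refine eval_congr fun y hy => ?_
    have : y ≠ x := by
      rintro rfl
      exact hn hy
    simp [Finset.piecewise, this]
  have h4 := h' _ ω h3 h1
  rw [eval_congr (ω' := Function.update ω x b), h2] at h4
  · cases h4
  · intro y _
    by_cases hy : y ∈ D
    · simp [Finset.piecewise, hy]
    · have : y ≠ x := by
        rintro rfl
        exact hy hx
      simp [Finset.piecewise, hy, this]

/-- If the parts on `D` of the models agree, then so do the splitting sets inside `D`. -/
theorem Transplants.splits {D : Finset ℕ} {φ : Formula} {F : List Formula}
    (h : Transplants D φ (bigAnd F)) (h' : Transplants D (bigAnd F) φ) (hF : Apart F)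
    (hs : (bigAnd F).Sat) {χ : Formula} (hχ : χ ∈ F) (hD : χ.vars ⊆ D) : φ.Splits χ.vars := by
  intro ω ω' hω hω'
  obtain ⟨ω₀, h₀⟩ := hs
  have := h' _ ω' (hF.splits hχ _ _ (h ω ω₀ hω h₀) (h ω' ω₀ hω' h₀)) hω'
  rw [← this]
  congr 1
  funext y
  by_cases hy : y ∈ D
  · simp [Finset.piecewise, hy]
  · have : y ∉ χ.vars := fun h => hy (hD h)
    simp [Finset.piecewise, hy, this]

/-- If both factorizations respect the set `D`, then the factor of the first one that contains a
given variable from `D` is included in the corresponding factor of the second one. -/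
theorem Transplants.vars_subset {j : ℕ∞} {D : Finset ℕ} {F F' : List Formula}
    (h : Transplants D (bigAnd F) (bigAnd F')) (h' : Transplants D (bigAnd F') (bigAnd F))
    (hF : Apart F) (hF' : Apart F') (hs : ∀ ψ ∈ F, ψ.Sat) (hs' : ∀ ψ ∈ F', ψ.Sat)
    (ht : ∀ ψ ∈ F, ψ.Tight) (hr : ∀ ψ ∈ F, ψ.Rigid j) (hl' : AtMostOneLarge j F')
    (hD : ∀ ψ ∈ F, ∀ x ∈ ψ.vars, x ∈ D → ψ.vars ⊆ D)
    (hD' : ∀ ψ ∈ F', ∀ x ∈ ψ.vars, x ∈ D → ψ.vars ⊆ D)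
    {ψ χ : Formula} (hψ : ψ ∈ F) (hχ : χ ∈ F') {x : ℕ} (hx : x ∈ D) (hxψ : x ∈ ψ.vars)
    (hxχ : x ∈ χ.vars) : ψ.vars ⊆ χ.vars := by
  have sat := hF.sat hs
  have sat' := hF'.sat hs'
  have cut : ∀ χ ∈ F', ∀ y ∈ ψ.vars, y ∈ χ.vars → ¬ ψ.vars ⊆ χ.vars →
      j < (χ.vars.card : ℕ∞) := by
    intro χ hχ y hy hyχ hsub
    have hyD := hD ψ hψ x hxψ hx hy
    refine (hr ψ hψ (χ.vars ∩ ψ.vars) Finset.inter_subset_right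
      (hF.splits_inter sat hψ (h.splits h' hF' sat' hχ (hD' χ hχ y hyχ hyD)))
      ⟨y, Finset.mem_inter.2 ⟨hyχ, hy⟩⟩ fun h => hsub (Finset.inter_eq_right.1 h)).trans_le ?_
    exact_mod_cast Finset.card_le_card Finset.inter_subset_left
  by_contra hsub
  obtain ⟨z, hz, hzχ⟩ := Finset.not_subset.1 hsub
  have hzF' := h.mem_vars h' (hF.tight hs ht) sat' (hD ψ hψ x hxψ hx hz)
    (mem_vars_bigAnd.2 ⟨ψ, hψ, hz⟩)
  obtain ⟨χ', hχ', hzχ'⟩ := mem_vars_bigAnd.1 hzF'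
  have hne : χ ≠ χ' := by
    rintro rfl
    exact hzχ hzχ'
  exact hne (hl' χ hχ χ' hχ' (cut χ hχ x hxψ hxχ hsub) (cut χ' hχ' z hz hzχ'
    fun h => Finset.disjoint_left.1 (hF' χ hχ χ' hχ' hne) hxχ (h hxψ)))

theorem Transplants.eval {D : Finset ℕ} {F F' : List Formula}
    (h : Transplants D (bigAnd F) (bigAnd F')) (hF : Apart F) (hs : (bigAnd F).Sat)
    (hs' : (bigAnd F').Sat) {ψ χ : Formula} (hψ : ψ ∈ F) (hχ : χ ∈ F') (hv : χ.vars = ψ.vars)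
    (hD : ψ.vars ⊆ D) {ω : ℕ → Bool} (hω : eval ω ψ = true) : eval ω χ = true := by
  obtain ⟨ω₁, h₁⟩ := hs
  obtain ⟨ω₂, h₂⟩ := hs'
  rw [← eval_bigAnd.1 (h _ _ (hF.eval_piecewise hψ hω h₁) h₂) χ hχ]
  refine eval_congr fun x hx => ?_
  rw [hv] at hx
  simp [Finset.piecewise, hx, hD hx]

/-- The decision between two conjunctions of rigid formulas without a common factor is rigid.
A set that splits the decision formula induces a set `D` of variables, not containing `x`, whose
part of the models is the same for both conjunctions.  If one side of the split had at most `j`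
variables, it could not cut a factor, and the two conjunctions would have the same factors
inside `D`. -/
theorem rigid_choice {j : ℕ∞} {x : ℕ} {F F' : List Formula} (hF : Apart F) (hF' : Apart F')
    (hs : ∀ ψ ∈ F, ψ.Sat) (hs' : ∀ ψ ∈ F', ψ.Sat) (ht : ∀ ψ ∈ F, ψ.Tight)
    (ht' : ∀ ψ ∈ F', ψ.Tight) (hr : ∀ ψ ∈ F, ψ.Rigid j) (hr' : ∀ ψ ∈ F', ψ.Rigid j)
    (hl : AtMostOneLarge j F) (hl' : AtMostOneLarge j F') (hx : x ∉ (bigAnd F).vars)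
    (hx' : x ∉ (bigAnd F').vars) (hne : ∀ ψ ∈ F, ∀ χ ∈ F', ¬ ψ.Equivalent χ) :
    (choice x (bigAnd F) (bigAnd F')).Rigid j := by
  intro B hBv hB hBn hBne
  by_contra hj
  set f := choice x (bigAnd F) (bigAnd F') with hf
  have sat := hF.sat hs
  have sat' := hF'.sat hs'
  -- `D` is the side of the split that does not contain `x`.
  obtain ⟨D, hDv, hD, hxD, hDn, hDB⟩ : ∃ D ⊆ f.vars, f.Splits D ∧ x ∉ D ∧ D.Nonempty ∧
      (B = D ∨ B = f.vars \ D) := by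
    by_cases hxB : x ∈ B
    · refine ⟨f.vars \ B, Finset.sdiff_subset, hB.sdiff, by simp [hxB], ?_, Or.inr ?_⟩
      · rw [Finset.sdiff_nonempty]
        exact fun h => hBne (hBv.antisymm h)
      · exact (Finset.sdiff_sdiff_eq_self hBv).symm
    · exact ⟨B, hBv, hB, hxB, hBn, Or.inl rfl⟩
  have ev : ∀ ω, Bool.not (ω x) = true → eval ω f = eval ω (bigAnd F) := fun ω h => by
    rw [hf, eval_choice]
    cases h' : ω x <;> simp_all
  have ev' : ∀ ω, ω x = true → eval ω f = eval ω (bigAnd F') := fun ω h => by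
    rw [hf, eval_choice, h]
    simp
  have up : ∀ {φ : Formula} (ω b), x ∉ φ.vars → eval (Function.update ω x b) φ = eval ω φ :=
    fun ω b hφ => eval_congr fun y hy => by
      rw [Function.update_of_ne]
      rintro rfl
      exact hφ hy
  have pw : ∀ (ω ω' : ℕ → Bool) (b c : Bool), D.piecewise (Function.update ω x b)
      (Function.update ω' x c) = Function.update (D.piecewise ω ω') x c := by
    intro ω ω' b c
    funext y
    by_cases hy : y = x
    · subst hy
      simp [Finset.piecewise, hxD]
    · simp [Finset.piecewise, hy]
  have t1 : Transplants D (bigAnd F) (bigAnd F') := by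
    intro ω ω' h h'
    rw [← up _ true hx', ← pw ω ω' false true, ← ev' _ (by simp [Finset.piecewise, hxD])]
    refine hD _ _ ?_ ?_
    · rw [ev _ (by simp), up _ _ hx, h]
    · rw [ev' _ (by simp), up _ _ hx', h']
  have t2 : Transplants D (bigAnd F') (bigAnd F) := by
    intro ω ω' h h'
    rw [← up _ false hx, ← pw ω ω' true false, ← ev _ (by simp [Finset.piecewise, hxD])]
    refine hD _ _ ?_ ?_
    · rw [ev' _ (by simp), up _ _ hx', h]
    · rw [ev _ (by simp), up _ _ hx, h']
  have t3 : (bigAnd F).Splits D := by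
    intro ω ω' h h'
    rw [← up _ false hx, ← pw ω ω' false false, ← ev _ (by simp [Finset.piecewise, hxD])]
    refine hD _ _ ?_ ?_
    · rw [ev _ (by simp), up _ _ hx, h]
    · rw [ev _ (by simp), up _ _ hx, h']
  have t4 : (bigAnd F').Splits D := by
    intro ω ω' h h'
    rw [← up _ true hx', ← pw ω ω' true true, ← ev' _ (by simp [Finset.piecewise, hxD])]
    refine hD _ _ ?_ ?_
    · rw [ev' _ (by simp), up _ _ hx', h]
    · rw [ev' _ (by simp), up _ _ hx', h']
  have sep : ∀ ψ : Formula, ψ.Rigid j → ψ.vars ⊆ f.vars → ψ.Splits (D ∩ ψ.vars) →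
      ∀ y ∈ ψ.vars, y ∈ D → ψ.vars ⊆ D := by
    intro ψ hrψ hψf hsp y hy hyD
    by_contra hsub
    obtain ⟨z, hz, hzD⟩ := Finset.not_subset.1 hsub
    apply hj
    rcases hDB with rfl | hDB
    · refine (hrψ (B ∩ ψ.vars) Finset.inter_subset_right hsp
        ⟨y, Finset.mem_inter.2 ⟨hyD, hy⟩⟩
        fun h => hsub (Finset.inter_eq_right.1 h)).trans_le ?_
      exact_mod_cast Finset.card_le_card Finset.inter_subset_left
    · refine (hrψ _ Finset.sdiff_subset hsp.sdiff ⟨z, by simp [hz, hzD]⟩ ?_).trans_le ?_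
      · intro h
        rw [← h] at hy
        simp [hyD] at hy
      · rw [hDB]
        refine Nat.cast_le.2 (Finset.card_le_card fun a ha => ?_)
        simp only [Finset.mem_sdiff, Finset.mem_inter, not_and] at ha ⊢
        exact ⟨hψf ha.1, fun h => ha.2 h ha.1⟩
  have vF : ∀ ψ ∈ F, ψ.vars ⊆ f.vars := fun ψ hψ y hy => by
    simp only [hf, vars_choice, Finset.mem_insert, Finset.mem_union]
    exact Or.inr (Or.inl (mem_vars_bigAnd.2 ⟨ψ, hψ, hy⟩))
  have vF' : ∀ ψ ∈ F', ψ.vars ⊆ f.vars := fun ψ hψ y hy => by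
    simp only [hf, vars_choice, Finset.mem_insert, Finset.mem_union]
    exact Or.inr (Or.inr (mem_vars_bigAnd.2 ⟨ψ, hψ, hy⟩))
  have s1 : ∀ ψ ∈ F, ∀ y ∈ ψ.vars, y ∈ D → ψ.vars ⊆ D := fun ψ hψ =>
    sep ψ (hr ψ hψ) (vF ψ hψ) (hF.splits_inter sat hψ t3)
  have s2 : ∀ ψ ∈ F', ∀ y ∈ ψ.vars, y ∈ D → ψ.vars ⊆ D := fun ψ hψ =>
    sep ψ (hr' ψ hψ) (vF' ψ hψ) (hF'.splits_inter sat' hψ t4)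
  obtain ⟨y, hy⟩ := hDn
  have hyx : y ≠ x := by
    rintro rfl
    exact hxD hy
  have hyF : y ∈ (bigAnd F).vars ∧ y ∈ (bigAnd F').vars := by
    have h := hDv hy
    simp only [hf, vars_choice, Finset.mem_insert, Finset.mem_union, hyx, false_or] at h
    rcases h with h | h
    · exact ⟨h, t1.mem_vars t2 (hF.tight hs ht) sat' hy h⟩
    · exact ⟨t2.mem_vars t1 (hF'.tight hs' ht') sat hy h, h⟩
  obtain ⟨ψ, hψ, hyψ⟩ := mem_vars_bigAnd.1 hyF.1
  obtain ⟨χ, hχ, hyχ⟩ := mem_vars_bigAnd.1 hyF.2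
  have hv : ψ.vars = χ.vars :=
    (t1.vars_subset t2 hF hF' hs hs' ht hr hl' s1 s2 hψ hχ hy hyψ hyχ).antisymm
      (t2.vars_subset t1 hF' hF hs' hs ht' hr' hl s2 s1 hχ hψ hy hyχ hyψ)
  refine hne ψ hψ χ hχ (equivalent_of_imp (fun ω h => ?_) fun ω h => ?_)
  · exact t1.eval hF sat sat' hψ hχ hv.symm (s1 ψ hψ y hyψ hy) h
  · exact t2.eval hF' sat' sat hχ hψ hv (s2 χ hχ y hyχ hy) h

end Formula

/-! ### Formulas of diagrams -/

open Formula

namespace Diagram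

/-- The formula represented by a node whose children are vertices of `G`. -/
def nodeTheta (G : Diagram) : Node → Formula
  | .leaf false => .fls
  | .leaf true => .tru
  | .dec x lo hi => .choice x (theta G lo) (theta G hi)
  | .conj ch => .bigAnd (ch.map (theta G))

theorem mem_names {G : Diagram} {v : ℕ} : v ∈ names G ↔ ∃ nd, (v, nd) ∈ G := by
  simp [names]

theorem mem_names_of_mem {G : Diagram} {v : ℕ} {nd : Node} (h : (v, nd) ∈ G) : v ∈ names G :=
  mem_names.2 ⟨nd, h⟩

theorem names_subset {D G : Diagram} (h : D ⊆ G) : names D ⊆ names G :=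
  List.map_subset _ h

theorem theta_cons_self {G : Diagram} {u : ℕ} {nd : Node} :
    theta ((u, nd) :: G) u = nodeTheta G nd := by
  rcases nd with (_ | _) | _ | _ <;> simp [theta, nodeTheta]

theorem theta_cons_of_ne {G : Diagram} {u v : ℕ} {nd : Node} (h : v ≠ u) :
    theta ((u, nd) :: G) v = theta G v := by
  rw [theta.eq_def]
  exact if_neg h

theorem map_theta_congr {G G' : Diagram} {l : List ℕ} (h : ∀ w ∈ l, theta G w = theta G' w) :
    l.map (theta G) = l.map (theta G') :=
  List.map_congr_left h

theorem nodeTheta_congr {G G' : Diagram} {nd : Node}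
    (h : ∀ w ∈ nd.children, theta G w = theta G' w) : nodeTheta G nd = nodeTheta G' nd := by
  rcases nd with (_ | _) | ⟨x, lo, hi⟩ | ch
  · rfl
  · rfl
  · simp only [nodeTheta, h lo (by simp [Node.children]), h hi (by simp [Node.children])]
  · exact congrArg bigAnd (map_theta_congr h)

namespace WellFormed

theorem nodup {G : Diagram} (h : WellFormed G) : (names G).Nodup := by
  induction G with
  | nil => exact List.nodup_nil
  | cons e G ih => exact List.nodup_cons.2 ⟨h.1, ih h.2.2⟩

theorem node_eq {G : Diagram} (h : WellFormed G) {u : ℕ} {nd nd' : Node} (h1 : (u, nd) ∈ G)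
    (h2 : (u, nd') ∈ G) : nd = nd' := by
  induction G with
  | nil => cases h1
  | cons e G ih =>
    obtain ⟨v, nd₀⟩ := e
    rw [List.mem_cons] at h1 h2
    rcases h1 with h1 | h1 <;> rcases h2 with h2 | h2
    · cases h1
      cases h2
      rfl
    · cases h1
      exact absurd (mem_names_of_mem h2) h.1
    · cases h2
      exact absurd (mem_names_of_mem h1) h.1
    · exact ih h.2.2 h1 h2

theorem child_mem {G : Diagram} (h : WellFormed G) {u w : ℕ} {nd : Node} (h1 : (u, nd) ∈ G)
    (hw : w ∈ nd.children) : w ∈ names G := by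
  induction G with
  | nil => cases h1
  | cons e G ih =>
    obtain ⟨v, nd₀⟩ := e
    refine List.mem_cons_of_mem _ ?_
    rcases List.mem_cons.1 h1 with h1 | h1
    · cases h1
      exact h.2.1 w hw
    · exact ih h.2.2 h1

theorem theta_eq {G : Diagram} (h : WellFormed G) {v : ℕ} {nd : Node} (hv : (v, nd) ∈ G) :
    theta G v = nodeTheta G nd := by
  induction G with
  | nil => cases hv
  | cons e G ih =>
    obtain ⟨u, nd₀⟩ := e
    have ne : ∀ w ∈ names G, theta ((u, nd₀) :: G) w = theta G w := fun w hw =>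
      theta_cons_of_ne (by
        rintro rfl
        exact h.1 hw)
    rcases List.mem_cons.1 hv with hv | hv
    · cases hv
      rw [theta_cons_self]
      exact nodeTheta_congr fun w hw => (ne w (h.2.1 w hw)).symm
    · rw [ne v (mem_names_of_mem hv), ih h.2.2 hv]
      exact nodeTheta_congr fun w hw => (ne w (h.2.2.child_mem hv hw)).symm

theorem theta_dec {G : Diagram} (h : WellFormed G) {v x lo hi : ℕ}
    (hv : (v, Node.dec x lo hi) ∈ G) : theta G v = choice x (theta G lo) (theta G hi) :=
  h.theta_eq hv

theorem theta_conj {G : Diagram} (h : WellFormed G) {v : ℕ} {ch : List ℕ}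
    (hv : (v, Node.conj ch) ∈ G) : theta G v = bigAnd (ch.map (theta G)) :=
  h.theta_eq hv

/-- Induction along the edges of a diagram. -/
theorem induction {G : Diagram} (h : WellFormed G) {P : ℕ → Prop}
    (step : ∀ v nd, (v, nd) ∈ G → (∀ w ∈ nd.children, P w) → P v) : ∀ v ∈ names G, P v := by
  suffices H : ∀ D : Diagram, WellFormed D → D ⊆ G → ∀ v ∈ names D, P v from
    H G h (List.Subset.refl G)
  intro D
  induction D with
  | nil => simp [names]
  | cons e D ih =>
    intro hD hs v hv
    have ih' := ih hD.2.2 fun a ha => hs (List.mem_cons_of_mem _ ha)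
    rcases List.mem_cons.1 hv with rfl | hv
    · exact step _ e.2 (hs List.mem_cons_self) fun w hw => ih' w (hD.2.1 w hw)
    · exact ih' v hv

theorem theta_eq_of_subset {D G : Diagram} (hD : WellFormed D) (hG : WellFormed G) (hs : D ⊆ G) :
    ∀ v ∈ names D, theta D v = theta G v :=
  hD.induction fun v nd hv ih => by
    rw [hD.theta_eq hv, hG.theta_eq (hs hv)]
    exact nodeTheta_congr ih

/-- The variables of the formula of a vertex are those of its decision descendants. -/
theorem mem_vars_theta {G : Diagram} (h : WellFormed G) {y : ℕ} : ∀ v ∈ names G,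
    (y ∈ (theta G v).vars ↔
      ∃ w lo hi, Relation.ReflTransGen (Edge G) v w ∧ (w, Node.dec y lo hi) ∈ G) := by
  intro v hv
  constructor
  · revert v
    refine h.induction fun v nd hv ih hy => ?_
    have key : ∀ w ∈ nd.children, y ∈ (theta G w).vars →
        ∃ w lo hi, Relation.ReflTransGen (Edge G) v w ∧ (w, Node.dec y lo hi) ∈ G := by
      intro w hw hyw
      obtain ⟨w', lo, hi, h1, h2⟩ := ih w hw hyw
      exact ⟨w', lo, hi, Relation.ReflTransGen.head ⟨nd, hv, hw⟩ h1, h2⟩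
    rw [h.theta_eq hv] at hy
    rcases nd with (_ | _) | ⟨x, lo, hi⟩ | ch
    · simp [nodeTheta, vars] at hy
    · simp [nodeTheta, vars] at hy
    · simp only [nodeTheta, vars_choice, Finset.mem_insert, Finset.mem_union] at hy
      rcases hy with rfl | hy | hy
      · exact ⟨v, lo, hi, Relation.ReflTransGen.refl, hv⟩
      · exact key lo (by simp [Node.children]) hy
      · exact key hi (by simp [Node.children]) hy
    · simp only [nodeTheta, mem_vars_bigAnd, List.mem_map] at hy
      obtain ⟨_, ⟨w, hw, rfl⟩, hy⟩ := hy
      exact key w hw hy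
  · rintro ⟨w, lo, hi, hr, hw⟩
    induction hr using Relation.ReflTransGen.head_induction_on with
    | refl =>
      rw [h.theta_dec hw, vars_choice]
      exact Finset.mem_insert_self _ _
    | head he _ ih =>
      obtain ⟨nd, hn, hc⟩ := he
      have hy := ih (h.child_mem hn hc)
      rw [h.theta_eq hn]
      rcases nd with b | ⟨x, lo, hi⟩ | ch
      · simp [Node.children] at hc
      · simp only [Node.children, List.mem_cons, List.not_mem_nil, or_false] at hc
        simp only [nodeTheta, vars_choice, Finset.mem_insert, Finset.mem_union]
        rcases hc with rfl | rfl
        · exact Or.inr (Or.inl hy)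
        · exact Or.inr (Or.inr hy)
      · simp only [nodeTheta, mem_vars_bigAnd]
        exact ⟨_, List.mem_map_of_mem hc, hy⟩

/-- The vertices of a diagram have together at most as many variables as there are vertices. -/
theorem card_le {G : Diagram} (h : WellFormed G) {B : Finset ℕ}
    (hB : ∀ y ∈ B, ∃ v ∈ names G, y ∈ (theta G v).vars) : B.card ≤ G.length := by
  classical
  let f : ℕ × Node → ℕ := fun e => match e.2 with
    | .dec x _ _ => x
    | _ => 0
  have : B ⊆ (G.map f).toFinset := by
    intro y hy
    obtain ⟨v, hv, hy⟩ := hB y hy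
    obtain ⟨w, lo, hi, -, hw⟩ := (h.mem_vars_theta v hv).1 hy
    exact List.mem_toFinset.2 (List.mem_map.2 ⟨_, hw, rfl⟩)
  exact (Finset.card_le_card this).trans ((List.toFinset_card_le _).trans (by simp))

end WellFormed

theorem length_le_size {G : Diagram} (hw : WellFormed G) (hr : Rooted G) :
    G.length ≤ G.size + 1 := by
  classical
  obtain ⟨r, -, hr⟩ := hr
  have h1 : names G ⊆ r :: G.flatMap fun e => e.2.children := by
    intro v hv
    rcases Relation.ReflTransGen.cases_tail (hr v hv) with h | ⟨u, -, nd, hu, hc⟩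
    · exact h ▸ List.mem_cons_self
    · exact List.mem_cons_of_mem _ (List.mem_flatMap.2 ⟨_, hu, hc⟩)
  have h2 := (hw.nodup.subperm h1).length_le
  simpa [names, List.length_flatMap, size] using h2

/-! ### Canonicity of reduced diagrams -/

/-- The structure shared by all reduced and ordered diagrams, with the order expressed through
the variables of the formulas. -/
structure Basic (G : Diagram) : Prop where
  wf : WellFormed G
  reduced : Reduced G
  order : ∀ v x lo hi, (v, Node.dec x lo hi) ∈ G →
    ∀ y, y ∈ (theta G lo).vars ∨ y ∈ (theta G hi).vars → x < y
  length : ∀ v ch, (v, Node.conj ch) ∈ G → 1 < ch.length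
  nonempty : ∀ v ch, (v, Node.conj ch) ∈ G → ∀ w ∈ ch, (theta G w).vars.Nonempty
  disjoint : ∀ v ch, (v, Node.conj ch) ∈ G →
    (ch.map (theta G)).Pairwise fun ψ χ => Disjoint ψ.vars χ.vars

/-- A diagram that satisfies all conditions on a ROBDD[∧_ĵ] except for having a root. -/
structure Canon (j : ℕ∞) (G : Diagram) : Prop extends Basic G where
  finest_conj : ∀ v ch, (v, Node.conj ch) ∈ G →
    IsFinestDecomposition j (ch.map (theta G)) (theta G v)
  finest_dec : ∀ v x lo hi, (v, Node.dec x lo hi) ∈ G →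
    IsFinestDecomposition j [theta G v] (theta G v)

/-- A local criterion for `Canon`: decision vertices are rigid, and `∧`-vertices have decision
vertices as children, at most one of them with more than `j` variables. -/
structure Good (j : ℕ∞) (G : Diagram) : Prop extends Basic G where
  rigid : ∀ v x lo hi, (v, Node.dec x lo hi) ∈ G → (theta G v).Rigid j
  isDec : ∀ v ch, (v, Node.conj ch) ∈ G → ∀ w ∈ ch, ∃ x lo hi, (w, Node.dec x lo hi) ∈ G
  large : ∀ v ch, (v, Node.conj ch) ∈ G → AtMostOneLarge j (ch.map (theta G))

theorem Basic.of_subset {D G : Diagram} (hG : Basic G) (hD : WellFormed D) (hs : D ⊆ G) :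
    Basic D := by
  have ht := hD.theta_eq_of_subset hG.wf hs
  have hm : ∀ {v ch}, (v, Node.conj ch) ∈ D → ch.map (theta D) = ch.map (theta G) :=
    fun h => map_theta_congr fun w hw => ht w (hD.child_mem h hw)
  refine ⟨hD, ⟨fun u v nd nd' h h' => hG.reduced.1 u v nd nd' (hs h) (hs h'),
    fun u x lo hi h => hG.reduced.2 u x lo hi (hs h)⟩, fun v x lo hi h => ?_,
    fun v ch h => hG.length v ch (hs h), fun v ch h w hw => ?_, fun v ch h => ?_⟩
  · rw [ht lo (hD.child_mem h (by simp [Node.children])),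
      ht hi (hD.child_mem h (by simp [Node.children]))]
    exact hG.order v x lo hi (hs h)
  · rw [ht w (hD.child_mem h hw)]
    exact hG.nonempty v ch (hs h) w hw
  · rw [hm h]
    exact hG.disjoint v ch (hs h)

theorem Canon.of_subset {j : ℕ∞} {D G : Diagram} (hG : Canon j G) (hD : WellFormed D)
    (hs : D ⊆ G) : Canon j D := by
  have ht := hD.theta_eq_of_subset hG.wf hs
  refine ⟨hG.toBasic.of_subset hD hs, fun v ch h => ?_, fun v x lo hi h => ?_⟩
  · rw [ht v (mem_names_of_mem h), map_theta_congr (l := ch) fun w hw => ht w (hD.child_mem h hw)]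
    exact hG.finest_conj v ch (hs h)
  · rw [ht v (mem_names_of_mem h)]
    exact hG.finest_dec v x lo hi (hs h)

theorem eval_update_choice {x : ℕ} {b : Bool} {φ ψ : Formula} {ω : ℕ → Bool} :
    eval (Function.update ω x b) (choice x φ ψ) =
      eval (Function.update ω x b) (if b then ψ else φ) := by
  rw [eval_choice]
  cases b <;> simp

theorem eval_update_of_not_mem {x : ℕ} {b : Bool} {φ : Formula} {ω : ℕ → Bool}
    (h : x ∉ φ.vars) : eval (Function.update ω x b) φ = eval ω φ :=
  eval_congr fun y hy => by
    rw [Function.update_of_ne]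
    rintro rfl
    exact h hy

section Basic

variable {G : Diagram}

theorem Basic.not_mem_lo (hG : Basic G) {v x lo hi : ℕ} (h : (v, Node.dec x lo hi) ∈ G) :
    x ∉ (theta G lo).vars :=
  fun hx => (hG.order v x lo hi h x (Or.inl hx)).false

theorem Basic.not_mem_hi (hG : Basic G) {v x lo hi : ℕ} (h : (v, Node.dec x lo hi) ∈ G) :
    x ∉ (theta G hi).vars :=
  fun hx => (hG.order v x lo hi h x (Or.inr hx)).false

theorem sat_choice_left {x : ℕ} {φ ψ : Formula} (h : φ.Sat) (hx : x ∉ φ.vars) :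
    (choice x φ ψ).Sat := by
  obtain ⟨ω, hω⟩ := h
  refine ⟨Function.update ω x false, ?_⟩
  rw [eval_update_choice]
  simpa [eval_update_of_not_mem hx] using hω

theorem sat_choice_right {x : ℕ} {φ ψ : Formula} (h : ψ.Sat) (hx : x ∉ ψ.vars) :
    (choice x φ ψ).Sat := by
  obtain ⟨ω, hω⟩ := h
  refine ⟨Function.update ω x true, ?_⟩
  rw [eval_update_choice]
  simpa [eval_update_of_not_mem hx] using hω

theorem vars_leaf (hG : WellFormed G) {v : ℕ} {b : Bool} (h : (v, Node.leaf b) ∈ G) :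
    (theta G v).vars = ∅ := by
  rw [hG.theta_eq h]
  cases b <;> rfl

/-- Only the leaf `⊥` is unsatisfiable. -/
theorem Basic.sat (hG : Basic G) {v : ℕ} {nd : Node} (hv : (v, nd) ∈ G)
    (hn : nd ≠ .leaf false) : (theta G v).Sat := by
  suffices H : ∀ v ∈ names G, ∀ nd, (v, nd) ∈ G → nd ≠ .leaf false → (theta G v).Sat from
    H v (mem_names_of_mem hv) nd hv hn
  refine hG.wf.induction fun v nd hv ih nd' hv' hn => ?_
  obtain rfl := hG.wf.node_eq hv hv'
  rw [hG.wf.theta_eq hv]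
  rcases nd with (_ | _) | ⟨x, lo, hi⟩ | ch
  · exact absurd rfl hn
  · exact ⟨fun _ => true, rfl⟩
  · have hlo : lo ∈ names G := hG.wf.child_mem hv (by simp [Node.children])
    have hhi : hi ∈ names G := hG.wf.child_mem hv (by simp [Node.children])
    obtain ⟨nl, hl⟩ := mem_names.1 hlo
    obtain ⟨nh, hh⟩ := mem_names.1 hhi
    by_cases h1 : nl = .leaf false
    · by_cases h2 : nh = .leaf false
      · subst h1 h2
        exact absurd (hG.reduced.1 lo hi _ _ hl hh rfl) (hG.reduced.2 v x lo hi hv)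
      · exact sat_choice_right (ih hi (by simp [Node.children]) nh hh h2) (hG.not_mem_hi hv)
    · exact sat_choice_left (ih lo (by simp [Node.children]) nl hl h1) (hG.not_mem_lo hv)
  · refine (pairwise_disjoint_apart (hG.disjoint v ch hv)).sat fun ψ hψ => ?_
    obtain ⟨w, hw, rfl⟩ := List.mem_map.1 hψ
    obtain ⟨nw, hnw⟩ := mem_names.1 (hG.wf.child_mem hv hw)
    refine ih w hw nw hnw ?_
    rintro rfl
    have := hG.nonempty v ch hv w hw
    rw [vars_leaf hG.wf hnw] at this
    exact Finset.not_nonempty_empty this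

theorem Basic.sat_child (hG : Basic G) {v w : ℕ} {ch : List ℕ} (hv : (v, Node.conj ch) ∈ G)
    (hw : w ∈ ch) : (theta G w).Sat := by
  obtain ⟨nw, hnw⟩ := mem_names.1 (hG.wf.child_mem hv hw)
  refine hG.sat hnw ?_
  rintro rfl
  have := hG.nonempty v ch hv w hw
  rw [vars_leaf hG.wf hnw] at this
  exact Finset.not_nonempty_empty this

theorem Basic.apart (hG : Basic G) {v : ℕ} {ch : List ℕ} (hv : (v, Node.conj ch) ∈ G) :
    Apart (ch.map (theta G)) :=
  pairwise_disjoint_apart (hG.disjoint v ch hv)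

/-- The variable `x` is essential as the two formulas differ, and a variable of one of them is
essential since `x` can be set so as to select this formula. -/
theorem tight_choice {x : ℕ} {φ ψ : Formula} (hφ : φ.Tight) (hψ : ψ.Tight) (hx : x ∉ φ.vars)
    (hx' : x ∉ ψ.vars) (hne : ¬ φ.Equivalent ψ) : (choice x φ ψ).Tight := by
  refine tight_of_ne fun y hy => ?_
  have key : ∀ (b : Bool) (χ : Formula), χ = (if b then ψ else φ) → χ.Tight → x ∉ χ.vars →
      y ∈ χ.vars → ∃ ω c, eval ω (choice x φ ψ) ≠ eval (Function.update ω y c) (choice x φ ψ) := by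
    intro b χ hχ ht hxχ hyχ
    obtain ⟨ω, c, h1, h2⟩ := ht y hyχ
    have hyx : y ≠ x := by
      rintro rfl
      exact hxχ hyχ
    refine ⟨Function.update ω x b, c, ?_⟩
    rw [Function.update_comm hyx.symm, eval_update_choice, eval_update_choice, ← hχ,
      eval_update_of_not_mem hxχ, eval_update_of_not_mem hxχ, h1, h2]
    simp
  rw [vars_choice, Finset.mem_insert, Finset.mem_union] at hy
  rcases hy with rfl | hy | hy
  · simp only [Equivalent, not_forall] at hne
    obtain ⟨ω, hω⟩ := hne
    refine ⟨Function.update ω y false, true, ?_⟩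
    rw [Function.update_idem, eval_update_choice, eval_update_choice]
    simpa [eval_update_of_not_mem hx, eval_update_of_not_mem hx'] using hω
  · exact key false φ rfl hφ hx hy
  · exact key true ψ rfl hψ hx' hy

end Basic

theorem _root_.AndBDD.IsBoundedDecomposition.congr {j : ℕ∞} {Ψ : List Formula} {φ φ' : Formula}
    (h : IsBoundedDecomposition j Ψ φ) (e : φ.Equivalent φ') (hv : φ.vars = φ'.vars) :
    IsBoundedDecomposition j Ψ φ' :=
  ⟨⟨e.symm.trans h.1.equiv, h.1.nonempty, h.1.disjoint, fun x => by rw [← hv, h.1.cover]⟩, h.2⟩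

section Canon

variable {j : ℕ∞} {G : Diagram}

/-- Equivalent `∧`-vertices give finest decompositions with the same partition of the variables, and
hence, up to equivalence, with the same members. -/
theorem Canon.conj_subset (hG : Canon j G) {v w : ℕ} {ch ch' : List ℕ}
    (hv : (v, Node.conj ch) ∈ G) (hw : (w, Node.conj ch') ∈ G)
    (e : (theta G v).Equivalent (theta G w)) (hvars : (theta G v).vars = (theta G w).vars)
    (hC : ∀ c ∈ ch, ∀ c' ∈ ch', (theta G c).Equivalent (theta G c') → c = c') : ch ⊆ ch' := by
  intro c hc
  have hA := hG.apart hv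
  have hA' := hG.apart hw
  have b := (hG.finest_conj v ch hv).1.congr e hvars
  have b' := (hG.finest_conj w ch' hw).1.congr e.symm hvars.symm
  obtain ⟨_, h1, hs⟩ := (hG.finest_conj v ch hv).2 _ b' _ (List.mem_map_of_mem hc)
  obtain ⟨c', hc', rfl⟩ := List.mem_map.1 h1
  obtain ⟨χ, hχ, hs'⟩ := (hG.finest_conj w ch' hw).2 _ b _ h1
  obtain ⟨y, hy⟩ := hG.nonempty v ch hv c hc
  have hcχ : theta G c = χ := by
    by_contra hne
    exact Finset.disjoint_left.1 (hA _ (List.mem_map_of_mem hc) _ hχ hne) hy (hs' (hs hy))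
  have hcc : (theta G c).vars = (theta G c').vars := hs.antisymm (hcχ ▸ hs')
  have imp : ∀ {F F' : List Formula} {ψ χ : Formula}, Apart F → (bigAnd F).Sat →
      (bigAnd F).Equivalent (bigAnd F') → ψ ∈ F → χ ∈ F' → ψ.vars = χ.vars → ∀ ω,
      eval ω ψ = true → eval ω χ = true := by
    intro F F' ψ χ hF ⟨ω₀, h₀⟩ e hψ hχ hvv ω hω
    have := hF.eval_piecewise hψ hω h₀
    rw [e] at this
    have := eval_bigAnd.1 this χ hχ
    rwa [hvv, eval_piecewise_vars] at this
  have hsv := hG.sat hv (by simp)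
  have hsw := hG.sat hw (by simp)
  rw [hG.wf.theta_conj hv] at e hsv
  rw [hG.wf.theta_conj hw] at e hsw
  have := hC c hc c' hc' (equivalent_of_imp
    (imp hA hsv e (List.mem_map_of_mem hc) h1 hcc)
    (imp hA' hsw e.symm h1 (List.mem_map_of_mem hc) hcc.symm))
  rwa [this]

theorem two_members {F : List Formula} (hF : F.Pairwise fun ψ χ => Disjoint ψ.vars χ.vars)
    (hn : ∀ ψ ∈ F, ψ.vars.Nonempty) (hl : 1 < F.length) :
    ∃ ψ ∈ F, ∃ χ ∈ F, ψ ≠ χ := by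
  obtain ⟨ψ, χ, l, rfl⟩ : ∃ ψ χ l, F = ψ :: χ :: l := by
    rcases F with _ | ⟨ψ, _ | ⟨χ, l⟩⟩
    · simp at hl
    · simp at hl
    · exact ⟨ψ, χ, l, rfl⟩
  refine ⟨ψ, by simp, χ, by simp, ?_⟩
  rintro rfl
  have := (List.pairwise_cons.1 hF).1 ψ (by simp)
  exact (hn ψ (by simp)).ne_empty (by simpa using this)

/-- The finest decomposition of the formula of a `∧`-vertex has more than one member. -/
theorem Canon.not_conj_dec (hG : Canon j G) {v w x lo hi : ℕ} {ch : List ℕ}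
    (hv : (v, Node.conj ch) ∈ G) (hw : (w, Node.dec x lo hi) ∈ G)
    (e : (theta G v).Equivalent (theta G w)) (hvars : (theta G v).vars = (theta G w).vars) :
    False := by
  have hA := hG.apart hv
  have b := (hG.finest_conj v ch hv).1.congr e hvars
  obtain ⟨χ, hχ, hs⟩ := (hG.finest_dec w x lo hi hw).2 _ b _ List.mem_cons_self
  have all : ∀ ψ ∈ ch.map (theta G), ψ = χ := by
    intro ψ hψ
    by_contra hne
    obtain ⟨y, hy⟩ := b.1.nonempty ψ hψ
    exact Finset.disjoint_left.1 (hA ψ hψ χ hχ hne) hy (hs ((b.1.cover y).2 ⟨ψ, hψ, hy⟩))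
  obtain ⟨ψ, hψ, χ', hχ', hne⟩ := two_members (hG.disjoint v ch hv) b.1.nonempty
    (by simpa using hG.length v ch hv)
  exact hne ((all ψ hψ).trans (all χ' hχ').symm)

theorem Canon.vars_nonempty (hG : Canon j G) {v : ℕ} {nd : Node} (hv : (v, nd) ∈ G)
    (hn : ∀ b, nd ≠ .leaf b) : (theta G v).vars.Nonempty := by
  rw [hG.wf.theta_eq hv]
  rcases nd with b | ⟨x, lo, hi⟩ | ch
  · exact absurd rfl (hn b)
  · exact ⟨x, by simp [nodeTheta, vars_choice]⟩
  · have hl := hG.length v ch hv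
    obtain ⟨w, l, rfl⟩ := List.exists_cons_of_length_pos (by omega : 0 < ch.length)
    obtain ⟨y, hy⟩ := hG.nonempty v _ hv w (by simp)
    exact ⟨y, mem_vars_bigAnd.2 ⟨_, List.mem_map_of_mem List.mem_cons_self, hy⟩⟩

theorem Canon.eq_of_children (hG : Canon j G) (ht : ∀ v ∈ names G, (theta G v).Tight)
    {v w : ℕ} {nd nd' : Node} (hv : (v, nd) ∈ G) (hw : (w, nd') ∈ G)
    (hC : ∀ c ∈ nd.children, ∀ c' ∈ nd'.children, (theta G c).Equivalent (theta G c') → c = c')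
    (e : (theta G v).Equivalent (theta G w)) : v = w := by
  have hvars := (ht v (mem_names_of_mem hv)).vars_eq (ht w (mem_names_of_mem hw)) e
  apply hG.reduced.1 v w nd nd' hv hw
  rcases nd with b | ⟨x, lo, hi⟩ | ch <;> rcases nd' with b' | ⟨x', lo', hi'⟩ | ch'
  · have := e fun _ => true
    rw [hG.wf.theta_eq hv, hG.wf.theta_eq hw] at this
    show b = b'
    cases b <;> cases b' <;> simp_all [nodeTheta, eval]
  · have := hG.vars_nonempty hw (by simp)
    rw [← hvars, vars_leaf hG.wf hv] at this
    exact Finset.not_nonempty_empty this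
  · have := hG.vars_nonempty hw (by simp)
    rw [← hvars, vars_leaf hG.wf hv] at this
    exact Finset.not_nonempty_empty this
  · have := hG.vars_nonempty hv (by simp)
    rw [hvars, vars_leaf hG.wf hw] at this
    exact Finset.not_nonempty_empty this
  · have hxx : x = x' := by
      have h1 : x ∈ (theta G w).vars := by
        rw [← hvars, hG.wf.theta_dec hv]
        simp [vars_choice]
      have h2 : x' ∈ (theta G v).vars := by
        rw [hvars, hG.wf.theta_dec hw]
        simp [vars_choice]
      rw [hG.wf.theta_dec hw, vars_choice, Finset.mem_insert, Finset.mem_union] at h1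
      rw [hG.wf.theta_dec hv, vars_choice, Finset.mem_insert, Finset.mem_union] at h2
      rcases h1 with h1 | h1
      · exact h1
      · rcases h2 with h2 | h2
        · exact h2.symm
        · exact absurd (hG.order v x lo hi hv _ h2) (hG.order w x' lo' hi' hw _ h1).asymm
    subst hxx
    rw [hG.wf.theta_dec hv, hG.wf.theta_dec hw] at e
    refine ⟨rfl, hC lo (by simp [Node.children]) lo' (by simp [Node.children]) fun ω => ?_,
      hC hi (by simp [Node.children]) hi' (by simp [Node.children]) fun ω => ?_⟩
    · have := e (Function.update ω x false)
      rwa [eval_update_choice, eval_update_choice, if_neg (by simp), if_neg (by simp),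
        eval_update_of_not_mem (hG.not_mem_lo hv), eval_update_of_not_mem (hG.not_mem_lo hw)]
        at this
    · have := e (Function.update ω x true)
      rwa [eval_update_choice, eval_update_choice, if_pos rfl, if_pos rfl,
        eval_update_of_not_mem (hG.not_mem_hi hv), eval_update_of_not_mem (hG.not_mem_hi hw)]
        at this
  · exact hG.not_conj_dec hw hv e.symm hvars.symm
  · have := hG.vars_nonempty hv (by simp)
    rw [hvars, vars_leaf hG.wf hw] at this
    exact Finset.not_nonempty_empty this
  · exact hG.not_conj_dec hv hw e hvars
  · have h1 := hG.conj_subset hv hw e hvars hC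
    have h2 := hG.conj_subset hw hv e.symm hvars.symm
      fun c hc c' hc' h => (hC c' hc' c hc h.symm).symm
    exact fun w => ⟨fun h => h1 h, fun h => h2 h⟩

/-- Every variable of a canonical diagram is essential, and equivalent vertices are equal. -/
theorem Canon.tight_and_injective (hG : Canon j G) : (∀ v ∈ names G, (theta G v).Tight) ∧
    ∀ v ∈ names G, ∀ w ∈ names G, (theta G v).Equivalent (theta G w) → v = w := by
  induction G with
  | nil => simp [names]
  | cons e D ih =>
    obtain ⟨u, nd⟩ := e
    have wf := hG.wf
    have hs : D ⊆ (u, nd) :: D := List.subset_cons_self _ _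
    obtain ⟨ihT, ihE⟩ := ih (hG.of_subset wf.2.2 hs)
    have hth := wf.2.2.theta_eq_of_subset wf hs
    have chT : ∀ c ∈ names D, (theta ((u, nd) :: D) c).Tight := fun c hc => by
      rw [← hth c hc]
      exact ihT c hc
    have chE : ∀ c ∈ names D, ∀ c' ∈ names D,
        (theta ((u, nd) :: D) c).Equivalent (theta ((u, nd) :: D) c') → c = c' := by
      intro c hc c' hc'
      rw [← hth c hc, ← hth c' hc']
      exact ihE c hc c' hc'
    have tight : ∀ v ∈ names ((u, nd) :: D), (theta ((u, nd) :: D) v).Tight := by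
      intro v hv
      rcases List.mem_cons.1 hv with rfl | hv
      · have hmem : (v, nd) ∈ (v, nd) :: D := List.mem_cons_self
        rcases nd with b | ⟨x, lo, hi⟩ | ch
        · intro y hy
          rw [vars_leaf wf hmem] at hy
          cases hy
        · have hlo : lo ∈ names D := wf.2.1 lo (by simp [Node.children])
          have hhi : hi ∈ names D := wf.2.1 hi (by simp [Node.children])
          rw [wf.theta_dec hmem]
          exact tight_choice (chT lo hlo) (chT hi hhi) (hG.not_mem_lo hmem)
            (hG.not_mem_hi hmem) fun h => hG.reduced.2 _ _ _ _ hmem (chE lo hlo hi hhi h)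
        · rw [wf.theta_conj hmem]
          refine (hG.apart hmem).tight ?_ ?_
          · simp only [List.mem_map, forall_exists_index, and_imp, forall_apply_eq_imp_iff₂]
            exact fun c hc => hG.sat_child hmem hc
          · simp only [List.mem_map, forall_exists_index, and_imp, forall_apply_eq_imp_iff₂]
            exact fun c hc => chT c (wf.2.1 c hc)
      · exact chT v hv
    have children : ∀ v nd', (v, nd') ∈ (u, nd) :: D → ∀ c ∈ nd'.children, c ∈ names D := by
      intro v nd' h c hc
      rcases List.mem_cons.1 h with h | h
      · cases h
        exact wf.2.1 c hc
      · exact wf.2.2.child_mem h hc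
    refine ⟨tight, fun v hv w hw h => ?_⟩
    obtain ⟨nv, hv⟩ := mem_names.1 hv
    obtain ⟨nw, hw⟩ := mem_names.1 hw
    exact hG.eq_of_children tight hv hw (fun c hc c' hc' => chE c (children v nv hv c hc) c'
      (children w nw hw c' hc')) h

theorem Canon.tight (hG : Canon j G) {v : ℕ} (hv : v ∈ names G) : (theta G v).Tight :=
  hG.tight_and_injective.1 v hv

theorem Canon.eq_of_equivalent (hG : Canon j G) {v w : ℕ} (hv : v ∈ names G) (hw : w ∈ names G)
    (h : (theta G v).Equivalent (theta G w)) : v = w :=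
  hG.tight_and_injective.2 v hv w hw h

theorem Good.of_subset {D : Diagram} (hG : Good j G) (hD : WellFormed D) (hs : D ⊆ G) :
    Good j D := by
  have ht := hD.theta_eq_of_subset hG.wf hs
  refine ⟨hG.toBasic.of_subset hD hs, fun v x lo hi h => ?_, fun v ch h w hw => ?_,
    fun v ch h => ?_⟩
  · rw [ht v (mem_names_of_mem h)]
    exact hG.rigid v x lo hi (hs h)
  · obtain ⟨x, lo, hi, h'⟩ := hG.isDec v ch (hs h) w hw
    obtain ⟨nd, h''⟩ := mem_names.1 (hD.child_mem h hw)
    obtain rfl := hG.wf.node_eq h' (hs h'')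
    exact ⟨x, lo, hi, h''⟩
  · rw [map_theta_congr (l := ch) fun w hw => ht w (hD.child_mem h hw)]
    exact hG.large v ch (hs h)

theorem Good.canon (hG : Good j G) : Canon j G := by
  refine ⟨hG.toBasic, fun v ch hv => ?_, fun v x lo hi hv => ?_⟩
  · refine isFinestDecomposition (hG.disjoint v ch hv) ?_ ?_ ?_ (hG.large v ch hv) ?_ ?_
    · simp only [List.mem_map, forall_exists_index, and_imp, forall_apply_eq_imp_iff₂]
      exact fun c hc => hG.sat_child hv hc
    · simp only [List.mem_map, forall_exists_index, and_imp, forall_apply_eq_imp_iff₂]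
      exact fun c hc => hG.nonempty v ch hv c hc
    · simp only [List.mem_map, forall_exists_index, and_imp, forall_apply_eq_imp_iff₂]
      intro c hc
      obtain ⟨x, lo, hi, h⟩ := hG.isDec v ch hv c hc
      exact hG.rigid c x lo hi h
    · rw [hG.wf.theta_conj hv]
      exact fun _ => rfl
    · rw [hG.wf.theta_conj hv]
  · refine isFinestDecomposition (List.pairwise_singleton _ _) ?_ ?_ ?_ ?_ ?_ ?_
    · simpa using hG.sat hv (by simp)
    · rw [hG.wf.theta_dec hv]
      simp [vars_choice]
    · simpa using hG.rigid v x lo hi hv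
    · simp [AtMostOneLarge]
    · intro ω
      simp [bigAnd, eval]
    · simp [bigAnd, vars]

/-- A canonical diagram with a root is a ROBDD[∧_ĵ]. -/
theorem Canon.mem_robddHat (hG : Canon j G) (hr : Rooted G) : G ∈ ROBDDHat j := by
  refine ⟨⟨hG.wf, hr, fun v ch h => ⟨(hG.finest_conj v ch h).1.1, hG.length v ch h⟩⟩, ?_,
    hG.reduced, hG.finest_conj, hG.finest_dec⟩
  intro u x lo hi v y lo' hi' hu hv huv
  obtain ⟨w, ⟨nd, hu', hw⟩, hwv⟩ := Relation.TransGen.head'_iff.1 huv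
  obtain rfl := hG.wf.node_eq hu hu'
  have hy := (hG.wf.mem_vars_theta w (hG.wf.child_mem hu hw)).2 ⟨v, lo', hi', hwv, hv⟩
  refine hG.order u x lo hi hu y ?_
  simp only [Node.children, List.mem_cons, List.not_mem_nil, or_false] at hw
  rcases hw with rfl | rfl
  · exact Or.inl hy
  · exact Or.inr hy

theorem lt_of_ordered (hw : WellFormed G) (ho : Ordered G) {v x lo hi : ℕ}
    (h : (v, Node.dec x lo hi) ∈ G) {y : ℕ}
    (hy : y ∈ (theta G lo).vars ∨ y ∈ (theta G hi).vars) : x < y := by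
  have key : ∀ w ∈ (Node.dec x lo hi).children, y ∈ (theta G w).vars → x < y := by
    intro w hc hy
    obtain ⟨w', lo', hi', hr, hw'⟩ := (hw.mem_vars_theta w (hw.child_mem h hc)).1 hy
    exact ho v x lo hi w' y lo' hi' h hw' (Relation.TransGen.head' ⟨_, h, hc⟩ hr)
  rcases hy with hy | hy
  · exact key lo (by simp [Node.children]) hy
  · exact key hi (by simp [Node.children]) hy

theorem canon_of_mem_robddHat (hG : G ∈ ROBDDHat j) : Canon j G := by
  obtain ⟨hb, ho, hr, hc, hd⟩ := hG
  exact ⟨⟨hb.wellFormed, hr, fun v x lo hi h y hy => lt_of_ordered hb.wellFormed ho h hy,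
    fun v ch h => (hb.decomposition v ch h).2,
    fun v ch h w hw => (hb.decomposition v ch h).1.nonempty _ (List.mem_map_of_mem hw),
    fun v ch h => (hb.decomposition v ch h).1.disjoint⟩, hc, hd⟩

end Canon

end Diagram

/-! ### Specifications of timed computations -/

/-- The computation `m` returns a result with the property `P` in at most `t` steps. -/
def Timed.Spec {α : Type} (m : Timed α) (P : α → Prop) (t : ℕ) : Prop := P m.val ∧ m.time ≤ t

namespace Timed.Spec

variable {α β : Type} {m : Timed α} {f : α → Timed β} {P P' : α → Prop} {Q : β → Prop}
  {t t₁ : ℕ}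

theorem mono (h : m.Spec P t₁) (hP : ∀ a, P a → P' a) (ht : t₁ ≤ t) : m.Spec P' t :=
  ⟨hP _ h.1, h.2.trans ht⟩

theorem bind (h : m.Spec P t₁) (ht : t₁ ≤ t) (hf : ∀ a, P a → (f a).Spec Q (t - t₁)) :
    (m >>= f).Spec Q t := by
  have := hf _ h.1
  refine ⟨this.1, ?_⟩
  have h1 := h.2
  have h2 := this.2
  change m.time + (f m.val).time ≤ t
  omega

theorem pure {a : α} (h : P a) : (Pure.pure a : Timed α).Spec P t :=
  ⟨h, Nat.zero_le _⟩

theorem tick_bind {f : Unit → Timed β} (ht : 1 ≤ t) (hf : (f ()).Spec Q (t - 1)) :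
    (tick >>= f).Spec Q t :=
  bind (m := tick) (P := fun _ => True) (t₁ := 1) ⟨trivial, le_rfl⟩ ht fun _ _ => hf

theorem ite_bind {c : Prop} [Decidable c] {m m' : Timed α}
    (h : ((if c then m else m') >>= f).Spec Q t) :
    (if c then m >>= f else m' >>= f).Spec Q t := by
  split_ifs at h ⊢ <;> exact h

end Timed.Spec

open Timed

theorem isMem_spec (a : ℕ) (l : List ℕ) :
    (isMem a l).Spec (fun r => r = true ↔ a ∈ l) (l.length + 1) := by
  induction l with
  | nil => exact Spec.tick_bind (by simp) (Spec.pure (by simp))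
  | cons b l ih =>
    refine Spec.tick_bind (by simp) ?_
    by_cases h : a = b
    · rw [if_pos h]
      exact Spec.pure (by simp [h])
    · rw [if_neg h]
      exact ih.mono (fun r hr => by simp [hr, h]) (by simp)

theorem isSub_spec (m l : List ℕ) :
    (isSub m l).Spec (fun r => r = true ↔ l ⊆ m) ((l.length + 1) * (m.length + 2)) := by
  induction l with
  | nil => exact Spec.tick_bind (by simp) (Spec.pure (by simp))
  | cons a l ih =>
    have e : ((a :: l).length + 1) * (m.length + 2) =
      (l.length + 1) * (m.length + 2) + (m.length + 2) := by
      simp only [List.length_cons]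
      ring
    rw [e]
    refine Spec.tick_bind (by omega) ?_
    refine Spec.bind (isMem_spec a m) (by omega) fun r hr => ?_
    by_cases h : a ∈ m
    · rw [if_pos (hr.2 h)]
      exact ih.mono (fun r hr => by simp [hr, h]) (by omega)
    · rw [if_neg fun h' => h (hr.1 h')]
      exact Spec.pure (by simp [h])

theorem union_spec (m l : List ℕ) :
    (union m l).Spec (fun r => (∀ x, x ∈ r ↔ x ∈ l ∨ x ∈ m) ∧ (m.Nodup → r.Nodup) ∧
      r.length ≤ l.length + m.length) ((l.length + 1) * (l.length + m.length + 2)) := by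
  induction l with
  | nil => exact Spec.tick_bind (by simp) (Spec.pure (by simp))
  | cons a l ih =>
    have e : (l.length + 1) * (l.length + m.length + 2) + (l.length + m.length + 2) ≤
      ((a :: l).length + 1) * ((a :: l).length + m.length + 2) := by
      simp only [List.length_cons]
      nlinarith
    refine Spec.mono (t₁ := (l.length + 1) * (l.length + m.length + 2) +
      (l.length + m.length + 2)) ?_ (fun _ h => h) e
    refine Spec.tick_bind (by omega) ?_
    refine Spec.bind ih (by omega) fun r hr => ?_
    refine Spec.bind (isMem_spec a r) (by omega) fun b hb => ?_
    by_cases h : a ∈ r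
    · rw [if_pos (hb.2 h)]
      refine Spec.pure ⟨fun x => ?_, hr.2.1, ?_⟩
      · rw [hr.1, List.mem_cons]
        constructor
        · tauto
        · rintro ((rfl | hx) | hx)
          · exact (hr.1 _).1 h
          · exact Or.inl hx
          · exact Or.inr hx
      · have := hr.2.2
        simp only [List.length_cons]
        omega
    · rw [if_neg fun h' => h (hb.1 h')]
      refine Spec.pure ⟨fun x => ?_, fun hm => List.nodup_cons.2 ⟨h, hr.2.1 hm⟩, ?_⟩
      · rw [List.mem_cons, hr.1, List.mem_cons]
        tauto
      · have := hr.2.2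
        simp only [List.length_cons]
        omega

theorem inter_spec (m l : List ℕ) :
    (inter m l).Spec (fun r => r = l.filter (· ∈ m)) ((l.length + 1) * (m.length + 2)) := by
  induction l with
  | nil => exact Spec.tick_bind (by simp) (Spec.pure (by simp))
  | cons a l ih =>
    have e : ((a :: l).length + 1) * (m.length + 2) =
      (l.length + 1) * (m.length + 2) + (m.length + 2) := by
      simp only [List.length_cons]
      ring
    rw [e]
    refine Spec.tick_bind (by omega) ?_
    refine Spec.bind ih (by omega) fun r hr => ?_
    refine Spec.bind (isMem_spec a m) (by omega) fun b hb => ?_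
    by_cases h : a ∈ m
    · rw [if_pos (hb.2 h)]
      exact Spec.pure (by simp [hr, h])
    · rw [if_neg fun h' => h (hb.1 h')]
      exact Spec.pure (by simp [hr, h])

theorem diff_spec (m l : List ℕ) :
    (diff m l).Spec (fun r => r = l.filter (· ∉ m)) ((l.length + 1) * (m.length + 2)) := by
  induction l with
  | nil => exact Spec.tick_bind (by simp) (Spec.pure (by simp))
  | cons a l ih =>
    have e : ((a :: l).length + 1) * (m.length + 2) =
      (l.length + 1) * (m.length + 2) + (m.length + 2) := by
      simp only [List.length_cons]
      ring
    rw [e]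
    refine Spec.tick_bind (by omega) ?_
    refine Spec.bind ih (by omega) fun r hr => ?_
    refine Spec.bind (isMem_spec a m) (by omega) fun b hb => ?_
    by_cases h : a ∈ m
    · rw [if_pos (hb.2 h)]
      exact Spec.pure (by simp [hr, h])
    · rw [if_neg fun h' => h (hb.1 h')]
      exact Spec.pure (by simp [hr, h])

theorem len_spec (l : List ℕ) : (len l).Spec (fun r => r = l.length) (l.length + 1) := by
  induction l with
  | nil => exact Spec.tick_bind (by simp) (Spec.pure (by simp))
  | cons a l ih =>
    refine Spec.tick_bind (by simp) ?_
    refine Spec.bind ih (by simp) fun r hr => ?_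
    exact Spec.pure (by simp [hr])

/-! Bounds for lists of length at most `N`, in powers of `N + 1`. -/

section Bounds

variable {N : ℕ} {l m : List ℕ}

theorem one_le_cube (N : ℕ) : 1 ≤ (N + 1) ^ 3 := Nat.one_le_pow _ _ (by omega)

theorem succ_le_sq (N : ℕ) : N + 1 ≤ (N + 1) ^ 2 := Nat.le_self_pow (by omega) _

theorem sq_le_cube (N : ℕ) : (N + 1) ^ 2 ≤ (N + 1) ^ 3 := Nat.pow_le_pow_right (by omega) (by omega)

theorem mul_sq_add_le_cube {k n : ℕ} (hk : k ≤ N) :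
    n * (N + 1) ^ 2 * k + n * (N + 1) ^ 2 ≤ n * (N + 1) ^ 3 := by
  have h : (k + 1) * (n * (N + 1) ^ 2) ≤ (N + 1) * (n * (N + 1) ^ 2) :=
    Nat.mul_le_mul_right _ (by omega)
  calc _ = (k + 1) * (n * (N + 1) ^ 2) := by ring
    _ ≤ _ := h
    _ = _ := by ring

theorem pair_bound (hl : l.length ≤ N) (hm : m.length ≤ N) :
    (l.length + 1) * (m.length + 2) ≤ 2 * (N + 1) ^ 2 := by
  calc _ ≤ (N + 1) * (2 * (N + 1)) := Nat.mul_le_mul (by omega) (by omega)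
    _ = _ := by ring

theorem union_bound (hl : l.length ≤ N) (hm : m.length ≤ N) :
    (l.length + 1) * (l.length + m.length + 2) ≤ 2 * (N + 1) ^ 2 := by
  calc _ ≤ (N + 1) * (2 * (N + 1)) := Nat.mul_le_mul (by omega) (by omega)
    _ = _ := by ring

theorem isSub_spec_le (hm : m.length ≤ N) (hl : l.length ≤ N) :
    (isSub m l).Spec (fun r => r = true ↔ l ⊆ m) (2 * (N + 1) ^ 2) :=
  (isSub_spec m l).mono (fun _ h => h) (pair_bound hl hm)

theorem inter_spec_le (hm : m.length ≤ N) (hl : l.length ≤ N) :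
    (inter m l).Spec (fun r => r = l.filter (· ∈ m)) (2 * (N + 1) ^ 2) :=
  (inter_spec m l).mono (fun _ h => h) (pair_bound hl hm)

theorem diff_spec_le (hm : m.length ≤ N) (hl : l.length ≤ N) :
    (diff m l).Spec (fun r => r = l.filter (· ∉ m)) (2 * (N + 1) ^ 2) :=
  (diff_spec m l).mono (fun _ h => h) (pair_bound hl hm)

theorem union_spec_le (hm : m.length ≤ N) (hl : l.length ≤ N) :
    (union m l).Spec (fun r => (∀ x, x ∈ r ↔ x ∈ l ∨ x ∈ m) ∧ (m.Nodup → r.Nodup))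
      (2 * (N + 1) ^ 2) :=
  (union_spec m l).mono (fun _ h => ⟨h.1, h.2.1⟩) (union_bound hl hm)

end Bounds

/-! ### The store of Decompose -/

open Formula Diagram

/-- The diagram formed by the vertices of a store. -/
def Store.diagram (S : Store) : Diagram := S.map fun e => (e.name, e.node)

/-- The store is a canonical diagram for the bound `j`, the names decrease along the list, and
the recorded variables are correct. -/
structure StoreInv (j : ℕ∞) (S : Store) : Prop where
  good : Good j S.diagram
  sorted : (S.map Entry.name).Pairwise (· > ·)
  nodup_vars : ∀ e ∈ S, e.vars.Nodup
  vars : ∀ e ∈ S, e.vars.toFinset = (theta S.diagram e.name).vars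

theorem Store.names_diagram (S : Store) : names S.diagram = S.map Entry.name := by
  simp [names, Store.diagram]

theorem Store.length_diagram (S : Store) : S.diagram.length = S.length := by
  simp [Store.diagram]

theorem Store.mem_diagram_of_mem {S : Store} {e : Entry} (h : e ∈ S) :
    (e.name, e.node) ∈ S.diagram :=
  List.mem_map_of_mem h

theorem Store.exists_entry {S : Store} {v : ℕ} {nd : Node} (h : (v, nd) ∈ S.diagram) :
    ∃ e ∈ S, e.name = v ∧ e.node = nd := by
  obtain ⟨e, he, h⟩ := List.mem_map.1 h
  cases h
  exact ⟨e, he, rfl, rfl⟩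

/-- The vertices in `F` are decision vertices with pairwise disjoint sets of variables, at most
one of them with more than `j` variables. -/
structure FactorList (j : ℕ∞) (G : Diagram) (F : List ℕ) : Prop where
  nodup : F.Nodup
  isDec : ∀ w ∈ F, ∃ x lo hi, (w, Node.dec x lo hi) ∈ G
  disjoint : ∀ a ∈ F, ∀ b ∈ F, a ≠ b → Disjoint (theta G a).vars (theta G b).vars
  large : ∀ a ∈ F, ∀ b ∈ F, j < ((theta G a).vars.card : ℕ∞) →
    j < ((theta G b).vars.card : ℕ∞) → a = b

/-- The conditions under which a node can be added to a canonical diagram. -/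
def NodeOK (j : ℕ∞) (G : Diagram) : Node → Prop
  | .leaf _ => True
  | .dec x lo hi => lo ∈ names G ∧ hi ∈ names G ∧ lo ≠ hi ∧
      (∀ y, y ∈ (theta G lo).vars ∨ y ∈ (theta G hi).vars → x < y) ∧
      (choice x (theta G lo) (theta G hi)).Rigid j
  | .conj ch => 1 < ch.length ∧ FactorList j G ch

namespace FactorList

variable {j : ℕ∞} {G D : Diagram} {F F' : List ℕ}

theorem mem_names (h : FactorList j G F) {w : ℕ} (hw : w ∈ F) : w ∈ names G := by
  obtain ⟨x, lo, hi, h⟩ := h.isDec w hw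
  exact mem_names_of_mem h

theorem sublist (h : FactorList j G F) (hs : F'.Sublist F) : FactorList j G F' :=
  ⟨h.nodup.sublist hs, fun w hw => h.isDec w (hs.subset hw),
    fun a ha b hb => h.disjoint a (hs.subset ha) b (hs.subset hb),
    fun a ha b hb => h.large a (hs.subset ha) b (hs.subset hb)⟩

theorem of_subset (h : FactorList j D F) (hD : WellFormed D) (hG : WellFormed G) (hs : D ⊆ G) :
    FactorList j G F := by
  have ht : ∀ w ∈ F, theta D w = theta G w := fun w hw =>
    hD.theta_eq_of_subset hG hs w (h.mem_names hw)
  refine ⟨h.nodup, fun w hw => ?_, fun a ha b hb => ?_, fun a ha b hb => ?_⟩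
  · obtain ⟨x, lo, hi, h⟩ := h.isDec w hw
    exact ⟨x, lo, hi, hs h⟩
  · rw [← ht a ha, ← ht b hb]
    exact h.disjoint a ha b hb
  · rw [← ht a ha, ← ht b hb]
    exact h.large a ha b hb

theorem nonempty (h : FactorList j G F) (hG : Basic G) {w : ℕ} (hw : w ∈ F) :
    (theta G w).vars.Nonempty := by
  obtain ⟨x, lo, hi, h⟩ := h.isDec w hw
  rw [hG.wf.theta_dec h, vars_choice]
  exact ⟨x, Finset.mem_insert_self _ _⟩

theorem pairwise (h : FactorList j G F) :
    (F.map (theta G)).Pairwise fun ψ χ => Disjoint ψ.vars χ.vars := by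
  rw [List.pairwise_map]
  exact h.nodup.pairwise_of_forall_ne h.disjoint

theorem apart (h : FactorList j G F) : Apart (F.map (theta G)) :=
  pairwise_disjoint_apart h.pairwise

theorem atMostOneLarge (h : FactorList j G F) : AtMostOneLarge j (F.map (theta G)) := by
  intro ψ hψ χ hχ h1 h2
  obtain ⟨a, ha, rfl⟩ := List.mem_map.1 hψ
  obtain ⟨b, hb, rfl⟩ := List.mem_map.1 hχ
  rw [h.large a ha b hb h1 h2]

theorem sat (h : FactorList j G F) (hG : Basic G) : ∀ ψ ∈ F.map (theta G), ψ.Sat := by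
  simp only [List.mem_map, forall_exists_index, and_imp, forall_apply_eq_imp_iff₂]
  intro a ha
  obtain ⟨x, lo, hi, h⟩ := h.isDec a ha
  exact hG.sat h (by simp)

theorem rigid (h : FactorList j G F) (hG : Good j G) : ∀ ψ ∈ F.map (theta G), ψ.Rigid j := by
  simp only [List.mem_map, forall_exists_index, and_imp, forall_apply_eq_imp_iff₂]
  intro a ha
  obtain ⟨x, lo, hi, h⟩ := h.isDec a ha
  exact hG.rigid a x lo hi h

theorem tight (h : FactorList j G F) (hG : Good j G) : ∀ ψ ∈ F.map (theta G), ψ.Tight := by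
  simp only [List.mem_map, forall_exists_index, and_imp, forall_apply_eq_imp_iff₂]
  exact fun a ha => hG.canon.tight (h.mem_names ha)

theorem length_le (h : FactorList j G F) : F.length ≤ G.length := by
  have := (h.nodup.subperm fun w hw => h.mem_names hw).length_le
  simpa [names] using this

end FactorList

theorem Diagram.Good.factorList {j : ℕ∞} {G : Diagram} (hG : Good j G) {v : ℕ} {ch : List ℕ}
    (hv : (v, Node.conj ch) ∈ G) : FactorList j G ch := by
  have hd := List.pairwise_map.1 (hG.disjoint v ch hv)
  have hne := hG.nonempty v ch hv
  have : Std.Symm fun a b : ℕ => Disjoint (theta G a).vars (theta G b).vars :=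
    ⟨fun _ _ h => h.symm⟩
  have hdis : ∀ a ∈ ch, ∀ b ∈ ch, a ≠ b → Disjoint (theta G a).vars (theta G b).vars :=
    fun a ha b hb hab => hd.forall ha hb hab
  refine ⟨?_, hG.isDec v ch hv, hdis, fun a ha b hb h1 h2 => ?_⟩
  · refine (hd.imp_of_mem ?_)
    rintro a b ha _ h rfl
    exact (hne a ha).ne_empty (by simpa using h)
  · by_contra hab
    have e := hG.large v ch hv _ (List.mem_map_of_mem ha) _ (List.mem_map_of_mem hb) h1 h2
    have := hdis a ha b hb hab
    rw [e] at this
    exact (hne b hb).ne_empty (by simpa using this)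

theorem identical_symm {nd nd' : Node} (h : Identical nd nd') : Identical nd' nd := by
  rcases nd with b | ⟨x, lo, hi⟩ | ch <;> rcases nd' with b' | ⟨x', lo', hi'⟩ | ch' <;>
    simp only [Identical] at h ⊢
  · exact h.symm
  · exact ⟨h.1.symm, h.2.1.symm, h.2.2.symm⟩
  · exact fun w => (h w).symm

theorem NodeOK.children_mem {j : ℕ∞} {G : Diagram} {nd : Node} (h : NodeOK j G nd) :
    ∀ w ∈ nd.children, w ∈ names G := by
  rcases nd with b | ⟨x, lo, hi⟩ | ch
  · simp [Node.children]
  · simpa [Node.children] using ⟨h.1, h.2.1⟩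
  · exact fun w hw => h.2.mem_names hw

/-- A new admissible node extends a canonical diagram to a canonical diagram. -/
theorem Diagram.Good.cons {j : ℕ∞} {G : Diagram} (hG : Good j G) {u : ℕ} {nd : Node}
    (h : NodeOK j G nd) (hu : u ∉ names G) (hn : ∀ v nd', (v, nd') ∈ G → ¬ Identical nd nd') :
    Good j ((u, nd) :: G) := by
  have wf : WellFormed ((u, nd) :: G) := ⟨hu, h.children_mem, hG.wf⟩
  have hs : G ⊆ (u, nd) :: G := List.subset_cons_self _ _
  have ht := hG.wf.theta_eq_of_subset wf hs
  have hself : theta ((u, nd) :: G) u = nodeTheta G nd := theta_cons_self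
  have hml : ∀ v ch, (v, Node.conj ch) ∈ G →
      ch.map (theta ((u, nd) :: G)) = ch.map (theta G) :=
    fun v ch hv => map_theta_congr fun w hw => (ht w (hG.wf.child_mem hv hw)).symm
  have hmu : ∀ ch, nd = .conj ch → FactorList j ((u, nd) :: G) ch := by
    rintro ch rfl
    exact h.2.of_subset hG.wf wf hs
  have hb : Basic ((u, nd) :: G) := by
    refine ⟨wf, ⟨?_, ?_⟩, ?_, ?_, ?_, ?_⟩
    · intro a b n n' ha hb hid
      rcases List.mem_cons.1 ha with ha | ha <;> rcases List.mem_cons.1 hb with hb | hb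
      · cases ha
        cases hb
        rfl
      · cases ha
        exact absurd hid (hn b n' hb)
      · cases hb
        exact absurd (identical_symm hid) (hn a n ha)
      · exact hG.reduced.1 a b n n' ha hb hid
    · intro a x lo hi ha
      rcases List.mem_cons.1 ha with ha | ha
      · cases ha
        exact h.2.2.1
      · exact hG.reduced.2 a x lo hi ha
    · intro v x lo hi hv
      rcases List.mem_cons.1 hv with hv | hv
      · cases hv
        rw [← ht lo h.1, ← ht hi h.2.1]
        exact h.2.2.2.1
      · rw [← ht lo (hG.wf.child_mem hv (by simp [Node.children])),
          ← ht hi (hG.wf.child_mem hv (by simp [Node.children]))]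
        exact hG.order v x lo hi hv
    · intro v ch hv
      rcases List.mem_cons.1 hv with hv | hv
      · cases hv
        exact h.1
      · exact hG.length v ch hv
    · intro v ch hv w hw
      rcases List.mem_cons.1 hv with hv | hv
      · cases hv
        rw [← ht w (h.2.mem_names hw)]
        exact h.2.nonempty hG.toBasic hw
      · rw [← ht w (hG.wf.child_mem hv hw)]
        exact hG.nonempty v ch hv w hw
    · intro v ch hv
      rcases List.mem_cons.1 hv with hv | hv
      · cases hv
        exact (hmu ch rfl).pairwise
      · rw [hml v ch hv]
        exact hG.disjoint v ch hv
  refine ⟨hb, ?_, ?_, ?_⟩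
  · intro v x lo hi hv
    rcases List.mem_cons.1 hv with hv | hv
    · cases hv
      rw [hself]
      exact h.2.2.2.2
    · rw [← ht v (mem_names_of_mem hv)]
      exact hG.rigid v x lo hi hv
  · intro v ch hv w hw
    rcases List.mem_cons.1 hv with hv | hv
    · cases hv
      exact (hmu ch rfl).isDec w hw
    · obtain ⟨x, lo, hi, h'⟩ := hG.isDec v ch hv w hw
      exact ⟨x, lo, hi, hs h'⟩
  · intro v ch hv
    rcases List.mem_cons.1 hv with hv | hv
    · cases hv
      exact (hmu ch rfl).atMostOneLarge
    · rw [hml v ch hv]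
      exact hG.large v ch hv

/-! ### Searching the store -/

section Store

variable {j : ℕ∞} {S : Store} {N : ℕ}

theorem find_spec (hS : (S.map Entry.name).Nodup) {v : ℕ} {nd : Node}
    (h : (v, nd) ∈ S.diagram) :
    (find v S).Spec (fun e => e ∈ S ∧ e.name = v ∧ e.node = nd) (S.length + 1) := by
  induction S with
  | nil => simp [Store.diagram] at h
  | cons e S ih =>
    refine Spec.tick_bind (by simp) ?_
    by_cases hv : v = e.name
    · rw [if_pos hv]
      obtain ⟨e', he', rfl, rfl⟩ := Store.exists_entry h
      refine Spec.pure ⟨List.mem_cons_self, hv.symm, ?_⟩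
      rcases List.mem_cons.1 he' with rfl | he'
      · rfl
      · exact absurd (List.mem_map.2 ⟨e', he', hv⟩) (List.nodup_cons.1 hS).1
    · rw [if_neg hv]
      have h' : (v, nd) ∈ Store.diagram S := by
        rcases List.mem_cons.1 h with h | h
        · cases h
          exact absurd rfl hv
        · exact h
      exact (ih (List.nodup_cons.1 hS).2 h').mono
        (fun a ha => ⟨List.mem_cons_of_mem _ ha.1, ha.2⟩) (by simp)

theorem StoreInv.nodup (h : StoreInv j S) : (S.map Entry.name).Nodup := by
  rw [← Store.names_diagram]
  exact h.good.wf.nodup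

theorem StoreInv.find_spec (h : StoreInv j S) (hN : S.length + 2 ≤ N) {v : ℕ} {nd : Node}
    (hv : (v, nd) ∈ S.diagram) :
    (find v S).Spec (fun e => e ∈ S ∧ e.name = v ∧ e.node = nd) (N + 1) :=
  (AndBDD.find_spec h.nodup hv).mono (fun _ h => h) (by omega)

theorem StoreInv.length_le (h : StoreInv j S) {l : List ℕ} (hl : l.Nodup)
    (hm : ∀ y ∈ l, ∃ v ∈ names S.diagram, y ∈ (theta S.diagram v).vars) :
    l.length ≤ S.length := by
  rw [← List.toFinset_card_of_nodup hl, ← S.length_diagram]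
  exact h.good.wf.card_le fun y hy => hm y (List.mem_toFinset.1 hy)

theorem StoreInv.mem_vars (h : StoreInv j S) {e : Entry} (he : e ∈ S) {y : ℕ} :
    y ∈ e.vars ↔ y ∈ (theta S.diagram e.name).vars := by
  rw [← h.vars e he, List.mem_toFinset]

theorem StoreInv.length_vars (h : StoreInv j S) {e : Entry} (he : e ∈ S) :
    e.vars.length = (theta S.diagram e.name).vars.card := by
  rw [← h.vars e he, List.toFinset_card_of_nodup (h.nodup_vars e he)]

theorem StoreInv.length_vars_le (h : StoreInv j S) {e : Entry} (he : e ∈ S) :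
    e.vars.length ≤ S.length :=
  h.length_le (h.nodup_vars e he) fun _ hy =>
    ⟨e.name, mem_names_of_mem (Store.mem_diagram_of_mem he), (h.mem_vars he).1 hy⟩

theorem StoreInv.length_children (h : StoreInv j S) (hN : S.length + 2 ≤ N) {v : ℕ} {nd : Node}
    (hv : (v, nd) ∈ S.diagram) : nd.children.length ≤ N := by
  rcases nd with b | ⟨x, lo, hi⟩ | ch
  · simp [Node.children]
  · simp [Node.children]
    omega
  · have := (h.good.factorList hv).length_le
    rw [S.length_diagram] at this
    simp only [Node.children]
    omega

theorem varsOf_spec (h : StoreInv j S) (hN : S.length + 2 ≤ N) {l : List ℕ}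
    (hl : ∀ v ∈ l, v ∈ names S.diagram) :
    (varsOf S l).Spec
      (fun r => r.Nodup ∧ ∀ y, y ∈ r ↔ ∃ v ∈ l, y ∈ (theta S.diagram v).vars)
      (4 * (N + 1) ^ 2 * l.length + (N + 1) ^ 2) := by
  have h1 := succ_le_sq N
  induction l with
  | nil => exact Spec.tick_bind (by omega) (Spec.pure (by simp))
  | cons v l ih =>
    obtain ⟨nd, hv⟩ := Diagram.mem_names.1 (hl v (by simp))
    rw [List.length_cons, Nat.mul_succ]
    refine Spec.tick_bind (by omega) ?_
    refine Spec.bind (h.find_spec hN hv) (by omega) ?_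
    rintro e ⟨he, rfl, -⟩
    refine Spec.bind (ih fun w hw => hl w (List.mem_cons_of_mem _ hw)) (by omega) ?_
    rintro r ⟨hr, hm⟩
    have hrl : r.length ≤ S.length := h.length_le hr fun y hy => by
      obtain ⟨w, hw, hy⟩ := (hm y).1 hy
      exact ⟨w, hl w (List.mem_cons_of_mem _ hw), hy⟩
    have hel := h.length_vars_le he
    refine (union_spec_le (N := N) (m := r) (l := e.vars) ?_ ?_).mono ?_ ?_ <;> try omega
    rintro r' ⟨h1, h2⟩
    refine ⟨h2 hr, fun y => ?_⟩
    rw [h1, hm, h.mem_vars he]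
    simp only [List.mem_cons, exists_eq_or_imp]

theorem varsOf_spec_le (h : StoreInv j S) (hN : S.length + 2 ≤ N) {l : List ℕ}
    (hl : ∀ v ∈ l, v ∈ names S.diagram) (hn : l.length ≤ N) :
    (varsOf S l).Spec
      (fun r => r.Nodup ∧ ∀ y, y ∈ r ↔ ∃ v ∈ l, y ∈ (theta S.diagram v).vars)
      (4 * (N + 1) ^ 3) := by
  refine (varsOf_spec h hN hl).mono (fun _ h => h) ?_
  have := mul_sq_add_le_cube (n := 4) hn
  omega

theorem nodeVars_spec (h : StoreInv j S) (hN : S.length + 2 ≤ N) {nd : Node}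
    (hl : ∀ v ∈ nd.children, v ∈ names S.diagram) (hn : nd.children.length ≤ N) :
    (nodeVars S nd).Spec
      (fun r => r.Nodup ∧ r.length ≤ N ∧ ∀ y, y ∈ r ↔ y ∈ (nodeTheta S.diagram nd).vars)
      (7 * (N + 1) ^ 3) := by
  have h1 := one_le_cube N
  have h2 := sq_le_cube N
  rcases nd with b | ⟨x, lo, hi⟩ | ch
  · refine Spec.tick_bind (by omega) (Spec.pure ?_)
    cases b <;> simp [nodeTheta, Formula.vars]
  · refine Spec.tick_bind (by omega) ?_
    refine Spec.bind (varsOf_spec_le h hN (l := [lo, hi]) hl hn) (by omega) ?_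
    rintro r ⟨hr, hm⟩
    have hrl : r.length ≤ S.length := h.length_le hr fun y hy => by
      obtain ⟨w, hw, hy⟩ := (hm y).1 hy
      exact ⟨w, hl w hw, hy⟩
    refine (union_spec r [x]).mono ?_ ((union_bound (N := N) ?_ ?_).trans ?_)
    · rintro r' ⟨h1, h2, h3⟩
      refine ⟨h2 hr, ?_, fun y => ?_⟩
      · simp at h3
        omega
      · rw [h1, hm]
        simp only [nodeTheta, vars_choice, Finset.mem_insert, Finset.mem_union, List.mem_cons,
          List.not_mem_nil, or_false, exists_eq_or_imp, exists_eq_left]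
    · simp
      omega
    · omega
    · omega
  · refine Spec.tick_bind (by omega) ?_
    refine (varsOf_spec_le h hN (l := ch) hl hn).mono ?_ (by omega)
    rintro r ⟨hr, hm⟩
    refine ⟨hr, ?_, fun y => ?_⟩
    · have : r.length ≤ S.length := h.length_le hr fun y hy => by
        obtain ⟨w, hw, hy⟩ := (hm y).1 hy
        exact ⟨w, hl w hw, hy⟩
      omega
    · rw [hm]
      simp [nodeTheta, mem_vars_bigAnd]

theorem isIdentical_spec {nd nd' : Node} (h : nd.children.length ≤ N)
    (h' : nd'.children.length ≤ N) :
    (isIdentical nd nd').Spec (fun r => r = true ↔ Identical nd nd') (5 * (N + 1) ^ 2) := by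
  have h1 := succ_le_sq N
  rcases nd with b | ⟨x, lo, hi⟩ | ch <;> rcases nd' with b' | ⟨x', lo', hi'⟩ | ch'
  case conj.conj =>
    refine Spec.tick_bind (by omega) ?_
    refine Spec.bind (isSub_spec_le (N := N) (m := ch) (l := ch') h h') (by omega) fun r hr => ?_
    by_cases hs : ch' ⊆ ch
    · rw [if_pos (hr.2 hs)]
      refine (isSub_spec_le (N := N) (m := ch') (l := ch) h' h).mono (fun r hr => ?_) (by omega)
      rw [hr]
      exact ⟨fun h w => ⟨fun hw => h hw, fun hw => hs hw⟩, fun h w hw => (h w).1 hw⟩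
    · rw [if_neg fun h => hs (hr.1 h)]
      refine Spec.pure ?_
      simp only [Bool.false_eq_true, Identical, false_iff]
      exact fun h => hs fun w hw => (h w).2 hw
  all_goals
    refine Spec.tick_bind (by omega) (Spec.pure ?_)
    simp [Identical, and_assoc]

theorem findNode_spec {nd : Node} (h : nd.children.length ≤ N)
    (hS : ∀ v nd', (v, nd') ∈ S.diagram → nd'.children.length ≤ N) :
    (findNode nd S).Spec
      (fun r => (∀ v, r = some v → ∃ nd', (v, nd') ∈ S.diagram ∧ Identical nd nd') ∧
        (r = none → ∀ v nd', (v, nd') ∈ S.diagram → ¬ Identical nd nd'))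
      (6 * (N + 1) ^ 2 * S.length + (N + 1) ^ 2) := by
  have h1 := succ_le_sq N
  induction S with
  | nil => exact Spec.tick_bind (by omega) (Spec.pure (by simp [Store.diagram]))
  | cons e S ih =>
    rw [List.length_cons, Nat.mul_succ]
    refine Spec.tick_bind (by omega) ?_
    refine Spec.bind (isIdentical_spec h (hS e.name e.node List.mem_cons_self)) (by omega)
      fun r hr => ?_
    by_cases hid : Identical nd e.node
    · rw [if_pos (hr.2 hid)]
      refine Spec.pure ⟨?_, by simp⟩
      intro v hv
      cases hv
      exact ⟨_, List.mem_cons_self, hid⟩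
    · rw [if_neg fun h => hid (hr.1 h)]
      refine (ih fun v nd' h => hS v nd' (List.mem_cons_of_mem _ h)).mono ?_ (by omega)
      rintro r ⟨h1, h2⟩
      refine ⟨fun v hv => ?_, fun hn v nd' hv => ?_⟩
      · obtain ⟨nd', h, h'⟩ := h1 v hv
        exact ⟨nd', List.mem_cons_of_mem _ h, h'⟩
      · rcases List.mem_cons.1 hv with hv | hv
        · cases hv
          exact hid
        · exact h2 hn v nd' hv

theorem freshName_spec (h : (S.map Entry.name).Pairwise (· > ·)) :
    (freshName S).Spec (fun r => ∀ a ∈ S.map Entry.name, r > a) 1 := by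
  cases S with
  | nil => exact Spec.tick_bind le_rfl (Spec.pure (by simp))
  | cons e S =>
    refine Spec.tick_bind le_rfl (Spec.pure fun a ha => ?_)
    rcases List.mem_cons.1 ha with rfl | ha
    · exact Nat.lt_succ_self _
    · exact ((List.pairwise_cons.1 h).1 a ha).trans (Nat.lt_succ_self _)

/-! ### Extending the store -/

/-- The store `S'` extends `S` by at most `k` vertices. -/
structure Extends (j : ℕ∞) (k : ℕ) (S S' : Store) : Prop where
  inv : StoreInv j S'
  sub : S.diagram ⊆ S'.diagram
  length : S'.length ≤ S.length + k
  theta : ∀ v ∈ names S.diagram, theta S'.diagram v = theta S.diagram v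

theorem Extends.refl (h : StoreInv j S) : Extends j 0 S S :=
  ⟨h, List.Subset.refl _, le_rfl, fun _ _ => rfl⟩

theorem Extends.trans {k k' : ℕ} {S' S'' : Store} (h : Extends j k S S')
    (h' : Extends j k' S' S'') : Extends j (k + k') S S'' :=
  ⟨h'.inv, fun _ ha => h'.sub (h.sub ha), by have := h.length; have := h'.length; omega,
    fun v hv => (h'.theta v (names_subset h.sub hv)).trans (h.theta v hv)⟩

theorem Extends.mono {k k' : ℕ} {S' : Store} (h : Extends j k S S') (hk : k ≤ k') :
    Extends j k' S S' :=
  ⟨h.inv, h.sub, h.length.trans (by omega), h.theta⟩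

theorem Extends.map_theta {k : ℕ} {S' : Store} (h : Extends j k S S') {l : List ℕ}
    (hl : ∀ w ∈ l, w ∈ names S.diagram) :
    l.map (Diagram.theta S'.diagram) = l.map (Diagram.theta S.diagram) :=
  map_theta_congr fun w hw => h.theta w (hl w hw)

theorem Extends.mem_names {k : ℕ} {S' : Store} (h : Extends j k S S') {v : ℕ}
    (hv : v ∈ names S.diagram) : v ∈ names S'.diagram :=
  names_subset h.sub hv

theorem vertex_spec (h : StoreInv j S) (hN : S.length + 2 ≤ N) {nd : Node}
    (hnd : NodeOK j S.diagram nd) :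
    (vertex S nd).Spec (fun r => Extends j 1 S r.2 ∧
      r.2.diagram.size ≤ S.diagram.size + nd.children.length ∧
      ∃ nd', (r.1, nd') ∈ r.2.diagram ∧ Identical nd nd') (15 * (N + 1) ^ 3) := by
  have h1 := one_le_cube N
  have hn : nd.children.length ≤ N := by
    rcases nd with b | ⟨x, lo, hi⟩ | ch
    · simp [Node.children]
    · simp only [Node.children, List.length_cons, List.length_nil]
      omega
    · have := hnd.2.length_le
      rw [S.length_diagram] at this
      simp only [Node.children]
      omega
  have hb := mul_sq_add_le_cube (N := N) (n := 6) (k := S.length) (by omega)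
  refine Spec.tick_bind (by omega) ?_
  refine Spec.bind (findNode_spec hn fun v nd' hv => h.length_children hN hv) (by omega) ?_
  rintro (_ | v) ⟨hs, hnone⟩
  · refine Spec.bind (nodeVars_spec h hN hnd.children_mem hn) (by omega) ?_
    rintro vs ⟨hvs, -, hvm⟩
    refine Spec.bind (freshName_spec h.sorted) (by omega) fun u hu => ?_
    have hu' : u ∉ names S.diagram := by
      rw [S.names_diagram]
      exact fun h => (hu u h).false
    have hg : Good j ((u, nd) :: S.diagram) := h.good.cons hnd hu' (hnone rfl)
    have ht := h.good.wf.theta_eq_of_subset hg.wf (List.subset_cons_self _ _)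
    refine Spec.pure ⟨⟨⟨hg, ?_, ?_, ?_⟩, List.subset_cons_self _ _, by simp,
      fun v hv => (ht v hv).symm⟩, ?_, nd, List.mem_cons_self, ?_⟩
    · exact List.pairwise_cons.2 ⟨hu, h.sorted⟩
    · intro e he
      rcases List.mem_cons.1 he with rfl | he
      · exact hvs
      · exact h.nodup_vars e he
    · intro e he
      rcases List.mem_cons.1 he with rfl | he
      · ext y
        rw [List.mem_toFinset, hvm]
        exact iff_of_eq (congrArg (y ∈ ·) (congrArg vars theta_cons_self.symm))
      · rw [h.vars e he]
        exact congrArg vars (ht e.name (mem_names_of_mem (Store.mem_diagram_of_mem he)))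
    · simp only [size, Store.diagram, List.map_cons, List.sum_cons]
      omega
    · rcases nd with b | ⟨x, lo, hi⟩ | ch <;> simp [Identical]
  · obtain ⟨nd', hm, hid⟩ := hs v rfl
    exact Spec.pure ⟨(Extends.refl h).mono (by omega), by simp, nd', hm, hid⟩

theorem vertex_leaf_spec (h : StoreInv j S) (hN : S.length + 2 ≤ N) (b : Bool) :
    (vertex S (.leaf b)).Spec (fun r => Extends j 1 S r.2 ∧ (r.1, Node.leaf b) ∈ r.2.diagram)
      (15 * (N + 1) ^ 3) := by
  refine (vertex_spec h hN (nd := .leaf b) trivial).mono ?_ le_rfl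
  rintro r ⟨he, -, nd', hm, hid⟩
  rcases nd' with b' | _ | _
  · obtain rfl : b = b' := hid
    exact ⟨he, hm⟩
  · exact hid.elim
  · exact hid.elim

theorem vertex_dec_spec (h : StoreInv j S) (hN : S.length + 2 ≤ N) {x lo hi : ℕ}
    (hnd : NodeOK j S.diagram (.dec x lo hi)) :
    (vertex S (.dec x lo hi)).Spec (fun r => Extends j 1 S r.2 ∧
      r.2.diagram.size ≤ S.diagram.size + 2 ∧ (r.1, Node.dec x lo hi) ∈ r.2.diagram)
      (15 * (N + 1) ^ 3) := by
  refine (vertex_spec h hN hnd).mono ?_ le_rfl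
  rintro r ⟨he, hs, nd', hm, hid⟩
  rcases nd' with _ | ⟨x', lo', hi'⟩ | _
  · exact hid.elim
  · obtain ⟨rfl, rfl, rfl⟩ := hid
    exact ⟨he, hs, hm⟩
  · exact hid.elim

theorem Extends.theta_dec {k : ℕ} {S' : Store} (h : Extends j k S S') {v x lo hi : ℕ}
    (hv : (v, Node.dec x lo hi) ∈ S'.diagram) (hlo : lo ∈ names S.diagram)
    (hhi : hi ∈ names S.diagram) : Diagram.theta S'.diagram v =
      choice x (Diagram.theta S.diagram lo) (Diagram.theta S.diagram hi) := by
  rw [h.inv.good.wf.theta_dec hv, h.theta lo hlo, h.theta hi hhi]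

theorem vertex_conj_spec (h : StoreInv j S) (hN : S.length + 2 ≤ N) {ch : List ℕ}
    (hnd : NodeOK j S.diagram (.conj ch)) :
    (vertex S (.conj ch)).Spec (fun r => Extends j 1 S r.2 ∧
      r.2.diagram.size ≤ S.diagram.size + ch.length ∧ r.1 ∈ names r.2.diagram ∧
      (theta r.2.diagram r.1).Equivalent (bigAnd (ch.map (theta S.diagram))))
      (15 * (N + 1) ^ 3) := by
  refine (vertex_spec h hN hnd).mono ?_ le_rfl
  rintro r ⟨he, hs, nd', hm, hid⟩
  refine ⟨he, hs, mem_names_of_mem hm, ?_⟩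
  rcases nd' with _ | _ | ch'
  · exact hid.elim
  · exact hid.elim
  · rw [he.inv.good.wf.theta_conj hm, ← he.map_theta fun w hw => hnd.2.mem_names hw]
    refine equivalent_of_imp (fun ω hω => ?_) fun ω hω => ?_
    · rw [eval_bigAnd] at hω ⊢
      intro ψ hψ
      obtain ⟨w, hw, rfl⟩ := List.mem_map.1 hψ
      exact hω _ (List.mem_map_of_mem ((hid w).1 hw))
    · rw [eval_bigAnd] at hω ⊢
      intro ψ hψ
      obtain ⟨w, hw, rfl⟩ := List.mem_map.1 hψ
      exact hω _ (List.mem_map_of_mem ((hid w).2 hw))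

theorem conjVertex_spec (h : StoreInv j S) (hN : S.length + 2 ≤ N) {F : List ℕ}
    (hF : FactorList j S.diagram F) :
    (conjVertex S F).Spec (fun r => Extends j 1 S r.2 ∧ r.1 ∈ names r.2.diagram ∧
      (theta r.2.diagram r.1).Equivalent (bigAnd (F.map (theta S.diagram))))
      (16 * (N + 1) ^ 3) := by
  have h1 := one_le_cube N
  rcases F with _ | ⟨w, _ | ⟨w', l⟩⟩
  · refine Spec.tick_bind (by omega) ?_
    refine (vertex_leaf_spec h hN true).mono ?_ (by omega)
    rintro r ⟨he, hm⟩
    refine ⟨he, mem_names_of_mem hm, ?_⟩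
    rw [he.inv.good.wf.theta_eq hm]
    exact fun ω => rfl
  · refine Spec.tick_bind (by omega) (Spec.pure ?_)
    refine ⟨(Extends.refl h).mono (by omega), hF.mem_names (by simp), fun ω => ?_⟩
    simp [bigAnd, eval]
  · refine Spec.tick_bind (by omega) ?_
    refine (vertex_conj_spec h hN (ch := w :: w' :: l) ⟨by simp, hF⟩).mono ?_ (by omega)
    exact fun r hr => ⟨hr.1, hr.2.2⟩

end Store

/-! ### Flattening of conjunctions -/

/-- The children of a `∧`-vertex, and the vertex itself if it is a decision vertex: the factors
in the `∧_ĵ`-decomposition of the formula. -/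
def factors (v : ℕ) : Node → List ℕ
  | .leaf _ => []
  | .dec _ _ _ => [v]
  | .conj ch => ch

section Factors

variable {j : ℕ∞} {G : Diagram} {v : ℕ} {nd : Node}

theorem Diagram.Good.factors (hG : Good j G) (hv : (v, nd) ∈ G) :
    FactorList j G (factors v nd) := by
  rcases nd with b | ⟨x, lo, hi⟩ | ch
  · exact ⟨List.nodup_nil, by simp [AndBDD.factors], by simp [AndBDD.factors],
      by simp [AndBDD.factors]⟩
  · refine ⟨List.nodup_singleton _, ?_, ?_, ?_⟩
    · simpa [AndBDD.factors] using ⟨x, lo, hi, hv⟩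
    · simp [AndBDD.factors]
    · simp [AndBDD.factors]
  · exact hG.factorList hv

theorem Diagram.WellFormed.mem_vars_factors (hG : WellFormed G) (hv : (v, nd) ∈ G) {y : ℕ} :
    y ∈ (theta G v).vars ↔ ∃ w ∈ factors v nd, y ∈ (theta G w).vars := by
  rcases nd with b | ⟨x, lo, hi⟩ | ch
  · rw [vars_leaf hG hv]
    simp [factors]
  · simp [factors]
  · rw [hG.theta_conj hv, mem_vars_bigAnd]
    simp [factors]

theorem Diagram.WellFormed.equivalent_factors (hG : WellFormed G) (hv : (v, nd) ∈ G)
    (hn : nd ≠ .leaf false) :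
    (theta G v).Equivalent (bigAnd ((factors v nd).map (theta G))) := by
  rcases nd with (_ | _) | ⟨x, lo, hi⟩ | ch
  · exact absurd rfl hn
  · rw [hG.theta_eq hv]
    exact fun _ => rfl
  · intro ω
    simp [factors, bigAnd, eval]
  · rw [hG.theta_conj hv]
    exact fun _ => rfl

end Factors

section Flatten

variable {j : ℕ∞} {S : Store} {N : ℕ}

theorem isBot_spec (nd : Node) : (isBot nd).Spec (fun r => r = true ↔ nd = .leaf false) 1 := by
  rcases nd with (_ | _) | ⟨x, lo, hi⟩ | ch <;>
    exact Spec.tick_bind le_rfl (Spec.pure (by simp))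

theorem hasBot_spec (h : StoreInv j S) (hN : S.length + 2 ≤ N) {l : List ℕ}
    (hl : ∀ v ∈ l, v ∈ names S.diagram) :
    (hasBot S l).Spec (fun r => r = true ↔ ∃ v ∈ l, (v, Node.leaf false) ∈ S.diagram)
      (4 * (N + 1) ^ 2 * l.length + (N + 1) ^ 2) := by
  have h1 := succ_le_sq N
  induction l with
  | nil => exact Spec.tick_bind (by omega) (Spec.pure (by simp))
  | cons v l ih =>
    obtain ⟨nd, hv⟩ := Diagram.mem_names.1 (hl v (by simp))
    rw [List.length_cons, Nat.mul_succ]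
    refine Spec.tick_bind (by omega) ?_
    refine Spec.bind (h.find_spec hN hv) (by omega) ?_
    rintro e ⟨-, rfl, rfl⟩
    refine Spec.bind (isBot_spec _) (by omega) fun r hr => ?_
    have hiff : e.node = .leaf false ↔ (e.name, Node.leaf false) ∈ S.diagram :=
      ⟨fun h => h ▸ hv, fun h' => h.good.wf.node_eq hv h'⟩
    by_cases hb : e.node = .leaf false
    · rw [if_pos (hr.2 hb)]
      exact Spec.pure (by simp [hiff.1 hb])
    · rw [if_neg fun h => hb (hr.1 h)]
      refine (ih fun w hw => hl w (List.mem_cons_of_mem _ hw)).mono (fun r hr => ?_) (by omega)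
      rw [hr]
      rw [hiff] at hb
      simp [hb]

theorem flatten_spec (h : StoreInv j S) (hN : S.length + 2 ≤ N) {l : List ℕ}
    (hl : ∀ v ∈ l, v ∈ names S.diagram) (hb : ∀ v ∈ l, (v, Node.leaf false) ∉ S.diagram) :
    (flatten S l).Spec (fun r => r.Nodup ∧
        ∀ w, w ∈ r ↔ ∃ v ∈ l, ∃ nd, (v, nd) ∈ S.diagram ∧ w ∈ factors v nd)
      (4 * (N + 1) ^ 2 * l.length + (N + 1) ^ 2) := by
  have h1 := succ_le_sq N
  induction l with
  | nil => exact Spec.tick_bind (by omega) (Spec.pure (by simp))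
  | cons v l ih =>
    obtain ⟨nd, hv⟩ := Diagram.mem_names.1 (hl v (by simp))
    have hbv := hb v (by simp)
    rw [List.length_cons, Nat.mul_succ]
    refine Spec.tick_bind (by omega) ?_
    refine Spec.bind (ih (fun w hw => hl w (List.mem_cons_of_mem _ hw))
      (fun w hw => hb w (List.mem_cons_of_mem _ hw))) (by omega) ?_
    rintro r ⟨hr, hm⟩
    refine Spec.bind (h.find_spec hN hv) (by omega) ?_
    rintro ⟨_, nd', _⟩ ⟨-, -, he⟩
    obtain rfl : nd' = nd := he
    have hrl : r.length ≤ N := by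
      have : r ⊆ names S.diagram := by
        intro w hw
        obtain ⟨v', hv', nd', h', hw⟩ := (hm w).1 hw
        exact (h.good.factors h').mem_names hw
      have := (hr.subperm this).length_le
      rw [S.names_diagram, List.length_map] at this
      omega
    have hfl := (h.good.factors hv).length_le
    rw [S.length_diagram] at hfl
    have key : ∀ r' : List ℕ, (∀ w, w ∈ r' ↔ w ∈ factors v nd' ∨ w ∈ r) →
        ∀ w, w ∈ r' ↔ ∃ v' ∈ v :: l, ∃ nd, (v', nd) ∈ S.diagram ∧ w ∈ factors v' nd := by
      intro r' hr' w
      rw [hr', hm]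
      constructor
      · rintro (hw | ⟨v', hv', hw⟩)
        · exact ⟨v, List.mem_cons_self, _, hv, hw⟩
        · exact ⟨v', List.mem_cons_of_mem _ hv', hw⟩
      · rintro ⟨v', hv', nd'', h', hw⟩
        rcases List.mem_cons.1 hv' with rfl | hv'
        · obtain rfl := h.good.wf.node_eq hv h'
          exact Or.inl hw
        · exact Or.inr ⟨v', hv', nd'', h', hw⟩
    have fin : (union r (factors v nd')).Spec (fun r => r.Nodup ∧ ∀ w, w ∈ r ↔
        ∃ v' ∈ v :: l, ∃ nd, (v', nd) ∈ S.diagram ∧ w ∈ factors v' nd) (2 * (N + 1) ^ 2) :=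
      (union_spec_le (N := N) hrl (by omega)).mono
        (fun r' hr' => ⟨hr'.2 hr, key r' hr'.1⟩) le_rfl
    rcases nd' with (_ | _) | ⟨x, lo, hi⟩ | ch
    · exact absurd hv hbv
    · exact Spec.pure ⟨hr, key r (by simp [factors])⟩
    · exact fin.mono (fun _ h => h) (by omega)
    · exact fin.mono (fun _ h => h) (by omega)

/-- The formulas of the vertices in the list have no common variables, and at most one of the
vertices has more than `j` variables. -/
def Separated (j : ℕ∞) (G : Diagram) (l : List ℕ) : Prop :=
  (∀ a ∈ l, ∀ b ∈ l, a ≠ b → Disjoint (theta G a).vars (theta G b).vars) ∧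
    ∀ a ∈ l, ∀ b ∈ l, j < ((theta G a).vars.card : ℕ∞) → j < ((theta G b).vars.card : ℕ∞) → a = b

/-- The factors of the conjunction of separated vertices are the factors of these vertices; this is
why flattening yields the finest decomposition. -/
theorem finest_spec (h : StoreInv j S) (hN : S.length + 2 ≤ N) {l : List ℕ}
    (hl : ∀ v ∈ l, v ∈ names S.diagram) (hn : l.length ≤ N) (hs : Separated j S.diagram l) :
    (finest S l).Spec (fun r => Extends j 1 S r.2 ∧ r.1 ∈ names r.2.diagram ∧
      (theta r.2.diagram r.1).Equivalent (bigAnd (l.map (theta S.diagram))))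
      (25 * (N + 1) ^ 3) := by
  have h1 := one_le_cube N
  have hb := mul_sq_add_le_cube (n := 4) hn
  refine Spec.tick_bind (by omega) ?_
  refine Spec.bind (hasBot_spec h hN hl) (by omega) fun r hr => ?_
  by_cases hbot : ∃ v ∈ l, (v, Node.leaf false) ∈ S.diagram
  · rw [if_pos (hr.2 hbot)]
    refine (vertex_leaf_spec h hN false).mono ?_ (by omega)
    rintro r ⟨he, hm⟩
    refine ⟨he, mem_names_of_mem hm, fun ω => ?_⟩
    obtain ⟨v, hv, hv'⟩ := hbot
    rw [he.inv.good.wf.theta_eq hm]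
    symm
    change _ = false
    rw [← Bool.not_eq_true, eval_bigAnd]
    intro hall
    have := hall _ (List.mem_map_of_mem hv)
    rw [h.good.wf.theta_eq hv'] at this
    cases this
  · rw [if_neg fun h => hbot (hr.1 h)]
    push Not at hbot
    refine Spec.bind (flatten_spec h hN hl hbot) (by omega) ?_
    rintro F ⟨hF, hm⟩
    have hsub : ∀ v nd w, (v, nd) ∈ S.diagram → w ∈ factors v nd →
        (theta S.diagram w).vars ⊆ (theta S.diagram v).vars :=
      fun v nd w hv hw y hy => (h.good.wf.mem_vars_factors hv).2 ⟨w, hw, hy⟩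
    have hFL : FactorList j S.diagram F := by
      refine ⟨hF, fun w hw => ?_, fun a ha b hb hab => ?_, fun a ha b hb hja hjb => ?_⟩
      · obtain ⟨v, -, nd, hv, hw⟩ := (hm w).1 hw
        exact (h.good.factors hv).isDec w hw
      · obtain ⟨v, hvl, nd, hv, ha⟩ := (hm a).1 ha
        obtain ⟨v', hvl', nd', hv', hb⟩ := (hm b).1 hb
        by_cases hvv : v = v'
        · subst hvv
          obtain rfl := h.good.wf.node_eq hv hv'
          exact (h.good.factors hv).disjoint a ha b hb hab
        · exact (hs.1 v hvl v' hvl' hvv).mono (hsub v nd a hv ha) (hsub v' nd' b hv' hb)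
      · obtain ⟨v, hvl, nd, hv, ha⟩ := (hm a).1 ha
        obtain ⟨v', hvl', nd', hv', hb⟩ := (hm b).1 hb
        obtain rfl := hs.2 v hvl v' hvl'
          (hja.trans_le (Nat.cast_le.2 (Finset.card_le_card (hsub v nd a hv ha))))
          (hjb.trans_le (Nat.cast_le.2 (Finset.card_le_card (hsub v' nd' b hv' hb))))
        obtain rfl := h.good.wf.node_eq hv hv'
        exact (h.good.factors hv).large a ha b hb hja hjb
    refine (conjVertex_spec h hN hFL).mono ?_ (by omega)
    rintro r ⟨he, hr, heq⟩
    refine ⟨he, hr, heq.trans (equivalent_of_imp (fun ω hω => ?_) fun ω hω => ?_)⟩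
    · rw [eval_bigAnd] at hω ⊢
      intro ψ hψ
      obtain ⟨v, hv, rfl⟩ := List.mem_map.1 hψ
      obtain ⟨nd, hnd⟩ := Diagram.mem_names.1 (hl v hv)
      rw [h.good.wf.equivalent_factors hnd (by rintro rfl; exact hbot v hv hnd), eval_bigAnd]
      intro ψ hψ
      obtain ⟨w, hw, rfl⟩ := List.mem_map.1 hψ
      exact hω _ (List.mem_map_of_mem ((hm w).2 ⟨v, hv, nd, hnd, hw⟩))
    · rw [eval_bigAnd] at hω ⊢
      intro ψ hψ
      obtain ⟨w, hw, rfl⟩ := List.mem_map.1 hψ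
      obtain ⟨v, hv, nd, hnd, hw⟩ := (hm w).1 hw
      have := hω _ (List.mem_map_of_mem hv)
      rw [h.good.wf.equivalent_factors hnd (by rintro rfl; exact hbot v hv hnd),
        eval_bigAnd] at this
      exact this _ (List.mem_map_of_mem hw)

end Flatten

/-! ### Decision vertices -/

section Decision

variable {j : ℕ∞} {G : Diagram} {S : Store} {N : ℕ}

theorem FactorList.tight_bigAnd {F : List ℕ} (h : FactorList j G F) (hG : Good j G) :
    (bigAnd (F.map (theta G))).Tight :=
  h.apart.tight (h.sat hG.toBasic) (h.tight hG)

theorem FactorList.sat_bigAnd {F : List ℕ} (h : FactorList j G F) (hG : Good j G) :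
    (bigAnd (F.map (theta G))).Sat :=
  h.apart.sat (h.sat hG.toBasic)

theorem mem_vars_map {F : List ℕ} {y : ℕ} :
    y ∈ (bigAnd (F.map (theta G))).vars ↔ ∃ w ∈ F, y ∈ (theta G w).vars := by
  simp [mem_vars_bigAnd]

theorem eval_map {F : List ℕ} {ω : ℕ → Bool} :
    eval ω (bigAnd (F.map (theta G))) = true ↔ ∀ w ∈ F, eval ω (theta G w) = true := by
  simp [eval_bigAnd]

/-- The decision between two conjunctions of vertices without a common factor is rigid. -/
theorem FactorList.rigid_choice {F F' : List ℕ} (h : FactorList j G F) (h' : FactorList j G F')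
    (hG : Good j G) {x : ℕ} (hx : x ∉ (bigAnd (F.map (theta G))).vars)
    (hx' : x ∉ (bigAnd (F'.map (theta G))).vars) (hd : ∀ a ∈ F, a ∉ F') :
    (choice x (bigAnd (F.map (theta G))) (bigAnd (F'.map (theta G)))).Rigid j := by
  refine Formula.rigid_choice h.apart h'.apart (h.sat hG.toBasic) (h'.sat hG.toBasic)
    (h.tight hG) (h'.tight hG) (h.rigid hG) (h'.rigid hG) h.atMostOneLarge h'.atMostOneLarge
    hx hx' fun ψ hψ χ hχ e => ?_
  obtain ⟨a, ha, rfl⟩ := List.mem_map.1 hψ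
  obtain ⟨b, hb, rfl⟩ := List.mem_map.1 hχ
  obtain rfl := hG.canon.eq_of_equivalent (h.mem_names ha) (h'.mem_names hb) e
  exact hd a ha hb

/-- A decision node can be added if it is equivalent to a tight and rigid formula. -/
theorem Diagram.Good.nodeOK_dec (hG : Good j G) {x lo hi : ℕ} (hlo : lo ∈ names G)
    (hhi : hi ∈ names G) (hne : lo ≠ hi)
    (hx : ∀ y, y ∈ (theta G lo).vars ∨ y ∈ (theta G hi).vars → x < y) {φ : Formula}
    (hr : φ.Rigid j) (ht : φ.Tight) (e : φ.Equivalent (choice x (theta G lo) (theta G hi))) :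
    NodeOK j G (.dec x lo hi) := by
  refine ⟨hlo, hhi, hne, hx, hr.congr e (ht.vars_eq ?_ e)⟩
  exact tight_choice (hG.canon.tight hlo) (hG.canon.tight hhi)
    (fun h => (hx x (Or.inl h)).false) (fun h => (hx x (Or.inr h)).false)
    fun h => hne (hG.canon.eq_of_equivalent hlo hhi h)

theorem Diagram.Good.vars_eq_of_equivalent (hG : Good j G) {v : ℕ} (hv : v ∈ names G)
    {φ : Formula} (ht : φ.Tight) (e : (theta G v).Equivalent φ) : (theta G v).vars = φ.vars :=
  (hG.canon.tight hv).vars_eq ht e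

/-- The result of the treatment of the decision node `⟨x, lo, hi⟩`. -/
def DecisionPost (j : ℕ∞) (S : Store) (φ : Formula) (r : ℕ × Store) : Prop :=
  Extends j 5 S r.2 ∧ r.1 ∈ names r.2.diagram ∧ (theta r.2.diagram r.1).Equivalent φ

theorem vertex_dec_post {k : ℕ} {S₀ : Store} (h : Extends j k S₀ S) (hk : k + 1 ≤ 5)
    (hN : S₀.length + 7 ≤ N) {x lo hi : ℕ} (hlo : lo ∈ names S₀.diagram)
    (hhi : hi ∈ names S₀.diagram) (hnd : NodeOK j S₀.diagram (.dec x lo hi)) :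
    (vertex S (.dec x lo hi)).Spec
      (DecisionPost j S₀ (choice x (theta S₀.diagram lo) (theta S₀.diagram hi)))
      (15 * (N + 1) ^ 3) := by
  have hlen := h.length
  have hnd' : NodeOK j S.diagram (.dec x lo hi) := by
    refine ⟨h.mem_names hlo, h.mem_names hhi, hnd.2.2.1, ?_, ?_⟩
    · rw [h.theta lo hlo, h.theta hi hhi]
      exact hnd.2.2.2.1
    · rw [h.theta lo hlo, h.theta hi hhi]
      exact hnd.2.2.2.2
  refine (vertex_dec_spec (N := N) h.inv (by omega) hnd').mono ?_ le_rfl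
  rintro r ⟨he, -, hm⟩
  refine ⟨(h.trans he).mono hk, mem_names_of_mem hm, ?_⟩
  rw [(h.trans he).theta_dec hm hlo hhi]
  exact fun _ => rfl

theorem conjVertex_post {k : ℕ} {S₀ : Store} (h : Extends j k S₀ S) (hk : k + 1 ≤ 5)
    (hN : S₀.length + 7 ≤ N) {F : List ℕ} (hF : FactorList j S.diagram F) {φ : Formula}
    (e : (bigAnd (F.map (theta S.diagram))).Equivalent φ) :
    (conjVertex S F).Spec (DecisionPost j S₀ φ) (16 * (N + 1) ^ 3) := by
  have hlen := h.length
  refine (conjVertex_spec (N := N) h.inv (by omega) hF).mono ?_ le_rfl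
  rintro r ⟨he, hm, heq⟩
  exact ⟨(h.trans he).mono hk, hm, heq.trans e⟩

/-- A decision vertex one of whose children is `⊥` is the conjunction of a literal and the other
child.  With the bound `0` no decomposition is allowed, and every formula is rigid. -/
theorem extractLeaf_spec (h : StoreInv j S) (hN : S.length + 7 ≤ N) {x lo hi : ℕ}
    (hlo : lo ∈ names S.diagram) (hhi : hi ∈ names S.diagram)
    (hx : ∀ y, y ∈ (theta S.diagram lo).vars ∨ y ∈ (theta S.diagram hi).vars → x < y)
    {loBot : Bool} (hb : ((if loBot then lo else hi), Node.leaf false) ∈ S.diagram)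
    (hv : (theta S.diagram (if loBot then hi else lo)).vars.Nonempty) :
    (extractLeaf j S x lo hi loBot).Spec
      (DecisionPost j S (choice x (theta S.diagram lo) (theta S.diagram hi)))
      (100 * (N + 1) ^ 3) := by
  have h1 := one_le_cube N
  have hG := h.good
  have hne : lo ≠ hi := by
    rintro rfl
    simp only [ite_self] at hb hv
    rw [vars_leaf hG.wf hb] at hv
    exact Finset.not_nonempty_empty hv
  refine Spec.tick_bind (by omega) ?_
  by_cases hj : j = 0
  · rw [if_pos hj]
    subst hj
    exact (vertex_dec_post (Extends.refl h) (by omega) hN hlo hhi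
      ⟨hlo, hhi, hne, hx, rigid_zero _⟩).mono (fun _ h => h) (by omega)
  rw [if_neg hj]
  refine Spec.bind (vertex_leaf_spec (N := N) h (by omega) true) (by omega) ?_
  rintro ⟨t, S₁⟩ ⟨h₁, ht⟩
  dsimp only at h₁ ht ⊢
  have hl1 := h₁.length
  have htt : theta S₁.diagram t = .tru := h₁.inv.good.wf.theta_eq ht
  -- The bottom vertex `w` and the other child `c`.
  have main : ∀ w c : ℕ, w ∈ names S.diagram → c ∈ names S.diagram →
      (w, Node.leaf false) ∈ S.diagram → (theta S.diagram c).vars.Nonempty →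
      (∀ y ∈ (theta S.diagram c).vars, x < y) → ∀ nd : Node,
      (nd = .dec x w t ∨ nd = .dec x t w) → ∀ φ : Formula,
      (bigAnd [nodeTheta S₁.diagram nd, theta S.diagram c]).Equivalent φ →
      (do
        let (v, S) ← vertex S₁ nd
        finest S [v, c]).Spec (DecisionPost j S φ) (60 * (N + 1) ^ 3) := by
    intro w c hw hc hwb hcv hxc nd hnd φ hφ
    have hwb₁ := h₁.sub hwb
    have htw : theta S₁.diagram w = .fls := h₁.inv.good.wf.theta_eq hwb₁
    have hne' : w ≠ t := by
      rintro rfl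
      cases h₁.inv.good.wf.node_eq hwb₁ ht
    obtain ⟨lo', hi', rfl, hm1, hm2, hne'', hvs⟩ : ∃ lo' hi', nd = .dec x lo' hi' ∧
        lo' ∈ names S₁.diagram ∧ hi' ∈ names S₁.diagram ∧ lo' ≠ hi' ∧
        (theta S₁.diagram lo').vars = ∅ ∧ (theta S₁.diagram hi').vars = ∅ := by
      rcases hnd with rfl | rfl
      · exact ⟨w, t, rfl, mem_names_of_mem hwb₁, mem_names_of_mem ht, hne', by rw [htw]; rfl,
          by rw [htt]; rfl⟩
      · exact ⟨t, w, rfl, mem_names_of_mem ht, mem_names_of_mem hwb₁, hne'.symm,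
          by rw [htt]; rfl, by rw [htw]; rfl⟩
    have hvars : (choice x (theta S₁.diagram lo') (theta S₁.diagram hi')).vars = {x} := by
      rw [vars_choice, hvs.1, hvs.2]
      rfl
    have hok : NodeOK j S₁.diagram (.dec x lo' hi') := by
      refine ⟨hm1, hm2, hne'', ?_, rigid_of_vars_eq_singleton hvars⟩
      rw [hvs.1, hvs.2]
      simp
    refine Spec.bind (vertex_dec_spec (N := N) h₁.inv (by omega) hok) (by omega) ?_
    rintro ⟨v, S₂⟩ ⟨h₂, -, hv₂⟩
    dsimp only at h₂ hv₂ ⊢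
    have hl2 := h₂.length
    have h₁₂ := h₁.trans h₂
    have hθv := h₂.theta_dec hv₂ hm1 hm2
    have hθc := h₁₂.theta c hc
    have hdis : Disjoint (theta S₂.diagram v).vars (theta S₂.diagram c).vars := by
      rw [hθv, hvars, hθc, Finset.disjoint_singleton_left]
      exact fun h => (hxc x h).false
    have hsmall : ¬ j < ((theta S₂.diagram v).vars.card : ℕ∞) := by
      rw [hθv, hvars]
      simpa using hj
    refine (finest_spec (N := N) h₂.inv (by omega) (l := [v, c]) ?_ ?_ ⟨?_, ?_⟩).mono ?_ ?_
    · simpa using ⟨mem_names_of_mem hv₂, h₁₂.mem_names hc⟩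
    · simp
      omega
    · simp only [List.mem_cons, List.not_mem_nil, or_false]
      rintro a (rfl | rfl) b (rfl | rfl) hab
      · exact absurd rfl hab
      · exact hdis
      · exact hdis.symm
      · exact absurd rfl hab
    · simp only [List.mem_cons, List.not_mem_nil, or_false]
      rintro a (rfl | rfl) b (rfl | rfl) ha hb
      · rfl
      · exact absurd ha hsmall
      · exact absurd hb hsmall
      · rfl
    · rintro r ⟨h₃, hm, e⟩
      refine ⟨(h₁₂.trans h₃).mono (by omega), hm, e.trans ?_⟩
      simp only [List.map_cons, List.map_nil, hθv, hθc]
      exact hφ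
    · omega
  cases loBot
  · simp only [Bool.false_eq_true, if_false] at hb hv ⊢
    refine (main hi lo hhi hlo hb hv (fun y hy => hx y (Or.inl hy)) _ (Or.inr rfl) _
      fun ω => ?_).mono (fun _ h => h) (by omega)
    have e1 : theta S₁.diagram hi = .fls := h₁.inv.good.wf.theta_eq (h₁.sub hb)
    have e2 : theta S.diagram hi = .fls := hG.wf.theta_eq hb
    simp only [nodeTheta, bigAnd, eval, eval_choice, htt, e1, e2]
    cases ω x <;> simp
  · simp only [if_true] at hb hv ⊢
    refine (main lo hi hlo hhi hb hv (fun y hy => hx y (Or.inr hy)) _ (Or.inl rfl) _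
      fun ω => ?_).mono (fun _ h => h) (by omega)
    have e1 : theta S₁.diagram lo = .fls := h₁.inv.good.wf.theta_eq (h₁.sub hb)
    have e2 : theta S.diagram lo = .fls := hG.wf.theta_eq hb
    simp only [nodeTheta, bigAnd, eval, eval_choice, htt, e1, e2]
    cases ω x <;> simp

/-! ### A child of a decision vertex that is a factor of the other child -/

/-- The formula that agrees with `ψ` if the value of `x` is `b` and with `φ` otherwise. -/
def choiceOn (x : ℕ) (b : Bool) (φ ψ : Formula) : Formula :=
  if b then choice x φ ψ else choice x ψ φ

theorem eval_choiceOn {x : ℕ} {b : Bool} {φ ψ : Formula} {ω : ℕ → Bool} :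
    eval ω (choiceOn x b φ ψ) = if ω x = b then eval ω ψ else eval ω φ := by
  cases b <;> cases h : ω x <;> simp [choiceOn, eval_choice, h]

theorem vars_choiceOn {x : ℕ} {b : Bool} {φ ψ : Formula} :
    (choiceOn x b φ ψ).vars = insert x (φ.vars ∪ ψ.vars) := by
  cases b <;> simp [choiceOn, vars_choice, Finset.union_comm]

theorem tight_tru : Formula.tru.Tight := fun _ h => by cases h

/-- A decision vertex one of whose children is a child `v₁` of the other child `v₂` is equivalent
to the conjunction of `v₁` and a rigid decision between `⊤` and the remaining factors of `v₂`.  If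
both have more than `j` variables, then the decision vertex itself is rigid. -/
theorem extractPart_spec (h : StoreInv j S) (hN : S.length + 7 ≤ N) {x v₁ v₂ : ℕ} {ch : List ℕ}
    (hv₂ : (v₂, Node.conj ch) ∈ S.diagram) (hv₁ : v₁ ∈ ch)
    (hx : ∀ y ∈ (theta S.diagram v₂).vars, x < y) (b : Bool) :
    (extractPart j S x (if b then v₁ else v₂) (if b then v₂ else v₁) b ch).Spec
      (DecisionPost j S (choiceOn x b (theta S.diagram v₁) (theta S.diagram v₂)))
      (100 * (N + 1) ^ 3) := by
  have c1 := one_le_cube N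
  have c2 := sq_le_cube N
  have c3 := succ_le_sq N
  have hG := h.good
  have FL := hG.factorList hv₂
  have hlen := FL.length_le
  rw [S.length_diagram] at hlen
  have hm₁ := FL.mem_names hv₁
  have hm₂ := mem_names_of_mem hv₂
  have hvars₂ : ∀ y, y ∈ (theta S.diagram v₂).vars ↔ ∃ w ∈ ch, y ∈ (theta S.diagram w).vars :=
    fun y => hG.wf.mem_vars_factors hv₂
  -- The remaining factors of `v₂`.
  set rest := ch.filter (· ∉ [v₁]) with hrest
  have FR : FactorList j S.diagram rest := FL.sublist List.filter_sublist
  have mem_rest : ∀ w, w ∈ rest ↔ w ∈ ch ∧ w ≠ v₁ := by simp [hrest]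
  set ρ := bigAnd (rest.map (theta S.diagram)) with hρ
  have hρt : ρ.Tight := FR.tight_bigAnd hG
  have hxρ : ∀ y ∈ ρ.vars, x < y := by
    intro y hy
    obtain ⟨w, hw, hy⟩ := mem_vars_map.1 hy
    exact hx y ((hvars₂ y).2 ⟨w, ((mem_rest w).1 hw).1, hy⟩)
  have hρn : ρ.vars.Nonempty := by
    have h2 := hG.length v₂ ch hv₂
    obtain ⟨w, hw⟩ : ∃ w, w ∈ rest := by
      by_contra hno
      push Not at hno
      have : ch ⊆ [v₁] := fun w hw => by
        by_contra hwv
        exact hno w ((mem_rest w).2 ⟨hw, by simpa using hwv⟩)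
      have := (FL.nodup.subperm this).length_le
      simp at this
      omega
    obtain ⟨y, hy⟩ := FR.nonempty hG.toBasic hw
    exact ⟨y, mem_vars_map.2 ⟨w, hw, hy⟩⟩
  have hρtru : ¬ Formula.tru.Equivalent ρ := fun e => by
    obtain ⟨y, hy⟩ := hρn
    have := hρt.mem_of_equivalent e.symm hy
    cases this
  set φ := choiceOn x b .tru ρ with hφ
  have hφt : φ.Tight := by
    have hx1 : x ∉ ρ.vars := fun h => (hxρ x h).false
    cases b
    · exact tight_choice hρt tight_tru hx1 (by simp [Formula.vars])
        fun h => hρtru h.symm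
    · exact tight_choice tight_tru hρt (by simp [Formula.vars]) hx1 hρtru
  have hφr : φ.Rigid j := by
    have hx1 : x ∉ ρ.vars := fun h => (hxρ x h).false
    have nil : FactorList j S.diagram [] :=
      ⟨List.nodup_nil, by simp, by simp, by simp⟩
    cases b
    · exact FR.rigid_choice nil hG hx1 (by simp [bigAnd, Formula.vars]) (by simp)
    · exact nil.rigid_choice FR hG (by simp [bigAnd, Formula.vars]) hx1 (by simp)
  have hφv : φ.vars = insert x ρ.vars := by
    rw [hφ, vars_choiceOn]
    simp [Formula.vars]
  have hdis : Disjoint (theta S.diagram v₁).vars φ.vars := by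
    rw [hφv, Finset.disjoint_insert_right]
    refine ⟨fun h => (hx x ((hvars₂ x).2 ⟨v₁, hv₁, h⟩)).false, ?_⟩
    rw [Finset.disjoint_left]
    intro y hy hy'
    obtain ⟨w, hw, hyw⟩ := mem_vars_map.1 hy'
    rw [mem_rest] at hw
    exact Finset.disjoint_left.1 (FL.disjoint v₁ hv₁ w hw.1 hw.2.symm) hy hyw
  have hequiv : (bigAnd [theta S.diagram v₁, φ]).Equivalent
      (choiceOn x b (theta S.diagram v₁) (theta S.diagram v₂)) := by
    intro ω
    rw [eval_choiceOn]
    have e2 : eval ω (theta S.diagram v₂) = (eval ω (theta S.diagram v₁) && eval ω ρ) := by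
      rw [Bool.eq_iff_iff, Bool.and_eq_true, hG.wf.theta_conj hv₂, hρ, eval_map, eval_map]
      constructor
      · exact fun h => ⟨h v₁ hv₁, fun w hw => h w ((mem_rest w).1 hw).1⟩
      · rintro ⟨h1, h2⟩ w hw
        by_cases hwv : w = v₁
        · rw [hwv, h1]
        · exact h2 w ((mem_rest w).2 ⟨hw, hwv⟩)
    rw [e2]
    simp only [bigAnd, eval, hφ, eval_choiceOn]
    split <;> simp
  have hv1eq : (if b = true then (if b = true then v₁ else v₂) else
      (if b = true then v₂ else v₁)) = v₁ := by
    cases b <;> rfl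
  have hdecOn : ∀ φ ψ : Formula, choice x (if b then φ else ψ) (if b then ψ else φ) =
      choiceOn x b φ ψ := by
    intro φ ψ
    cases b <;> rfl
  have hpost : choiceOn x b (theta S.diagram v₁) (theta S.diagram v₂) =
      choice x (theta S.diagram (if b then v₁ else v₂))
        (theta S.diagram (if b then v₂ else v₁)) := by
    cases b <;> rfl
  refine Spec.tick_bind (by omega) ?_
  refine Spec.bind (diff_spec_le (N := N) (m := [_]) (l := ch) (by simp; omega) (by omega))
    (by omega) ?_
  rintro _ rfl
  rw [hv1eq, ← hrest]
  refine Spec.bind (conjVertex_spec (N := N) h (by omega) FR) (by omega) ?_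
  rintro ⟨r, S₁⟩ ⟨h₁, hr, er⟩
  dsimp only at h₁ hr er ⊢
  have l₁ := h₁.length
  refine Spec.bind (vertex_leaf_spec (N := N) h₁.inv (by omega) true) (by omega) ?_
  rintro ⟨t, S₂⟩ ⟨h₂, ht⟩
  dsimp only at h₂ ht ⊢
  have l₂ := h₂.length
  have et : theta S₂.diagram t = .tru := h₂.inv.good.wf.theta_eq ht
  have er₂ : (theta S₂.diagram r).Equivalent ρ := by
    rw [h₂.theta r hr]
    exact er
  have hr₂ := h₂.mem_names hr
  have hvr : (theta S₂.diagram r).vars = ρ.vars :=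
    h₂.inv.good.vars_eq_of_equivalent hr₂ hρt er₂
  have hnode : (if b = true then Node.dec x t r else Node.dec x r t) =
      Node.dec x (if b then t else r) (if b then r else t) := by
    cases b <;> rfl
  have hφe : (choice x (theta S₂.diagram (if b then t else r))
      (theta S₂.diagram (if b then r else t))).Equivalent φ := by
    intro ω
    rw [eval_choice, hφ, eval_choiceOn, ← er₂ ω, ← et]
    cases b <;> cases ω x <;> simp
  have hok : NodeOK j S₂.diagram (.dec x (if b then t else r) (if b then r else t)) := by
    have htr : t ≠ r := by
      rintro rfl
      rw [et] at er₂
      exact hρtru er₂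
    have hvt : (theta S₂.diagram t).vars = ∅ := by
      rw [et]
      rfl
    have ht' := mem_names_of_mem ht
    refine h₂.inv.good.nodeOK_dec ?_ ?_ ?_ ?_ hφr hφt hφe.symm
    · cases b <;> assumption
    · cases b <;> assumption
    · cases b
      · exact htr.symm
      · exact htr
    · intro y hy
      refine hxρ y ?_
      rw [← hvr]
      cases b <;> simpa [hvt] using hy
  rw [hnode]
  refine Spec.bind (vertex_dec_spec (N := N) h₂.inv (by omega) hok) (by omega) ?_
  rintro ⟨v, S₃⟩ ⟨h₃, -, hv⟩
  dsimp only at h₃ hv ⊢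
  have l₃ := h₃.length
  have h₁₃ := (h₁.trans h₂).trans h₃
  have hm₁₃ := h₁₃.mem_names hm₁
  have θ₁ := h₁₃.theta v₁ hm₁
  have hve : (theta S₃.diagram v).Equivalent φ := by
    rw [h₃.theta_dec hv hok.1 hok.2.1]
    exact hφe
  have hvv : (theta S₃.diagram v).vars = φ.vars :=
    h₃.inv.good.vars_eq_of_equivalent (mem_names_of_mem hv) hφt hve
  obtain ⟨nd₁, hnd₁⟩ := Diagram.mem_names.1 hm₁₃
  refine Spec.bind (h₃.inv.find_spec (N := N) (by omega) hnd₁) (by omega) ?_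
  rintro e₁ ⟨he₁, hen₁, -⟩
  refine Spec.bind (h₃.inv.find_spec (N := N) (by omega) hv) (by omega) ?_
  rintro e ⟨he, hen, -⟩
  have le₁ := h₃.inv.length_vars_le he₁
  have le := h₃.inv.length_vars_le he
  refine Spec.bind (len_spec e₁.vars) (by omega) ?_
  rintro _ rfl
  refine Spec.bind (len_spec e.vars) (by omega) ?_
  rintro _ rfl
  have q₁ := h₃.inv.length_vars he₁
  have q := h₃.inv.length_vars he
  rw [hen₁, θ₁] at q₁
  rw [hen, hvv] at q
  rw [q₁, q]
  by_cases hbig : j < ((theta S.diagram v₁).vars.card : ℕ∞) ∧ j < (φ.vars.card : ℕ∞)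
  · rw [if_pos hbig, hpost]
    have hne12 : v₁ ≠ v₂ := by
      rintro rfl
      obtain ⟨x', lo', hi', h'⟩ := FL.isDec v₁ hv₁
      cases hG.wf.node_eq hv₂ h'
    have hA : Apart [theta S.diagram v₁, φ] := by
      refine pairwise_disjoint_apart ?_
      simpa using hdis
    have hφs : φ.Sat := by
      refine ⟨fun y => if y = x then !b else true, ?_⟩
      rw [hφ, eval_choiceOn, if_neg (by cases b <;> simp)]
      rfl
    have hsat : ∀ ψ ∈ [theta S.diagram v₁, φ], ψ.Sat := by
      simpa using ⟨hG.sat_child hv₂ hv₁, hφs⟩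
    obtain ⟨x', lo', hi', hd₁⟩ := FL.isDec v₁ hv₁
    refine (vertex_dec_post h₁₃ (by omega) hN ?_ ?_ (hG.nodeOK_dec ?_ ?_ ?_ ?_
      (φ := bigAnd [theta S.diagram v₁, φ]) ?_ ?_ ?_)).mono (fun _ h => h) (by omega)
    · cases b <;> assumption
    · cases b <;> assumption
    · cases b <;> assumption
    · cases b <;> assumption
    · cases b
      · exact hne12.symm
      · exact hne12
    · intro y hy
      have : y ∈ (theta S.diagram v₁).vars ∨ y ∈ (theta S.diagram v₂).vars := by
        cases b
        · exact hy.symm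
        · exact hy
      exact hx y (this.elim (fun h => (hvars₂ y).2 ⟨v₁, hv₁, h⟩) id)
    · exact rigid_bigAnd hA hsat (by simpa using ⟨hG.rigid _ _ _ _ hd₁, hφr⟩)
        (by simpa using hbig)
    · exact hA.tight hsat (by simpa using ⟨hG.canon.tight hm₁, hφt⟩)
    · rw [← hpost]
      exact hequiv
  · rw [if_neg hbig]
    refine (conjVertex_post (N := N) h₁₃ (by omega) hN (F := [v₁, v]) ?_ ?_).mono
      (fun _ h => h) (by omega)
    · have hnev : v₁ ≠ v := by
        rintro rfl
        rw [θ₁] at hvv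
        rw [hvv, disjoint_self] at hdis
        rw [Finset.bot_eq_empty, hφv] at hdis
        exact Finset.insert_ne_empty _ _ hdis
      obtain ⟨x', lo', hi', hd₁⟩ := FL.isDec v₁ hv₁
      refine ⟨by simpa using hnev, ?_, ?_, ?_⟩
      · simp only [List.mem_cons, List.not_mem_nil, or_false, forall_eq_or_imp, forall_eq]
        exact ⟨⟨_, _, _, h₁₃.sub hd₁⟩, ⟨_, _, _, hv⟩⟩
      · simp only [List.mem_cons, List.not_mem_nil, or_false]
        rintro a (rfl | rfl) c (rfl | rfl) hac
        · exact absurd rfl hac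
        · rw [θ₁, hvv]
          exact hdis
        · rw [θ₁, hvv]
          exact hdis.symm
        · exact absurd rfl hac
      · simp only [List.mem_cons, List.not_mem_nil, or_false]
        rintro a (rfl | rfl) c (rfl | rfl) ha hc
        · rfl
        · rw [θ₁] at ha
          rw [hvv] at hc
          exact absurd ⟨ha, hc⟩ hbig
        · rw [θ₁] at hc
          rw [hvv] at ha
          exact absurd ⟨hc, ha⟩ hbig
        · rfl
    · intro ω
      rw [← hequiv ω]
      simp only [List.map_cons, List.map_nil, bigAnd, eval, θ₁, hve ω]

/-! ### Common factors of the children of a decision vertex -/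

theorem dropLarge_spec (h : StoreInv j S) (hN : S.length + 2 ≤ N) {l : List ℕ}
    (hl : ∀ v ∈ l, v ∈ names S.diagram) :
    (dropLarge j S l).Spec (fun r => r.Sublist l ∧
        ∀ w ∈ l, w ∈ r ↔ ¬ j < ((theta S.diagram w).vars.card : ℕ∞))
      (4 * (N + 1) ^ 2 * l.length + (N + 1) ^ 2) := by
  have h1 := succ_le_sq N
  induction l with
  | nil => exact Spec.tick_bind (by omega) (Spec.pure (by simp))
  | cons v l ih =>
    obtain ⟨nd, hv⟩ := Diagram.mem_names.1 (hl v (by simp))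
    rw [List.length_cons, Nat.mul_succ]
    refine Spec.tick_bind (by omega) ?_
    refine Spec.bind (ih fun w hw => hl w (List.mem_cons_of_mem _ hw)) (by omega) ?_
    rintro r ⟨hr, hm⟩
    refine Spec.bind (h.find_spec hN hv) (by omega) ?_
    rintro e ⟨he, rfl, -⟩
    have hel := h.length_vars_le he
    refine Spec.bind (len_spec e.vars) (by omega) ?_
    rintro k rfl
    have hk := h.length_vars he
    by_cases hj : j < (e.vars.length : ℕ∞)
    · rw [if_pos hj]
      rw [hk] at hj
      refine Spec.pure ⟨hr.cons _, fun w hw => ?_⟩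
      rcases List.mem_cons.1 hw with rfl | hw
      · by_cases hmem : e.name ∈ r
        · exact hm _ (hr.subset hmem)
        · simp [hmem, hj]
      · exact hm w hw
    · rw [if_neg hj]
      rw [hk] at hj
      refine Spec.pure ⟨hr.cons_cons _, fun w hw => ?_⟩
      rcases List.mem_cons.1 hw with rfl | hw
      · simpa using hj
      · rw [List.mem_cons, hm w hw]
        constructor
        · rintro (rfl | h)
          · exact hj
          · exact h
        · exact Or.inr

/-- A part of a conjunction is separated from the rest. -/
theorem eval_filter_not_mem {a U : List ℕ} (hU : U ⊆ a) (ω : ℕ → Bool) :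
    eval ω (bigAnd (a.map (theta G))) =
      (eval ω (bigAnd ((a.filter (· ∉ U)).map (theta G))) &&
        eval ω (bigAnd (U.map (theta G)))) := by
  rw [Bool.eq_iff_iff, Bool.and_eq_true, eval_map, eval_map, eval_map]
  constructor
  · exact fun h => ⟨fun w hw => h w (List.mem_filter.1 hw).1, fun w hw => h w (hU hw)⟩
  · rintro ⟨h1, h2⟩ w hw
    by_cases hwU : w ∈ U
    · exact h2 w hwU
    · exact h1 w (List.mem_filter.2 ⟨hw, by simpa using hwU⟩)

/-- A decision vertex whose children are `∧`-vertices with common children is equivalent to the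
conjunction of these and a decision between the remaining factors, which is rigid.  If this decision
has more than `j` variables, then a common factor with more than `j` variables has to stay in it,
and it remains rigid. -/
theorem extractShare_spec (h : StoreInv j S) (hN : S.length + 7 ≤ N) {x lo hi : ℕ}
    {a b V : List ℕ} (hlo : (lo, Node.conj a) ∈ S.diagram) (hhi : (hi, Node.conj b) ∈ S.diagram)
    (hx : ∀ y, y ∈ (theta S.diagram lo).vars ∨ y ∈ (theta S.diagram hi).vars → x < y)
    (hV : V = a.filter (· ∈ b)) :
    (extractShare j S x lo hi a b V).Spec
      (DecisionPost j S (choice x (theta S.diagram lo) (theta S.diagram hi)))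
      (150 * (N + 1) ^ 3) := by
  have c1 := one_le_cube N
  have c2 := sq_le_cube N
  have c3 := succ_le_sq N
  have hG := h.good
  have FA := hG.factorList hlo
  have FB := hG.factorList hhi
  have la := FA.length_le
  have lb := FB.length_le
  rw [S.length_diagram] at la lb
  have mlo := mem_names_of_mem hlo
  have mhi := mem_names_of_mem hhi
  refine Spec.tick_bind (by omega) ?_
  by_cases hlh : lo = hi
  · rw [if_pos hlh]
    subst hlh
    refine Spec.pure ⟨(Extends.refl h).mono (by omega), mlo, fun ω => ?_⟩
    rw [eval_choice]
    simp
  rw [if_neg hlh]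
  have hVs : V.Sublist a := hV ▸ List.filter_sublist
  have hmV : ∀ w, w ∈ V ↔ w ∈ a ∧ w ∈ b := by simp [hV]
  have hVb : V ⊆ b := fun w hw => ((hmV w).1 hw).2
  have FV := FA.sublist hVs
  have lV := hVs.length_le
  have vlo : ∀ y, y ∈ (theta S.diagram lo).vars ↔ ∃ w ∈ a, y ∈ (theta S.diagram w).vars :=
    fun y => hG.wf.mem_vars_factors hlo
  have vhi : ∀ y, y ∈ (theta S.diagram hi).vars ↔ ∃ w ∈ b, y ∈ (theta S.diagram w).vars :=
    fun y => hG.wf.mem_vars_factors hhi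
  -- The formulas that arise from `lo` and `hi` by the removal of common factors.
  set A : List ℕ → Formula := fun U => bigAnd ((a.filter (· ∉ U)).map (theta S.diagram)) with hA
  set B : List ℕ → Formula := fun U => bigAnd ((b.filter (· ∉ U)).map (theta S.diagram)) with hB
  have FAU : ∀ U : List ℕ, FactorList j S.diagram (a.filter (· ∉ U)) :=
    fun U => FA.sublist List.filter_sublist
  have FBU : ∀ U : List ℕ, FactorList j S.diagram (b.filter (· ∉ U)) :=
    fun U => FB.sublist List.filter_sublist
  have xA : ∀ U, ∀ y ∈ (A U).vars, x < y := by
    intro U y hy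
    obtain ⟨w, hw, hy⟩ := mem_vars_map.1 hy
    exact hx y (Or.inl ((vlo y).2 ⟨w, (List.mem_filter.1 hw).1, hy⟩))
  have xB : ∀ U, ∀ y ∈ (B U).vars, x < y := by
    intro U y hy
    obtain ⟨w, hw, hy⟩ := mem_vars_map.1 hy
    exact hx y (Or.inr ((vhi y).2 ⟨w, (List.mem_filter.1 hw).1, hy⟩))
  have eA : ∀ U, U ⊆ a → ∀ ω, eval ω (theta S.diagram lo) =
      (eval ω (A U) && eval ω (bigAnd (U.map (theta S.diagram)))) := fun U hU ω => by
    rw [hG.wf.theta_conj hlo, eval_filter_not_mem hU]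
  have eB : ∀ U, U ⊆ b → ∀ ω, eval ω (theta S.diagram hi) =
      (eval ω (B U) && eval ω (bigAnd (U.map (theta S.diagram)))) := fun U hU ω => by
    rw [hG.wf.theta_conj hhi, eval_filter_not_mem hU]
  have neAB : ∀ U, U ⊆ a → U ⊆ b → ¬ (A U).Equivalent (B U) := fun U hUa hUb e =>
    hlh (hG.canon.eq_of_equivalent mlo mhi fun ω => by rw [eA U hUa, eB U hUb, e ω])
  have tAB : ∀ U, U ⊆ a → U ⊆ b → (choice x (A U) (B U)).Tight := fun U hUa hUb =>
    tight_choice ((FAU U).tight_bigAnd hG) ((FBU U).tight_bigAnd hG)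
      (fun h => (xA U x h).false) (fun h => (xB U x h).false) (neAB U hUa hUb)
  have rAB : (choice x (A V) (B V)).Rigid j := by
    refine (FAU V).rigid_choice (FBU V) hG (fun h => (xA V x h).false)
      (fun h => (xB V x h).false) fun w hw hw' => ?_
    obtain ⟨h1, h2⟩ := List.mem_filter.1 hw
    exact (of_decide_eq_true h2) ((hmV w).2 ⟨h1, (List.mem_filter.1 hw').1⟩)
  have hmemlo : ∀ v ∈ (Node.dec x lo hi).children, v ∈ names S.diagram := by
    simpa [Node.children] using ⟨mlo, mhi⟩
  refine Spec.bind (nodeVars_spec (N := N) h (by omega) hmemlo (by simp [Node.children]; omega))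
    (by omega) ?_
  rintro w ⟨hwn, hwl, hwm⟩
  refine Spec.bind (varsOf_spec_le (N := N) h (by omega) (fun v hv => FV.mem_names hv)
    (by omega)) (by omega) ?_
  rintro vs ⟨hvn, hvm⟩
  have lvs : vs.length ≤ S.length := h.length_le hvn fun y hy => by
    obtain ⟨u, hu, hy⟩ := (hvm y).1 hy
    exact ⟨u, FV.mem_names hu, hy⟩
  refine Spec.bind (diff_spec_le (N := N) (m := vs) (l := w) (by omega) hwl) (by omega) ?_
  rintro d hd
  have ld : d.length ≤ w.length := by
    rw [hd]
    exact List.length_filter_le _ _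
  refine Spec.bind (len_spec d) (by omega) ?_
  rintro k hk
  -- The number `k` is the number of variables of the decision formula without common factors.
  have hkc : k = (choice x (A V) (B V)).vars.card := by
    have hdn : d.Nodup := hd ▸ hwn.filter _
    rw [hk, ← List.toFinset_card_of_nodup hdn]
    congr 1
    ext y
    rw [List.mem_toFinset, hd, List.mem_filter, hwm]
    simp only [nodeTheta, vars_choice, Finset.mem_insert, Finset.mem_union, decide_eq_true_eq,
      vlo, vhi, hvm, hA, hB, mem_vars_map, List.mem_filter]
    constructor
    · rintro ⟨rfl | ⟨u, hu, hy⟩ | ⟨u, hu, hy⟩, hn⟩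
      · exact Or.inl rfl
      · exact Or.inr (Or.inl ⟨u, ⟨hu, fun huV => hn ⟨u, huV, hy⟩⟩, hy⟩)
      · exact Or.inr (Or.inr ⟨u, ⟨hu, fun huV => hn ⟨u, huV, hy⟩⟩, hy⟩)
    · rintro (rfl | ⟨u, ⟨hu, huV⟩, hy⟩ | ⟨u, ⟨hu, huV⟩, hy⟩)
      · refine ⟨Or.inl rfl, ?_⟩
        rintro ⟨u, hu, hy⟩
        exact (hx y (Or.inl ((vlo y).2 ⟨u, hVs.subset hu, hy⟩))).false
      · refine ⟨Or.inr (Or.inl ⟨u, hu, hy⟩), ?_⟩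
        rintro ⟨u', hu', hy'⟩
        refine Finset.disjoint_left.1 (FA.disjoint u hu u' (hVs.subset hu') ?_) hy hy'
        rintro rfl
        exact huV hu'
      · refine ⟨Or.inr (Or.inr ⟨u, hu, hy⟩), ?_⟩
        rintro ⟨u', hu', hy'⟩
        refine Finset.disjoint_left.1 (FB.disjoint u hu u' (hVb hu') ?_) hy hy'
        rintro rfl
        exact huV hu'
  have hdrop : (if j < (k : ℕ∞) then dropLarge j S V else pure V).Spec
      (fun V' => V'.Sublist V ∧
        (∀ w ∈ V', j < (k : ℕ∞) → ¬ j < ((theta S.diagram w).vars.card : ℕ∞)) ∧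
        ∀ w ∈ V, w ∉ V' → j < (k : ℕ∞) ∧ j < ((theta S.diagram w).vars.card : ℕ∞))
      (4 * (N + 1) ^ 3) := by
    by_cases hjk : j < (k : ℕ∞)
    · rw [if_pos hjk]
      refine (dropLarge_spec (N := N) h (by omega) fun v hv => FV.mem_names hv).mono ?_ ?_
      · rintro r ⟨hr, hm⟩
        refine ⟨hr, fun w hw _ => (hm w (hr.subset hw)).1 hw, fun w hw hwr => ⟨hjk, ?_⟩⟩
        by_contra hno
        exact hwr ((hm w hw).2 hno)
      · have := mul_sq_add_le_cube (N := N) (n := 4) (k := V.length) (by omega)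
        omega
    · rw [if_neg hjk]
      exact Spec.pure ⟨List.Sublist.refl _, fun _ _ h => absurd h hjk,
        fun w hw hw' => absurd hw hw'⟩
  refine Spec.ite_bind (Spec.bind hdrop (by omega) ?_)
  rintro V' ⟨hV', hsm, hlg⟩
  have hV'a : V' ⊆ a := fun w hw => hVs.subset (hV'.subset hw)
  have hV'b : V' ⊆ b := fun w hw => hVb (hV'.subset hw)
  have lV' := hV'.length_le
  have FV' := FV.sublist hV'
  -- A large common factor stays in the decision formula, next to a large second factor.
  have rAB' : (choice x (A V') (B V')).Rigid j := by
    by_cases hex : ∃ w₀ ∈ V, w₀ ∉ V'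
    · obtain ⟨w₀, hw₀, hw₀'⟩ := hex
      obtain ⟨hjk, hjw⟩ := hlg w₀ hw₀ hw₀'
      have hiff : ∀ w, w ∉ V' ↔ w ∉ V ∨ w = w₀ := by
        intro w
        constructor
        · intro hw
          by_cases hwV : w ∈ V
          · exact Or.inr (FV.large w hwV w₀ hw₀ (hlg w hwV hw).2 hjw)
          · exact Or.inl hwV
        · rintro (hw | rfl)
          · exact fun hw' => hw (hV'.subset hw')
          · exact hw₀'
      have hw₀a := hVs.subset hw₀
      have hw₀b := hVb hw₀
      have ev : ∀ (c : List ℕ), w₀ ∈ c → ∀ ω,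
          eval ω (bigAnd ((c.filter (· ∉ V')).map (theta S.diagram))) =
          (eval ω (theta S.diagram w₀) &&
            eval ω (bigAnd ((c.filter (· ∉ V)).map (theta S.diagram)))) := by
        intro c hc ω
        rw [Bool.eq_iff_iff, Bool.and_eq_true, eval_map, eval_map]
        simp only [List.mem_filter, decide_eq_true_eq, hiff]
        constructor
        · exact fun h => ⟨h w₀ ⟨hc, Or.inr rfl⟩, fun w hw => h w ⟨hw.1, Or.inl hw.2⟩⟩
        · rintro ⟨h1, h2⟩ w ⟨hw, hw' | rfl⟩
          · exact h2 w ⟨hw, hw'⟩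
          · exact h1
      have e : (bigAnd [theta S.diagram w₀, choice x (A V) (B V)]).Equivalent
          (choice x (A V') (B V')) := by
        intro ω
        simp only [bigAnd, eval, eval_choice, hA, hB, ev a hw₀a, ev b hw₀b]
        split <;> simp
      have hdis : Disjoint (theta S.diagram w₀).vars (choice x (A V) (B V)).vars := by
        rw [Finset.disjoint_left]
        intro y hy hy'
        rw [vars_choice, Finset.mem_insert, Finset.mem_union] at hy'
        rcases hy' with rfl | hy' | hy'
        · exact (hx y (Or.inl ((vlo y).2 ⟨w₀, hw₀a, hy⟩))).false
        · obtain ⟨u, hu, hyu⟩ := mem_vars_map.1 hy'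
          obtain ⟨hu, huV⟩ := List.mem_filter.1 hu
          refine Finset.disjoint_left.1 (FA.disjoint w₀ hw₀a u hu ?_) hy hyu
          rintro rfl
          exact (of_decide_eq_true huV) hw₀
        · obtain ⟨u, hu, hyu⟩ := mem_vars_map.1 hy'
          obtain ⟨hu, huV⟩ := List.mem_filter.1 hu
          refine Finset.disjoint_left.1 (FB.disjoint w₀ hw₀b u hu ?_) hy hyu
          rintro rfl
          exact (of_decide_eq_true huV) hw₀
      have hAp : Apart [theta S.diagram w₀, choice x (A V) (B V)] :=
        pairwise_disjoint_apart (by simpa using hdis)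
      have hsat : ∀ ψ ∈ [theta S.diagram w₀, choice x (A V) (B V)], ψ.Sat := by
        simpa using ⟨hG.sat_child hlo hw₀a, sat_choice_left ((FAU V).sat_bigAnd hG)
          fun h => (xA V x h).false⟩
      obtain ⟨x', l', h', hd₀⟩ := FA.isDec w₀ hw₀a
      refine (rigid_bigAnd hAp hsat ?_ ?_).congr e ((hAp.tight hsat ?_).vars_eq
        (tAB V' hV'a hV'b) e)
      · simpa using ⟨hG.rigid _ _ _ _ hd₀, rAB⟩
      · rw [hkc] at hjk
        simpa using ⟨hjw, hjk⟩
      · simpa using ⟨hG.canon.tight (FA.mem_names hw₀a), tAB V hVs.subset hVb⟩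
    · push Not at hex
      have hiff : ∀ w, w ∈ V' ↔ w ∈ V := fun w => ⟨fun hw => hV'.subset hw, hex w⟩
      simpa only [hA, hB, hiff] using rAB
  have hfull : ∀ ω, eval ω (choice x (theta S.diagram lo) (theta S.diagram hi)) =
      (eval ω (choice x (A V') (B V')) && eval ω (bigAnd (V'.map (theta S.diagram)))) := by
    intro ω
    rw [eval_choice, eval_choice, eA V' hV'a, eB V' hV'b]
    split <;> simp
  rcases V' with _ | ⟨v₀, l⟩
  · dsimp only
    refine (vertex_dec_post (Extends.refl h) (by omega) hN mlo mhi (hG.nodeOK_dec mlo mhi hlh hx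
      rAB' (tAB [] hV'a hV'b) fun ω => ?_)).mono (fun _ h => h) (by omega)
    rw [hfull]
    simp [bigAnd, eval]
  dsimp only
  refine Spec.bind (diff_spec_le (N := N) (m := v₀ :: l) (l := a) (by omega) (by omega))
    (by omega) ?_
  rintro _ rfl
  refine Spec.bind (conjVertex_spec (N := N) h (by omega) (FAU (v₀ :: l))) (by omega) ?_
  rintro ⟨lo', S₁⟩ ⟨h₁, hlo', elo⟩
  dsimp only at h₁ hlo' elo ⊢
  have l₁ := h₁.length
  refine Spec.bind (diff_spec_le (N := N) (m := v₀ :: l) (l := b) (by omega) (by omega))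
    (by omega) ?_
  rintro _ rfl
  refine Spec.bind (conjVertex_spec (N := N) h₁.inv (by omega)
    ((FBU (v₀ :: l)).of_subset hG.wf h₁.inv.good.wf h₁.sub)) (by omega) ?_
  rintro ⟨hi', S₂⟩ ⟨h₂, hhi', ehi⟩
  dsimp only at h₂ hhi' ehi ⊢
  have l₂ := h₂.length
  rw [h₁.map_theta fun w hw => (FBU (v₀ :: l)).mem_names hw] at ehi
  have hlo₂ := h₂.mem_names hlo'
  have elo₂ : (theta S₂.diagram lo').Equivalent (A (v₀ :: l)) := by
    rw [h₂.theta lo' hlo']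
    exact elo
  have ehi₂ : (theta S₂.diagram hi').Equivalent (B (v₀ :: l)) := ehi
  have vlo₂ := h₂.inv.good.vars_eq_of_equivalent hlo₂ ((FAU (v₀ :: l)).tight_bigAnd hG) elo₂
  have vhi₂ := h₂.inv.good.vars_eq_of_equivalent hhi' ((FBU (v₀ :: l)).tight_bigAnd hG) ehi₂
  have eφ : (choice x (theta S₂.diagram lo') (theta S₂.diagram hi')).Equivalent
      (choice x (A (v₀ :: l)) (B (v₀ :: l))) := elo₂.choice ehi₂
  have hok : NodeOK j S₂.diagram (.dec x lo' hi') := by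
    refine h₂.inv.good.nodeOK_dec hlo₂ hhi' ?_ ?_ rAB' (tAB (v₀ :: l) hV'a hV'b) eφ.symm
    · rintro rfl
      exact neAB (v₀ :: l) hV'a hV'b (elo₂.symm.trans ehi₂)
    · rw [vlo₂, vhi₂]
      exact fun y hy => hy.elim (xA (v₀ :: l) y) (xB (v₀ :: l) y)
  refine Spec.bind (vertex_dec_spec (N := N) h₂.inv (by omega) hok) (by omega) ?_
  rintro ⟨v, S₃⟩ ⟨h₃, -, hv⟩
  dsimp only at h₃ hv ⊢
  have h₁₃ := (h₁.trans h₂).trans h₃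
  have hve : (theta S₃.diagram v).Equivalent (choice x (A (v₀ :: l)) (B (v₀ :: l))) := by
    rw [h₃.theta_dec hv hlo₂ hhi']
    exact eφ
  have hvv := h₃.inv.good.vars_eq_of_equivalent (mem_names_of_mem hv)
    (tAB (v₀ :: l) hV'a hV'b) hve
  have F₃ := FV'.of_subset hG.wf h₃.inv.good.wf h₁₃.sub
  refine (conjVertex_post (N := N) h₁₃ (by omega) hN (F := v :: v₀ :: l) ?_ fun ω => ?_).mono
    (fun _ h => h) (by omega)
  · have hdis : ∀ u ∈ v₀ :: l, Disjoint (theta S₃.diagram v).vars (theta S₃.diagram u).vars := by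
      intro u hu
      rw [hvv, h₁₃.theta u (FV'.mem_names hu), Finset.disjoint_left]
      intro y hy' hy
      rw [vars_choice, Finset.mem_insert, Finset.mem_union] at hy'
      rcases hy' with rfl | hy' | hy'
      · exact (hx y (Or.inl ((vlo y).2 ⟨u, hV'a hu, hy⟩))).false
      · obtain ⟨u', hu', hyu⟩ := mem_vars_map.1 hy'
        obtain ⟨hu', huV⟩ := List.mem_filter.1 hu'
        refine Finset.disjoint_left.1 (FA.disjoint u (hV'a hu) u' hu' ?_) hy hyu
        rintro rfl
        exact (of_decide_eq_true huV) hu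
      · obtain ⟨u', hu', hyu⟩ := mem_vars_map.1 hy'
        obtain ⟨hu', huV⟩ := List.mem_filter.1 hu'
        refine Finset.disjoint_left.1 (FB.disjoint u (hV'b hu) u' hu' ?_) hy hyu
        rintro rfl
        exact (of_decide_eq_true huV) hu
    have hvnot : v ∉ v₀ :: l := by
      intro hmem
      have := hdis v hmem
      rw [disjoint_self, Finset.bot_eq_empty, hvv, vars_choice] at this
      exact Finset.insert_ne_empty _ _ this
    -- If the new vertex is large, then all large factors have been removed from the list.
    have hone : ∀ u ∈ v₀ :: l, j < ((theta S₃.diagram v).vars.card : ℕ∞) →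
        ¬ j < ((theta S₃.diagram u).vars.card : ℕ∞) := by
      intro u hu hjv
      rw [h₁₃.theta u (FV'.mem_names hu)]
      by_cases hjk : j < (k : ℕ∞)
      · exact hsm u hu hjk
      · intro hju
        refine hjk (hjv.trans_le ?_)
        rw [hvv, hkc]
        refine Nat.cast_le.2 (Finset.card_le_card ?_)
        have hiff : ∀ w, w ∈ v₀ :: l ↔ w ∈ V := fun w =>
          ⟨fun hw => hV'.subset hw, fun hw => by
            by_contra hno
            exact hjk (hlg w hw hno).1⟩
        simp only [hA, hB, hiff]
        exact Finset.Subset.refl _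
    refine ⟨List.nodup_cons.2 ⟨hvnot, F₃.nodup⟩, ?_, ?_, ?_⟩
    · intro w hw
      rcases List.mem_cons.1 hw with rfl | hw
      · exact ⟨_, _, _, hv⟩
      · exact F₃.isDec w hw
    · intro p hp q hq hpq
      rw [List.mem_cons (a := p)] at hp
      rw [List.mem_cons (a := q)] at hq
      rcases hp with rfl | hp <;> rcases hq with rfl | hq
      · exact absurd rfl hpq
      · exact hdis q hq
      · exact (hdis p hp).symm
      · exact F₃.disjoint p hp q hq hpq
    · intro p hp q hq h1 h2
      rw [List.mem_cons (a := p)] at hp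
      rw [List.mem_cons (a := q)] at hq
      rcases hp with rfl | hp <;> rcases hq with rfl | hq
      · rfl
      · exact absurd h2 (hone q hq h1)
      · exact absurd h1 (hone p hp h2)
      · exact F₃.large p hp q hq h1 h2
  · rw [hfull, List.map_cons, h₁₃.map_theta fun w hw => FV'.mem_names hw]
    simp only [bigAnd, eval, hve ω]

theorem isPart_spec {v : ℕ} {nd : Node} (hn : nd.children.length ≤ N) :
    (isPart v nd).Spec (fun r => r = true ↔ ∃ ch, nd = .conj ch ∧ v ∈ ch) (N + 2) := by
  rcases nd with b | ⟨x, lo, hi⟩ | ch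
  · exact Spec.tick_bind (by omega) (Spec.pure (by simp))
  · exact Spec.tick_bind (by omega) (Spec.pure (by simp))
  · refine Spec.tick_bind (by omega) ((isMem_spec v ch).mono (fun r hr => by simp [hr]) ?_)
    simp only [Node.children] at hn
    omega

theorem conjChildren_spec (nd : Node) :
    (conjChildren nd).Spec (fun r => nd = .conj r ∨ r = [] ∧ ∀ ch, nd ≠ .conj ch) 1 := by
  rcases nd with b | ⟨x, lo, hi⟩ | ch <;> exact Spec.tick_bind le_rfl (Spec.pure (by simp))

theorem decompDecision_spec (h : StoreInv j S) (hN : S.length + 7 ≤ N) {x lo hi : ℕ}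
    (hlo : lo ∈ names S.diagram) (hhi : hi ∈ names S.diagram)
    (hx : ∀ y, y ∈ (theta S.diagram lo).vars ∨ y ∈ (theta S.diagram hi).vars → x < y) :
    (decompDecision j S x lo hi).Spec
      (DecisionPost j S (choice x (theta S.diagram lo) (theta S.diagram hi)))
      (200 * (N + 1) ^ 3) := by
  have c1 := one_le_cube N
  have c2 := sq_le_cube N
  have c3 := succ_le_sq N
  have hG := h.good
  obtain ⟨nl, hl⟩ := Diagram.mem_names.1 hlo
  obtain ⟨nh, hh⟩ := Diagram.mem_names.1 hhi
  have lnl := h.length_children (N := N) (by omega) hl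
  have lnh := h.length_children (N := N) (by omega) hh
  refine Spec.tick_bind (by omega) ?_
  refine Spec.bind (h.find_spec (N := N) (by omega) hl) (by omega) ?_
  rintro el ⟨-, -, hel⟩
  refine Spec.bind (h.find_spec (N := N) (by omega) hh) (by omega) ?_
  rintro eh ⟨-, -, heh⟩
  rw [hel, heh]
  refine Spec.bind (nodeVars_spec (N := N) h (by omega) (nd := .dec x lo hi)
    (by simpa [Node.children] using ⟨hlo, hhi⟩) (by simp [Node.children]; omega))
    (by omega) ?_
  rintro w ⟨hwn, hwl, hwm⟩
  refine Spec.bind (len_spec w) (by omega) ?_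
  rintro k hk
  have hkc : k = (choice x (theta S.diagram lo) (theta S.diagram hi)).vars.card := by
    rw [hk, ← List.toFinset_card_of_nodup hwn]
    congr 1
    ext y
    rw [List.mem_toFinset, hwm]
    rfl
  refine Spec.bind (isBot_spec nl) (by omega) fun loBot hloBot => ?_
  refine Spec.bind (isBot_spec nh) (by omega) fun hiBot hhiBot => ?_
  refine Spec.bind (conjChildren_spec nl) (by omega) fun a ha => ?_
  refine Spec.bind (conjChildren_spec nh) (by omega) fun b hb => ?_
  refine Spec.bind (isPart_spec (v := lo) lnh) (by omega) fun loPart hloPart => ?_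
  refine Spec.bind (isPart_spec (v := hi) lnl) (by omega) fun hiPart hhiPart => ?_
  have la : a.length ≤ N := by
    rcases ha with rfl | ⟨rfl, -⟩
    · exact lnl
    · simp
  have lb : b.length ≤ N := by
    rcases hb with rfl | ⟨rfl, -⟩
    · exact lnh
    · simp
  refine Spec.bind (inter_spec_le (N := N) (m := b) (l := a) lb la) (by omega) fun V hV => ?_
  by_cases hbot : ((loBot || hiBot) && decide (1 < k)) = true
  · rw [if_pos hbot]
    rw [Bool.and_eq_true, Bool.or_eq_true, hloBot, hhiBot, decide_eq_true_eq] at hbot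
    obtain ⟨hbot, hk1⟩ := hbot
    have hvar : (theta S.diagram lo).vars.Nonempty ∨ (theta S.diagram hi).vars.Nonempty := by
      by_contra hno
      rw [not_or, Finset.not_nonempty_iff_eq_empty, Finset.not_nonempty_iff_eq_empty] at hno
      rw [hkc, vars_choice, hno.1, hno.2] at hk1
      simp at hk1
    have hleaf : ∀ v nd, (v, nd) ∈ S.diagram → nd = .leaf false →
        ¬ (theta S.diagram v).vars.Nonempty := by
      rintro v nd hv rfl hne
      rw [vars_leaf hG.wf hv] at hne
      exact Finset.not_nonempty_empty hne
    refine (extractLeaf_spec h hN hlo hhi hx ?_ ?_).mono (fun _ h => h) (by omega)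
    · cases loBot
      · obtain rfl : nh = .leaf false :=
          hbot.resolve_left fun h => Bool.false_ne_true (hloBot.2 h)
        simpa using hh
      · obtain rfl : nl = .leaf false := hloBot.1 rfl
        simpa using hl
    · cases loBot
      · have : nh = .leaf false :=
          hbot.resolve_left fun h => Bool.false_ne_true (hloBot.2 h)
        simpa using hvar.resolve_right (hleaf hi nh hh this)
      · simpa using hvar.resolve_left (hleaf lo nl hl (hloBot.1 rfl))
  rw [if_neg hbot]
  by_cases hlp : loPart = true
  · rw [if_pos hlp]
    obtain ⟨ch, rfl, hch⟩ := hloPart.1 hlp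
    obtain rfl : ch = b := by
      rcases hb with h' | ⟨-, h'⟩
      · cases h'
        rfl
      · exact absurd rfl (h' ch)
    exact (extractPart_spec h hN hh hch (fun y hy => hx y (Or.inr hy)) true).mono
      (fun _ h => h) (by omega)
  rw [if_neg hlp]
  by_cases hhp : hiPart = true
  · rw [if_pos hhp]
    obtain ⟨ch, rfl, hch⟩ := hhiPart.1 hhp
    obtain rfl : ch = a := by
      rcases ha with h' | ⟨-, h'⟩
      · cases h'
        rfl
      · exact absurd rfl (h' ch)
    exact (extractPart_spec h hN hl hch (fun y hy => hx y (Or.inl hy)) false).mono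
      (fun _ h => h) (by omega)
  rw [if_neg hhp]
  by_cases hVe : (!V.isEmpty) = true
  · rw [if_pos hVe]
    obtain ⟨u, hu⟩ : ∃ u, u ∈ V := by
      cases V with
      | nil => simp at hVe
      | cons u l => exact ⟨u, List.mem_cons_self⟩
    rw [hV, List.mem_filter, decide_eq_true_eq] at hu
    rcases ha with rfl | ⟨rfl, -⟩
    · rcases hb with rfl | ⟨rfl, -⟩
      · exact (extractShare_spec h hN hl hh hx hV).mono (fun _ h => h) (by omega)
      · cases hu.2
    · cases hu.1
  rw [if_neg hVe]
  by_cases hlh : lo = hi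
  · rw [if_pos hlh]
    subst hlh
    refine Spec.pure ⟨(Extends.refl h).mono (by omega), hlo, fun ω => ?_⟩
    rw [eval_choice]
    simp
  rw [if_neg hlh]
  refine (vertex_dec_post (Extends.refl h) (by omega) hN hlo hhi ?_).mono (fun _ h => h) (by omega)
  by_cases hbb : nl = .leaf false ∨ nh = .leaf false
  · refine ⟨hlo, hhi, hlh, hx, rigid_of_vars_eq_singleton (x := x) ?_⟩
    have hk1 : ¬ 1 < k := fun hk1 => hbot (by
      rw [Bool.and_eq_true, Bool.or_eq_true, hloBot, hhiBot, decide_eq_true_eq]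
      exact ⟨hbb, hk1⟩)
    rw [hkc, not_lt, Finset.card_le_one_iff_subset_singleton] at hk1
    obtain ⟨z, hz⟩ := hk1
    have hxv : x ∈ (choice x (theta S.diagram lo) (theta S.diagram hi)).vars := by
      simp [vars_choice]
    obtain rfl := Finset.mem_singleton.1 (hz hxv)
    exact hz.antisymm (Finset.singleton_subset_iff.2 hxv)
  · rw [not_or] at hbb
    have el := hG.wf.equivalent_factors hl hbb.1
    have eh := hG.wf.equivalent_factors hh hbb.2
    have Fl := hG.factors hl
    have Fh := hG.factors hh
    have hxl : x ∉ (bigAnd ((factors lo nl).map (theta S.diagram))).vars := fun hmem =>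
      (hx x (Or.inl ((hG.wf.mem_vars_factors hl).2 (mem_vars_map.1 hmem)))).false
    have hxh : x ∉ (bigAnd ((factors hi nh).map (theta S.diagram))).vars := fun hmem =>
      (hx x (Or.inr ((hG.wf.mem_vars_factors hh).2 (mem_vars_map.1 hmem)))).false
    refine hG.nodeOK_dec hlo hhi hlh hx (Fl.rigid_choice Fh hG hxl hxh ?_)
      (tight_choice (Fl.tight_bigAnd hG) (Fh.tight_bigAnd hG) hxl hxh fun e =>
        hlh (hG.canon.eq_of_equivalent hlo hhi (el.trans (e.trans eh.symm))))
      (el.symm.choice eh.symm)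
    intro u hu hu'
    rcases nl with _ | ⟨xl, ll, hl'⟩ | cl <;> rcases nh with _ | ⟨xh, lh, hh'⟩ | chh <;>
      simp only [factors, List.mem_singleton, List.not_mem_nil] at hu hu'
    · exact hlh (hu.symm.trans hu')
    · subst hu
      exact hlp (hloPart.2 ⟨chh, rfl, hu'⟩)
    · subst hu'
      exact hhp (hhiPart.2 ⟨cl, rfl, hu⟩)
    · apply hVe
      rcases ha with ha | ⟨-, ha⟩
      · cases ha
        rcases hb with hb | ⟨-, hb⟩
        · cases hb
          have : u ∈ V := by
            rw [hV]
            simpa using ⟨hu, hu'⟩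
          cases V with
          | nil => cases this
          | cons _ _ => rfl
        · exact absurd rfl (hb _)
      · exact absurd rfl (ha _)

end Decision

/-! ### Correctness and running time of Decompose -/

section Decompose

variable {j : ℕ∞} {N : ℕ}

theorem lookup_spec {u : ℕ} {H : List (ℕ × ℕ)} (hu : u ∈ H.map Prod.fst) :
    (lookup u H).Spec (fun v => (u, v) ∈ H) (H.length + 1) := by
  induction H with
  | nil => cases hu
  | cons p H ih =>
    obtain ⟨u', v⟩ := p
    refine Spec.tick_bind (by simp) ?_
    by_cases h : u = u'
    · rw [if_pos h]
      exact Spec.pure (by simp [h])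
    · rw [if_neg h]
      refine (ih ?_).mono (fun v hv => List.mem_cons_of_mem _ hv) (by simp)
      simpa [h] using hu

theorem lookupAll_spec {H : List (ℕ × ℕ)} {l : List ℕ} (hl : ∀ u ∈ l, u ∈ H.map Prod.fst) :
    (lookupAll H l).Spec (fun r => r.length = l.length ∧ (∀ v ∈ r, ∃ u ∈ l, (u, v) ∈ H) ∧
      ∀ u ∈ l, ∃ v ∈ r, (u, v) ∈ H) ((H.length + 2) * l.length + 1) := by
  induction l with
  | nil => exact Spec.tick_bind (by simp) (Spec.pure (by simp))
  | cons u l ih =>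
    rw [List.length_cons, Nat.mul_succ]
    refine Spec.tick_bind (by omega) ?_
    refine Spec.bind (lookup_spec (hl u (by simp))) (by omega) fun v hv => ?_
    refine Spec.bind (ih fun w hw => hl w (List.mem_cons_of_mem _ hw)) (by omega) ?_
    rintro r ⟨h1, h2, h3⟩
    refine Spec.pure ⟨by simp [h1], ?_, ?_⟩
    · intro w hw
      rcases List.mem_cons.1 hw with rfl | hw
      · exact ⟨u, by simp, hv⟩
      · obtain ⟨u', hu', h⟩ := h2 w hw
        exact ⟨u', List.mem_cons_of_mem _ hu', h⟩
    · intro w hw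
      rcases List.mem_cons.1 hw with rfl | hw
      · exact ⟨v, by simp, hv⟩
      · obtain ⟨v', hv', h⟩ := h3 w hw
        exact ⟨v', List.mem_cons_of_mem _ hv', h⟩

/-- The conditions on a diagram on which Decompose with the bound `j` relies. -/
structure Input (j : ℕ∞) (G : Diagram) : Prop where
  wf : WellFormed G
  order : ∀ v x lo hi, (v, Node.dec x lo hi) ∈ G →
    ∀ y, y ∈ (theta G lo).vars ∨ y ∈ (theta G hi).vars → x < y
  bounded : ∀ v ch, (v, Node.conj ch) ∈ G →
    IsBoundedDecomposition j (ch.map (theta G)) (theta G v)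

theorem Input.of_subset {D G : Diagram} (hG : Input j G) (hD : WellFormed D) (hs : D ⊆ G) :
    Input j D := by
  have ht := hD.theta_eq_of_subset hG.wf hs
  refine ⟨hD, fun v x lo hi h => ?_, fun v ch h => ?_⟩
  · rw [ht lo (hD.child_mem h (by simp [Node.children])),
      ht hi (hD.child_mem h (by simp [Node.children]))]
    exact hG.order v x lo hi (hs h)
  · rw [ht v (mem_names_of_mem h), map_theta_congr (l := ch) fun w hw => ht w (hD.child_mem h hw)]
    exact hG.bounded v ch (hs h)

theorem input_of_mem_obddAnd {i : ℕ∞} (hij : i ≤ j) {G : Diagram} (hG : G ∈ OBDDAnd i) :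
    Input j G := by
  obtain ⟨hb, ho, hc⟩ := hG
  exact ⟨hb.wellFormed, fun v x lo hi h y hy => lt_of_ordered hb.wellFormed ho h hy,
    fun v ch h => ⟨(hc v ch h).1, fun ψ hψ χ hχ h1 h2 =>
      (hc v ch h).2 ψ hψ χ hχ (hij.trans_lt h1) (hij.trans_lt h2)⟩⟩

/-- The table `H` assigns to every vertex of `G` an equivalent vertex of the store. -/
structure Table (j : ℕ∞) (G : Diagram) (H : List (ℕ × ℕ)) (S : Store) : Prop where
  inv : StoreInv j S
  keys : H.map Prod.fst = names G
  mem : ∀ u v, (u, v) ∈ H → v ∈ names S.diagram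
  equiv : ∀ u v, (u, v) ∈ H → (theta S.diagram v).Equivalent (theta G u)

theorem Table.vars_subset {G : Diagram} {H : List (ℕ × ℕ)} {S : Store} (h : Table j G H S)
    {u v : ℕ} (huv : (u, v) ∈ H) : (theta S.diagram v).vars ⊆ (theta G u).vars :=
  (h.inv.good.canon.tight (h.mem u v huv)).vars_subset (h.equiv u v huv)

/-- The members of a `∧ⱼ`-decomposition may lose variables when they are replaced by equivalent
output vertices, since those have essential variables only; they stay separated. -/
theorem decompNode_spec {G : Diagram} {u : ℕ} {nd : Node} (hG : Input j ((u, nd) :: G))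
    {H : List (ℕ × ℕ)} {S : Store} (hT : Table j G H S) (hN : S.length + 7 ≤ N)
    (hGN : G.length ≤ N) :
    (decompNode j H S nd).Spec (DecisionPost j S (nodeTheta G nd)) (250 * (N + 1) ^ 3) := by
  have c1 := one_le_cube N
  have c2 := sq_le_cube N
  have c3 := succ_le_sq N
  have hself : (u, nd) ∈ (u, nd) :: G := List.mem_cons_self
  have hth := hG.wf.2.2.theta_eq_of_subset hG.wf (List.subset_cons_self _ _)
  have hch : ∀ w ∈ nd.children, w ∈ names G := hG.wf.2.1
  have hHl : H.length = G.length := by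
    have := congrArg List.length hT.keys
    simpa [names] using this
  rcases nd with b | ⟨x, lo, hi⟩ | ch
  · refine Spec.tick_bind (by omega) ?_
    refine (vertex_leaf_spec (N := N) hT.inv (by omega) b).mono ?_ (by omega)
    rintro r ⟨he, hm⟩
    refine ⟨he.mono (by omega), mem_names_of_mem hm, ?_⟩
    rw [he.inv.good.wf.theta_eq hm]
    cases b <;> exact fun _ => rfl
  · have hlo : lo ∈ names G := hch lo (by simp [Node.children])
    have hhi : hi ∈ names G := hch hi (by simp [Node.children])
    refine Spec.tick_bind (by omega) ?_
    refine Spec.bind (lookup_spec (by rw [hT.keys]; exact hlo)) (by omega) fun lo' hlo' => ?_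
    refine Spec.bind (lookup_spec (by rw [hT.keys]; exact hhi)) (by omega) fun hi' hhi' => ?_
    refine (decompDecision_spec hT.inv hN (hT.mem _ _ hlo') (hT.mem _ _ hhi') ?_).mono ?_
      (by omega)
    · intro y hy
      refine hG.order u x lo hi hself y ?_
      rw [← hth lo hlo, ← hth hi hhi]
      exact hy.imp (fun h => hT.vars_subset hlo' h) fun h => hT.vars_subset hhi' h
    · rintro r ⟨he, hm, e⟩
      exact ⟨he, hm, e.trans ((hT.equiv _ _ hlo').choice (hT.equiv _ _ hhi'))⟩
  · have hb := hG.bounded u ch hself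
    rw [← map_theta_congr (l := ch) fun w hw => hth w (hch w hw)] at hb
    have hp := List.pairwise_map.1 hb.1.disjoint
    have hne : ∀ w ∈ ch, (theta G w).vars.Nonempty := fun w hw =>
      hb.1.nonempty _ (List.mem_map_of_mem hw)
    have hnd : ch.Nodup := by
      refine hp.imp_of_mem ?_
      rintro a b ha _ h rfl
      exact (hne a ha).ne_empty (by simpa using h)
    have hlen : ch.length ≤ G.length := by
      have := (hnd.subperm hch).length_le
      simpa [names] using this
    have hmul : (H.length + 2) * ch.length + 1 ≤ 3 * (N + 1) ^ 2 := by
      have : (H.length + 2) * ch.length ≤ (N + 2) * N := Nat.mul_le_mul (by omega) (by omega)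
      nlinarith
    refine Spec.tick_bind (by omega) ?_
    refine Spec.bind (lookupAll_spec (H := H) (l := ch) fun w hw => by
      rw [hT.keys]
      exact hch w hw) (by omega) ?_
    rintro r ⟨hr, hr1, hr2⟩
    have : Std.Symm fun a b : ℕ => Disjoint (theta G a).vars (theta G b).vars :=
      ⟨fun _ _ h => h.symm⟩
    refine (finest_spec (N := N) hT.inv (by omega) (l := r) ?_ (by omega) ⟨?_, ?_⟩).mono ?_
      (by omega)
    · intro v hv
      obtain ⟨w, -, hw⟩ := hr1 v hv
      exact hT.mem _ _ hw
    · intro a ha b hb hab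
      obtain ⟨c, hc, hca⟩ := hr1 a ha
      obtain ⟨d, hd, hdb⟩ := hr1 b hb
      by_cases hcd : c = d
      · subst hcd
        exact absurd (hT.inv.good.canon.eq_of_equivalent (hT.mem _ _ hca) (hT.mem _ _ hdb)
          ((hT.equiv _ _ hca).trans (hT.equiv _ _ hdb).symm)) hab
      · exact (hp.forall hc hd hcd).mono (hT.vars_subset hca) (hT.vars_subset hdb)
    · intro a ha b hb' h1 h2
      obtain ⟨c, hc, hca⟩ := hr1 a ha
      obtain ⟨d, hd, hdb⟩ := hr1 b hb'
      have e := hb.2 _ (List.mem_map_of_mem hc) _ (List.mem_map_of_mem hd)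
        (h1.trans_le (Nat.cast_le.2 (Finset.card_le_card (hT.vars_subset hca))))
        (h2.trans_le (Nat.cast_le.2 (Finset.card_le_card (hT.vars_subset hdb))))
      have hdb' := hT.equiv _ _ hdb
      rw [← e] at hdb'
      exact hT.inv.good.canon.eq_of_equivalent (hT.mem _ _ hca) (hT.mem _ _ hdb)
        ((hT.equiv _ _ hca).trans hdb'.symm)
    · rintro r' ⟨he, hm, e⟩
      refine ⟨he.mono (by omega), hm, e.trans (equivalent_of_imp (fun ω hω => ?_)
        fun ω hω => ?_)⟩
      · rw [nodeTheta, eval_map]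
        rw [eval_map] at hω
        intro w hw
        obtain ⟨v, hv, hwv⟩ := hr2 w hw
        rw [← hT.equiv _ _ hwv ω]
        exact hω v hv
      · rw [nodeTheta, eval_map] at hω
        rw [eval_map]
        intro v hv
        obtain ⟨w, hw, hwv⟩ := hr1 v hv
        rw [hT.equiv _ _ hwv ω]
        exact hω w hw

theorem storeInv_nil : StoreInv j [] :=
  ⟨⟨⟨trivial, ⟨by simp [Store.diagram], by simp [Store.diagram]⟩, by simp [Store.diagram],
    by simp [Store.diagram], by simp [Store.diagram], by simp [Store.diagram]⟩,
    by simp [Store.diagram], by simp [Store.diagram], by simp [Store.diagram]⟩,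
    List.Pairwise.nil, by simp, by simp⟩

theorem decompAll_spec {G : Diagram} (hG : Input j G) (hN : 5 * G.length + 7 ≤ N) :
    (decompAll j G).Spec (fun r => Table j G r.1 r.2 ∧ r.2.length ≤ 5 * G.length)
      (251 * (N + 1) ^ 3 * G.length + 1) := by
  have c1 := one_le_cube N
  induction G with
  | nil =>
    exact Spec.tick_bind le_rfl (Spec.pure ⟨⟨storeInv_nil, rfl, by simp, by simp⟩, by simp⟩)
  | cons e G ih =>
    obtain ⟨u, nd⟩ := e
    have hlen : 251 * (N + 1) ^ 3 * ((u, nd) :: G).length + 1 =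
        251 * (N + 1) ^ 3 * G.length + 251 * (N + 1) ^ 3 + 1 := by
      rw [List.length_cons]
      ring
    rw [hlen]
    rw [List.length_cons] at hN ⊢
    refine Spec.tick_bind (by omega) ?_
    refine Spec.bind (ih (hG.of_subset hG.wf.2.2 (List.subset_cons_self _ _)) (by omega))
      (by omega) ?_
    rintro ⟨H, S⟩ ⟨hT, hS⟩
    dsimp only at hT hS ⊢
    have hth := hG.wf.2.2.theta_eq_of_subset hG.wf (List.subset_cons_self _ _)
    refine Spec.bind (decompNode_spec (N := N) hG hT (by omega) (by omega)) (by omega) ?_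
    rintro ⟨v, S'⟩ ⟨he, hm, heq⟩
    dsimp only at he hm heq ⊢
    have hl := he.length
    refine Spec.pure ⟨⟨he.inv, ?_, ?_, ?_⟩, ?_⟩
    · simp [hT.keys, names]
    · intro a b hab
      rcases List.mem_cons.1 hab with hab | hab
      · cases hab
        exact hm
      · exact he.mem_names (hT.mem a b hab)
    · intro a b hab
      rcases List.mem_cons.1 hab with hab | hab
      · cases hab
        rw [theta_cons_self]
        exact heq
      · have ha : a ∈ names G := by
          rw [← hT.keys]
          exact List.mem_map_of_mem hab
        rw [← hth a ha, he.theta b (hT.mem a b hab)]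
        exact hT.equiv a b hab
    · dsimp only
      omega

theorem collect_spec {L : List ℕ} (hL : L.length ≤ N) {S : Store} (hS : WellFormed S.diagram)
    (hch : ∀ v nd, (v, nd) ∈ S.diagram → nd.children ⊆ L ∧ nd.children.length ≤ N)
    {marks : List ℕ} (hn : marks.Nodup) (hm : marks ⊆ L) :
    (collect marks S).Spec (fun D => D.Sublist S.diagram ∧ WellFormed D ∧
        (∀ v ∈ marks, v ∈ names S.diagram → v ∈ names D) ∧
        ∀ v ∈ names D, ∃ m ∈ marks, Relation.ReflTransGen (Edge D) m v)
      (4 * (N + 1) ^ 2 * S.length + (N + 1) ^ 2) := by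
  have c3 := succ_le_sq N
  induction S generalizing marks with
  | nil =>
    refine Spec.tick_bind (by omega) (Spec.pure ?_)
    simp [Store.diagram, names, WellFormed]
  | cons e S ih =>
    rw [List.length_cons, Nat.mul_succ]
    have hml : marks.length ≤ N := (hn.subperm hm).length_le.trans hL
    have hS' : WellFormed (Store.diagram S) := hS.2.2
    have hch' : ∀ v nd, (v, nd) ∈ Store.diagram S → nd.children ⊆ L ∧ nd.children.length ≤ N :=
      fun v nd h => hch v nd (List.mem_cons_of_mem _ h)
    obtain ⟨hc1, hc2⟩ := hch e.name e.node List.mem_cons_self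
    refine Spec.tick_bind (by omega) ?_
    refine Spec.bind (isMem_spec e.name marks) (by omega) fun r hr => ?_
    by_cases he : e.name ∈ marks
    · rw [if_pos (hr.2 he)]
      refine Spec.bind (union_spec_le (N := N) (m := marks) (l := e.node.children) hml hc2)
        (by omega) ?_
      rintro marks' ⟨hm1, hm2⟩
      refine Spec.bind (ih hS' hch' (hm2 hn) fun w hw => ?_) (by omega) ?_
      · exact ((hm1 w).1 hw).elim (fun h => hc1 h) fun h => hm h
      rintro D ⟨hD1, hD2, hD3, hD4⟩
      refine Spec.pure ⟨hD1.cons_cons _, ⟨?_, ?_, hD2⟩, ?_, ?_⟩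
      · exact fun h => hS.1 (names_subset hD1.subset h)
      · exact fun w hw => hD3 w ((hm1 w).2 (Or.inl hw)) (hS.2.1 w hw)
      · intro v hv hvS
        rcases List.mem_cons.1 hvS with rfl | hvS
        · exact List.mem_cons_self
        · exact List.mem_cons_of_mem _ (hD3 v ((hm1 v).2 (Or.inr hv)) hvS)
      · intro v hv
        rcases List.mem_cons.1 hv with rfl | hv
        · exact ⟨_, he, Relation.ReflTransGen.refl⟩
        · obtain ⟨m, hmm, hmv⟩ := hD4 v hv
          have hmv' : Relation.ReflTransGen (Edge ((e.name, e.node) :: D)) m v :=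
            hmv.lift id fun a b ⟨nd, h1, h2⟩ => ⟨nd, List.mem_cons_of_mem _ h1, h2⟩
          rcases (hm1 m).1 hmm with h | h
          · exact ⟨e.name, he, Relation.ReflTransGen.head ⟨e.node, List.mem_cons_self, h⟩ hmv'⟩
          · exact ⟨m, h, hmv'⟩
    · rw [if_neg fun h => he (hr.1 h)]
      refine (ih hS' hch' hn hm).mono ?_ (by omega)
      rintro D ⟨hD1, hD2, hD3, hD4⟩
      refine ⟨hD1.cons _, hD2, fun v hv hvS => ?_, hD4⟩
      rcases List.mem_cons.1 hvS with rfl | hvS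
      · exact absurd hv he
      · exact hD3 v hv hvS

/-- Nothing is collected before `v`, as only `v` is marked. -/
theorem head_collect {S : Store} {v : ℕ} (hv : v ∈ names S.diagram) :
    (names (collect [v] S).val).head? = some v := by
  induction S with
  | nil => cases hv
  | cons e S ih =>
    have hr := (isMem_spec e.name [v]).1
    rw [List.mem_singleton] at hr
    by_cases he : e.name = v
    · have : (collect [v] (e :: S)).val = (e.name, e.node) ::
          (collect (union [v] e.node.children).val S).val := by
        change Timed.val (if (isMem e.name [v]).val = true then _ else _) = _
        rw [if_pos (hr.2 he)]
        rfl
      rw [this]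
      simp [names, he]
    · have : (collect [v] (e :: S)).val = (collect [v] S).val := by
        change Timed.val (if (isMem e.name [v]).val = true then _ else _) = _
        rw [if_neg fun h => he (hr.1 h)]
      rw [this]
      refine ih ?_
      rcases List.mem_cons.1 hv with rfl | hv
      · exact absurd rfl he
      · exact hv

/-- The reachable part of a store is a ROBDD[∧_ĵ]. -/
theorem collect_root_spec {S : Store} (h : StoreInv j S) (hN : S.length + 2 ≤ N) {v : ℕ}
    (hv : v ∈ names S.diagram) :
    (collect [v] S).Spec (fun D => D ∈ ROBDDHat j ∧
      D.formula.Equivalent (theta S.diagram v) ∧ D.size ≤ S.diagram.size ∧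
      D.size ≤ (N + 1) ^ 2) (5 * (N + 1) ^ 3) := by
  have hb := mul_sq_add_le_cube (N := N) (n := 4) (k := S.length) (by omega)
  have c2 := sq_le_cube N
  have main := collect_spec (N := N) (L := names S.diagram) (S := S) (marks := [v])
    (by rw [S.names_diagram, List.length_map]; omega) h.good.wf
    (fun u nd hu => ⟨fun w hw => h.good.wf.child_mem hu hw, h.length_children hN hu⟩)
    (List.nodup_singleton v) (by simpa using hv)
  have hhead := head_collect hv
  obtain ⟨⟨hD1, hD2, -, hD4⟩, ht⟩ := main
  refine ⟨?_, ht.trans (by omega)⟩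
  generalize (collect [v] S).val = D at hD1 hD2 hD4 hhead ⊢
  refine ⟨((h.good.of_subset hD2 hD1.subset).canon).mem_robddHat ⟨v, hhead, fun w hw => ?_⟩,
    ?_, ?_, ?_⟩
  · obtain ⟨m, hm, hmw⟩ := hD4 w hw
    rwa [List.mem_singleton.1 hm] at hmw
  · rcases D with _ | ⟨⟨u, nd⟩, D⟩
    · simp [names] at hhead
    · obtain rfl : u = v := by simpa [names] using hhead
      change (theta ((u, nd) :: D) u).Equivalent _
      rw [hD2.theta_eq_of_subset h.good.wf hD1.subset u (by simp [names])]
      exact fun _ => rfl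
  · exact (hD1.map fun e => e.2.children.length).sum_le_sum fun _ _ => Nat.zero_le _
  · have h1 : D.size ≤ (D.map fun e => e.2.children.length).length • N := by
      refine List.sum_le_card_nsmul _ _ fun k hk => ?_
      obtain ⟨⟨u, nd⟩, hu, rfl⟩ := List.mem_map.1 hk
      exact h.length_children hN (hD1.subset hu)
    have h2 := hD1.length_le
    rw [S.length_diagram] at h2
    rw [List.length_map, smul_eq_mul] at h1
    have h3 : D.length * N ≤ (N + 1) * (N + 1) := Nat.mul_le_mul (by omega) (by omega)
    nlinarith

theorem decompose_spec {G : Diagram} (hG : Input j G) (hr : Rooted G) :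
    (decompose j G).Spec (fun D => D ∈ ROBDDHat j ∧ D.formula.Equivalent G.formula ∧
      D.size ≤ 300 * (5 * G.size + 13) ^ 4) (300 * (5 * G.size + 13) ^ 4) := by
  have hlen := length_le_size hG.wf hr
  set N := 5 * G.length + 7 with hN
  have hbig : 300 * (N + 1) ^ 4 ≤ 300 * (5 * G.size + 13) ^ 4 :=
    Nat.mul_le_mul_left _ (Nat.pow_le_pow_left (by omega) _)
  have c1 := one_le_cube N
  have c2 := sq_le_cube N
  have c4 : (N + 1) ^ 3 ≤ (N + 1) ^ 4 := Nat.pow_le_pow_right (by omega) (by omega)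
  have hall : 251 * (N + 1) ^ 3 * G.length + 251 * (N + 1) ^ 3 ≤ 251 * (N + 1) ^ 4 := by
    have : (G.length + 1) * (251 * (N + 1) ^ 3) ≤ (N + 1) * (251 * (N + 1) ^ 3) :=
      Nat.mul_le_mul_right _ (by omega)
    calc _ = (G.length + 1) * (251 * (N + 1) ^ 3) := by ring
      _ ≤ _ := this
      _ = _ := by ring
  refine Spec.tick_bind (by omega) ?_
  refine Spec.bind (decompAll_spec (N := N) hG le_rfl) (by omega) ?_
  rintro ⟨H, S⟩ ⟨hT, hS⟩
  dsimp only at hT hS ⊢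
  obtain ⟨r, hr, -⟩ := hr
  rcases G with _ | ⟨⟨u, nd⟩, G⟩
  · simp [names] at hr
  rcases H with _ | ⟨⟨u', v⟩, H⟩
  · have := hT.keys
    simp [names] at this
  have huu : u' = u := by
    have := hT.keys
    simp only [names, List.map_cons, List.cons.injEq] at this
    exact this.1
  subst huu
  have hmem : (u', v) ∈ (u', v) :: H := List.mem_cons_self
  refine (collect_root_spec (N := N) hT.inv (by omega) (hT.mem _ _ hmem)).mono ?_ (by omega)
  rintro D ⟨h1, h2, -, h3⟩
  exact ⟨h1, h2.trans (hT.equiv _ _ hmem), by omega⟩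

end Decompose

/-! ### Existence of canonical diagrams -/

section Existence

variable {j : ℕ∞}

/-- Every Boolean function of the variables `k, …, k + n - 1` is represented by a vertex of some
extension of a given store. -/
theorem exists_vertex (n : ℕ) : ∀ {k : ℕ} {f : (ℕ → Bool) → Bool},
    (∀ ω ω' : ℕ → Bool, (∀ y, k ≤ y → y < k + n → ω y = ω' y) → f ω = f ω') →
    ∀ {S : Store}, StoreInv j S → ∃ S' K v, Extends j K S S' ∧ v ∈ names S'.diagram ∧
      ∀ ω, eval ω (theta S'.diagram v) = f ω := by
  induction n with
  | zero =>
    intro k f hf S hS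
    obtain ⟨he, hm⟩ := (vertex_leaf_spec (N := S.length + 2) hS le_rfl (f fun _ => true)).1
    refine ⟨_, _, _, he, mem_names_of_mem hm, fun ω => ?_⟩
    rw [he.inv.good.wf.theta_eq hm, hf ω (fun _ => true) fun y h1 h2 => by omega]
    cases f fun _ => true <;> rfl
  | succ n ih =>
    intro k f hf S hS
    have dep : ∀ (b : Bool) (ω ω' : ℕ → Bool), (∀ y, k + 1 ≤ y → y < k + 1 + n → ω y = ω' y) →
        f (Function.update ω k b) = f (Function.update ω' k b) := by
      intro b ω ω' h
      refine hf _ _ fun y h1 h2 => ?_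
      by_cases hy : y = k
      · simp [hy]
      · simp [hy, h y (by omega) (by omega)]
    obtain ⟨S₁, K₁, lo, he₁, hlo, e₁⟩ := ih (dep false) hS
    obtain ⟨S₂, K₂, hi, he₂, hhi, e₂⟩ := ih (dep true) he₁.inv
    rw [← he₂.theta lo hlo] at e₁
    replace hlo := he₂.mem_names hlo
    have lt : ∀ (b : Bool), ∀ v ∈ names S₂.diagram,
        (∀ ω, eval ω (theta S₂.diagram v) = f (Function.update ω k b)) →
        ∀ y ∈ (theta S₂.diagram v).vars, k < y := by
      intro b v hv e y hy
      obtain ⟨ω, c, h1, h2⟩ := he₂.inv.good.canon.tight hv y hy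
      by_contra hle
      rw [e] at h1 h2
      rw [dep b _ ω fun z hz _ => Function.update_of_ne (by omega) _ _, h1] at h2
      cases h2
    obtain ⟨he, hm, e⟩ := (decompDecision_spec (N := S₂.length + 7) (x := k) he₂.inv le_rfl hlo
      hhi fun y hy => hy.elim (lt false lo hlo e₁ y) (lt true hi hhi e₂ y)).1
    refine ⟨_, _, _, (he₁.trans he₂).trans he, hm, fun ω => ?_⟩
    rw [e, eval_choice, e₁, e₂]
    cases h : ω k
    · rw [if_neg (by simp), ← h, Function.update_eq_self]
    · rw [if_pos rfl, ← h, Function.update_eq_self]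

theorem exists_mem_robddHat (j : ℕ∞) (φ : Formula) : ∃ G ∈ ROBDDHat j, G.Represents φ := by
  obtain ⟨S, K, v, he, hv, e⟩ := exists_vertex (φ.vars.sup id + 1) (k := 0)
    (f := fun ω => eval ω φ) (fun ω ω' h => eval_congr fun x hx =>
      h x (Nat.zero_le _) (by have := Finset.le_sup (f := id) hx; simp at this; omega))
    (storeInv_nil (j := j))
  obtain ⟨h1, h2, -⟩ := (collect_root_spec he.inv le_rfl hv).1
  exact ⟨_, h1, fun ω => (h2 ω).trans (e ω)⟩

end Existence

/-! ### Systems of biconditional chains -/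

/-- The truth value of the chain `x₁ ↔ ⋯ ↔ xₘ`. -/
def chainVal (ω : ℕ → Bool) : List ℕ → Bool
  | [] => true
  | x :: l => ω x == chainVal ω l

theorem chainVal_congr {ω ω' : ℕ → Bool} {l : List ℕ} (h : ∀ x ∈ l, ω x = ω' x) :
    chainVal ω l = chainVal ω' l := by
  induction l with
  | nil => rfl
  | cons x l ih =>
    rw [chainVal, chainVal, h x (by simp), ih fun y hy => h y (List.mem_cons_of_mem _ hy)]

theorem chainVal_update_of_not_mem {ω : ℕ → Bool} {l : List ℕ} {x : ℕ} {b : Bool} (h : x ∉ l) :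
    chainVal (Function.update ω x b) l = chainVal ω l :=
  chainVal_congr fun y hy => Function.update_of_ne (by
    rintro rfl
    exact h hy) _ _

theorem chainVal_flip {ω : ℕ → Bool} {l : List ℕ} {x : ℕ} (hl : l.Nodup) (h : x ∈ l) :
    chainVal (Function.update ω x !ω x) l = !chainVal ω l := by
  induction l with
  | nil => cases h
  | cons y l ih =>
    obtain ⟨hy, hl⟩ := List.nodup_cons.1 hl
    rw [chainVal, chainVal]
    rcases List.mem_cons.1 h with rfl | h
    · rw [chainVal_update_of_not_mem hy, Function.update_self]
      cases ω x <;> cases chainVal ω l <;> rfl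
    · rw [ih hl h, Function.update_of_ne (by
        rintro rfl
        exact hy h)]
      cases ω y <;> cases chainVal ω l <;> rfl

/-- The assignment gives every chain of the list the required value. -/
def Solves (ω : ℕ → Bool) (L : List (List ℕ × Bool)) : Prop := ∀ p ∈ L, chainVal ω p.1 = p.2

/-- The chains are not empty and do not share variables. -/
structure Proper (L : List (List ℕ × Bool)) : Prop where
  ne_nil : ∀ p ∈ L, p.1 ≠ []
  nodup : ∀ p ∈ L, p.1.Nodup
  eq_of_mem : ∀ p ∈ L, ∀ q ∈ L, ∀ x, x ∈ p.1 → x ∈ q.1 → p = q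

section Systems

variable {L : List (List ℕ × Bool)} {φ : Formula} {j : ℕ∞}

theorem Proper.exists_solves (hL : Proper L) : ∃ ω, Solves ω L := by
  induction L with
  | nil => exact ⟨fun _ => true, by simp [Solves]⟩
  | cons p L ih =>
    obtain ⟨ω, hω⟩ := ih ⟨fun q hq => hL.ne_nil q (List.mem_cons_of_mem _ hq),
      fun q hq => hL.nodup q (List.mem_cons_of_mem _ hq),
      fun q hq q' hq' => hL.eq_of_mem q (List.mem_cons_of_mem _ hq) q'
        (List.mem_cons_of_mem _ hq')⟩
    by_cases hp : chainVal ω p.1 = p.2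
    · exact ⟨ω, List.forall_mem_cons.2 ⟨hp, hω⟩⟩
    · obtain ⟨x, hx⟩ := List.exists_mem_of_ne_nil _ (hL.ne_nil p (by simp))
      refine ⟨Function.update ω x !ω x, List.forall_mem_cons.2 ⟨?_, fun q hq => ?_⟩⟩
      · rw [chainVal_flip (hL.nodup p (by simp)) hx]
        revert hp
        cases chainVal ω p.1 <;> cases p.2 <;> simp
      · rw [chainVal_update_of_not_mem, hω q hq]
        intro hxq
        obtain rfl := hL.eq_of_mem p (by simp) q (List.mem_cons_of_mem _ hq) x hx hxq
        exact hp (hω p hq)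

theorem Proper.mem_vars (hL : Proper L) (h : ∀ ω, eval ω φ = true ↔ Solves ω L)
    {p : List ℕ × Bool} (hp : p ∈ L) {x : ℕ} (hx : x ∈ p.1) : x ∈ φ.vars := by
  obtain ⟨ω, hω⟩ := hL.exists_solves
  by_contra hn
  have h1 := (h ω).2 hω
  rw [← eval_update_of_not_mem hn (b := !ω x), h] at h1
  have h2 := h1 p hp
  rw [chainVal_flip (hL.nodup p hp) hx, hω p hp] at h2
  simp at h2

theorem exists_mem_of_mem_vars (ht : φ.Tight) (h : ∀ ω, eval ω φ = true ↔ Solves ω L) {x : ℕ}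
    (hx : x ∈ φ.vars) : ∃ p ∈ L, x ∈ p.1 := by
  obtain ⟨ω, b, h1, h2⟩ := ht x hx
  by_contra! hn
  rw [← Bool.not_eq_true, h] at h2
  refine h2 fun p hp => ?_
  rw [chainVal_update_of_not_mem (hn p hp)]
  exact (h ω).1 h1 p hp

/-- A splitting set does not cut a chain: a change of one variable of the chain has to be
compensated by a change of another one. -/
theorem Proper.subset_of_splits (hL : Proper L) (h : ∀ ω, eval ω φ = true ↔ Solves ω L)
    {B : Finset ℕ} (hB : φ.Splits B) {p : List ℕ × Bool} (hp : p ∈ L) {x : ℕ} (hx : x ∈ p.1)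
    (hxB : x ∈ B) : ∀ y ∈ p.1, y ∈ B := by
  intro y hy
  by_contra hyB
  have hxy : y ≠ x := by
    rintro rfl
    exact hyB hxB
  obtain ⟨ω, hω⟩ := hL.exists_solves
  set ω₁ := Function.update ω x !ω x with hω₁
  set ω₂ := Function.update ω₁ y !ω₁ y with hω₂
  have h₂ : Solves ω₂ L := by
    intro q hq
    by_cases hqp : q = p
    · subst hqp
      rw [hω₂, chainVal_flip (hL.nodup q hq) hy, hω₁, chainVal_flip (hL.nodup q hq) hx, hω q hq,
        Bool.not_not]
    · rw [hω₂, chainVal_update_of_not_mem fun h => hqp (hL.eq_of_mem q hq p hp y h hy), hω₁,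
        chainVal_update_of_not_mem fun h => hqp (hL.eq_of_mem q hq p hp x h hx), hω q hq]
  have h₃ := (h _).1 (hB ω₂ ω ((h _).2 h₂) ((h _).2 hω)) p hp
  rw [chainVal_congr (ω' := ω₁), hω₁, chainVal_flip (hL.nodup p hp) hx, hω p hp] at h₃
  · simp at h₃
  · intro z _
    by_cases hz : z ∈ B
    · have : z ≠ y := by
        rintro rfl
        exact hyB hz
      simp [Finset.piecewise, hz, hω₂, this]
    · have : z ≠ x := by
        rintro rfl
        exact hz hxB
      simp [Finset.piecewise, hz, hω₁, this]

theorem Proper.length_le_card (hL : Proper L) (h : ∀ ω, eval ω φ = true ↔ Solves ω L)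
    {B : Finset ℕ} (hB : φ.Splits B) {p : List ℕ × Bool} (hp : p ∈ L) {x : ℕ} (hx : x ∈ p.1)
    (hxB : x ∈ B) : p.1.length ≤ B.card := by
  rw [← List.toFinset_card_of_nodup (hL.nodup p hp)]
  refine Finset.card_le_card fun y hy => ?_
  exact hL.subset_of_splits h hB hp hx hxB y (List.mem_toFinset.1 hy)

/-- A single chain is rigid, and so is a system of chains with more than `j` variables each. -/
theorem Proper.rigid (hL : Proper L) (h : ∀ ω, eval ω φ = true ↔ Solves ω L) (ht : φ.Tight)
    (hl : (∃ p, L = [p]) ∨ ∀ p ∈ L, j < (p.1.length : ℕ∞)) : φ.Rigid j := by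
  intro B hBφ hB ⟨x, hxB⟩ hne
  obtain ⟨p, hp, hx⟩ := exists_mem_of_mem_vars ht h (hBφ hxB)
  rcases hl with ⟨q, rfl⟩ | hl
  · obtain rfl := List.mem_singleton.1 hp
    refine absurd (hBφ.antisymm fun y hy => ?_) hne
    obtain ⟨q, hq, hyq⟩ := exists_mem_of_mem_vars ht h hy
    obtain rfl := List.mem_singleton.1 hq
    exact hL.subset_of_splits h hB hp hx hxB y hyq
  · exact (hl p hp).trans_le (Nat.cast_le.2 (hL.length_le_card h hB hp hx hxB))

end Systems

/-- The variables of the chain with the index `k` of the formula `chains j n`. -/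
def chainVars (j n k : ℕ) : List ℕ := (List.range (j + 2)).map fun m => (k + 1) + m * n

theorem eval_bigIff {ω : ℕ → Bool} : ∀ l : List ℕ, eval ω (bigIff (l.map var)) = chainVal ω l
  | [] => rfl
  | [x] => by simp [bigIff, eval, chainVal]
  | x :: y :: l => by
    have ih := eval_bigIff (ω := ω) (y :: l)
    simp only [List.map_cons] at ih ⊢
    rw [bigIff, chainVal, ← ih, Formula.iff]
    simp only [eval]
    cases ω x <;> cases eval ω (bigIff (var y :: l.map var)) <;> rfl

theorem eval_chains {j n : ℕ} {ω : ℕ → Bool} :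
    eval ω (chains j n) = true ↔ ∀ k < n, chainVal ω (chainVars j n k) = true := by
  simp only [chains, eval_bigAnd, List.mem_map, List.mem_range, forall_exists_index, and_imp,
    forall_apply_eq_imp_iff₂]
  refine forall₂_congr fun k _ => ?_
  rw [chainVars, ← eval_bigIff, List.map_map]
  rfl

theorem chainVars_eq {j n k : ℕ} : chainVars j n k =
    (k + 1) :: (List.range (j + 1)).map fun m => (k + 1) + (m + 1) * n := by
  simp [chainVars, List.range_succ_eq_map (n := j + 1), Function.comp_def]

theorem pairwise_chainVars {j n k : ℕ} (hn : 1 ≤ n) : (chainVars j n k).Pairwise (· < ·) :=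
  List.pairwise_map.2 (List.pairwise_lt_range.imp fun h =>
    Nat.add_lt_add_left (Nat.mul_lt_mul_of_pos_right h hn) _)

theorem eq_of_mem_chainVars {j n k l x : ℕ} (hk : k < n) (hl : l < n) (h : x ∈ chainVars j n k)
    (h' : x ∈ chainVars j n l) : k = l := by
  obtain ⟨a, -, rfl⟩ := List.mem_map.1 h
  obtain ⟨b, -, e⟩ := List.mem_map.1 h'
  have e' : (l + b * n) % n = (k + a * n) % n := by congr 1; omega
  rw [Nat.add_mul_mod_self_right, Nat.add_mul_mod_self_right, Nat.mod_eq_of_lt hk,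
    Nat.mod_eq_of_lt hl] at e'
  exact e'.symm

theorem succ_le_of_mem_chainVars {j n k x : ℕ} (h : x ∈ chainVars j n k) : k + 1 ≤ x := by
  obtain ⟨a, -, rfl⟩ := List.mem_map.1 h
  omega

theorem lt_of_mem_tail_chainVars {j n k x : ℕ} (h : x ∈ (chainVars j n k).tail) : n < x := by
  rw [chainVars_eq, List.tail_cons] at h
  obtain ⟨a, -, rfl⟩ := List.mem_map.1 h
  rw [Nat.succ_mul]
  omega

/-! ### The lower bound -/

/-- What remains of the formula `chains j n` when the first variables of the first `k` chains
have the values given by `p`. -/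
def residual (j n : ℕ) (p : ℕ → Bool) (k : ℕ) : List (List ℕ × Bool) :=
  (List.range n).map fun m =>
    if m < k then ((chainVars j n m).tail, p m) else (chainVars j n m, true)

section LowerBound

variable {j n k : ℕ} {p : ℕ → Bool}

theorem forall_mem_residual {P : List ℕ × Bool → Prop} : (∀ q ∈ residual j n p k, P q) ↔
    ∀ m < n, P (if m < k then ((chainVars j n m).tail, p m) else (chainVars j n m, true)) := by
  simp [residual]

theorem proper_residual (hn : 1 ≤ n) : Proper (residual j n p k) := by
  refine ⟨forall_mem_residual.2 fun m _ => ?_, forall_mem_residual.2 fun m _ => ?_,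
    forall_mem_residual.2 fun m hm => forall_mem_residual.2 fun l hl x hx hx' => ?_⟩
  · split_ifs
    · simp [chainVars_eq]
    · simp [chainVars_eq]
  · have := (pairwise_chainVars (j := j) (k := m) hn).imp (S := (· ≠ ·)) fun h => h.ne
    split_ifs
    · exact this.tail
    · exact this
  · have mem : ∀ m, x ∈ (if m < k then ((chainVars j n m).tail, p m)
        else (chainVars j n m, true)).1 → x ∈ chainVars j n m := by
      intro m h
      split_ifs at h
      · exact List.mem_of_mem_tail h
      · exact h
    obtain rfl := eq_of_mem_chainVars hm hl (mem m hx) (mem l hx')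
    rfl

theorem lt_length_residual : ∀ q ∈ residual j n p k, j < q.1.length := by
  refine forall_mem_residual.2 fun m _ => ?_
  split_ifs
  · simp [chainVars_eq]
  · simp [chainVars_eq]

theorem le_of_mem_residual (hk : k < n) :
    ∀ q ∈ residual j n p k, ∀ x ∈ q.1, k + 1 ≤ x := by
  refine forall_mem_residual.2 fun m _ x hx => ?_
  split_ifs at hx with h
  · have := lt_of_mem_tail_chainVars hx
    omega
  · have := succ_le_of_mem_chainVars hx
    omega

/-- Assigning the first variable of the next chain. -/
theorem solves_residual_succ {ω : ℕ → Bool} (hk : k < n) :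
    Solves (Function.update ω (k + 1) (p k)) (residual j n p k) ↔
      Solves ω (residual j n p (k + 1)) := by
  rw [Solves, Solves, forall_mem_residual, forall_mem_residual]
  refine forall₂_congr fun m hm => ?_
  rcases lt_trichotomy m k with h | rfl | h
  · rw [if_pos h, if_pos (by omega), chainVal_update_of_not_mem fun hx => ?_]
    have := lt_of_mem_tail_chainVars hx
    omega
  · rw [if_neg (by omega), if_pos (by omega), chainVars_eq, chainVal, List.tail_cons,
      Function.update_self, chainVal_update_of_not_mem fun hx => ?_]
    · cases p m <;> simp
    · have := lt_of_mem_tail_chainVars (j := j) (n := n) (k := m) (by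
        rw [chainVars_eq]
        exact hx)
      omega
  · rw [if_neg (by omega), if_neg (by omega), chainVal_update_of_not_mem fun hx => ?_]
    have := succ_le_of_mem_chainVars hx
    omega

/-- A vertex that represents a residual system is not a leaf, and it is not a `∧`-vertex either,
since all its splitting sets have more than `j` variables. -/
theorem eq_dec_of_residual {G : Diagram} (hG : Canon (j : ℕ∞) G) (hn : 1 ≤ n) {v : ℕ}
    {nd : Node} (hv : (v, nd) ∈ G)
    (h : ∀ ω, eval ω (theta G v) = true ↔ Solves ω (residual j n p k)) :
    ∃ x lo hi, nd = .dec x lo hi := by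
  have hL := proper_residual (j := j) (k := k) (p := p) hn
  rcases nd with b | ⟨x, lo, hi⟩ | ch
  · obtain ⟨q, hq⟩ : ∃ q, q ∈ residual j n p k :=
      List.exists_mem_of_length_pos (by simpa [residual, Nat.pos_iff_ne_zero, Nat.one_le_iff_ne_zero] using hn)
    obtain ⟨x, hx⟩ := List.exists_mem_of_ne_nil _ (hL.ne_nil q hq)
    have := hL.mem_vars h hq hx
    rw [vars_leaf hG.wf hv] at this
    cases this
  · exact ⟨x, lo, hi, rfl⟩
  · have hd := (hG.finest_conj v ch hv).1
    have large : ∀ ψ ∈ ch.map (theta G), (j : ℕ∞) < (ψ.vars.card : ℕ∞) := by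
      intro ψ hψ
      obtain ⟨x, hx⟩ := hd.1.nonempty ψ hψ
      obtain ⟨q, hq, hxq⟩ := exists_mem_of_mem_vars (hG.tight (mem_names_of_mem hv)) h
        ((hd.1.cover x).2 ⟨ψ, hψ, hx⟩)
      exact Nat.cast_lt.2 ((lt_length_residual q hq).trans_le
        (hL.length_le_card h (hd.1.splits hψ) hq hxq hx))
    obtain ⟨ψ, hψ, χ, hχ, hne⟩ := two_members hd.1.disjoint hd.1.nonempty
      (by simpa using hG.length v ch hv)
    exact absurd (hd.2 ψ hψ χ hχ (large ψ hψ) (large χ hχ)) hne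

/-- On the path that follows `p`, the vertices are decision vertices for the first variables of the
chains in their order. -/
theorem exists_residual {G : Diagram} (hG : Canon (j : ℕ∞) G) (hn : 1 ≤ n) {r : ℕ}
    (hr : r ∈ names G) (h : (theta G r).Equivalent (chains j n)) (p : ℕ → Bool) :
    ∀ k ≤ n, ∃ v ∈ names G, ∀ ω, eval ω (theta G v) = true ↔ Solves ω (residual j n p k) := by
  intro k
  induction k with
  | zero =>
    refine fun _ => ⟨r, hr, fun ω => ?_⟩
    rw [h, eval_chains, Solves, forall_mem_residual]
    simp
  | succ k ih =>
    intro hk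
    obtain ⟨v, hv, e⟩ := ih (by omega)
    have hL := proper_residual (j := j) (k := k) (p := p) hn
    obtain ⟨nd, hm⟩ := mem_names.1 hv
    obtain ⟨x, lo, hi, rfl⟩ := eq_dec_of_residual hG hn hm e
    have hth := hG.wf.theta_dec hm
    -- The variable of the vertex is the least one of the system.
    have hx : x = k + 1 := by
      have h1 : k + 1 ∈ (theta G v).vars := by
        refine hL.mem_vars e (p := (chainVars j n k, true)) ?_ (by simp [chainVars_eq])
        exact List.mem_map.2 ⟨k, List.mem_range.2 hk, if_neg (lt_irrefl k)⟩
      obtain ⟨q, hq, hxq⟩ := exists_mem_of_mem_vars (hG.tight hv) e (x := x) (by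
        simp [hth, vars_choice])
      have h2 := le_of_mem_residual (by omega) q hq x hxq
      rw [hth, vars_choice, Finset.mem_insert, Finset.mem_union] at h1
      rcases h1 with h1 | h1
      · exact h1.symm
      · have := hG.order v x lo hi hm _ h1
        omega
    subst hx
    refine ⟨if p k then hi else lo, hG.wf.child_mem hm (by
      cases p k <;> simp [Node.children]), fun ω => ?_⟩
    rw [← solves_residual_succ (by omega), ← e, hth, eval_update_choice]
    cases p k
    · rw [if_neg (by simp), if_neg (by simp), eval_update_of_not_mem (hG.not_mem_lo hm)]
    · rw [if_pos rfl, if_pos rfl, eval_update_of_not_mem (hG.not_mem_hi hm)]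

/-- A diagram has at least as many edges as inner vertices. -/
theorem length_filter_le_size (G : Diagram) :
    (G.filter fun e => !e.2.children.isEmpty).length ≤ G.size := by
  induction G with
  | nil => simp
  | cons e G ih =>
    rw [size, List.map_cons, List.sum_cons, ← size, List.filter_cons]
    rcases h : e.2.children with _ | ⟨w, l⟩
    · simpa using ih
    · simp
      omega

/-- The residual systems for the `2 ^ n` assignments of the first variables of the chains are
represented by different vertices. -/
theorem two_pow_le_size {G : Diagram} (hG : G ∈ ROBDDHat (j : ℕ∞)) (hn : 1 ≤ n)
    (h : G.Represents (chains j n)) : 2 ^ n ≤ G.size := by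
  classical
  have hC := canon_of_mem_robddHat hG
  obtain ⟨r, hr, e⟩ : ∃ r ∈ names G, (theta G r).Equivalent (chains j n) := by
    obtain ⟨r, hr, -⟩ := hG.1.rooted
    rcases G with _ | ⟨⟨u, nd⟩, G⟩
    · simp [names] at hr
    · exact ⟨u, List.mem_cons_self, h⟩
  have ex := fun p : Fin n → Bool => exists_residual hC hn hr e
    (fun m => if hm : m < n then p ⟨m, hm⟩ else true) n le_rfl
  choose f hf hs using ex
  have inj : Function.Injective f := by
    intro p q hpq
    funext m
    obtain ⟨ω, hω⟩ := (proper_residual (j := j) (k := n)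
      (p := fun m => if hm : m < n then p ⟨m, hm⟩ else true) hn).exists_solves
    have hω' := (hs q ω).1 (hpq ▸ (hs p ω).2 hω)
    rw [Solves, forall_mem_residual] at hω hω'
    have h1 := hω m m.2
    have h2 := hω' m m.2
    simp only [m.2, if_true, dif_pos] at h1 h2
    exact h1.symm.trans h2
  have sub : Finset.univ.image f ⊆
      ((G.filter fun e => !e.2.children.isEmpty).map Prod.fst).toFinset := by
    intro v hv
    obtain ⟨p, -, rfl⟩ := Finset.mem_image.1 hv
    obtain ⟨nd, hm⟩ := mem_names.1 (hf p)
    obtain ⟨x, lo, hi, rfl⟩ := eq_dec_of_residual hC hn hm (hs p)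
    rw [List.mem_toFinset]
    exact List.mem_map.2 ⟨_, List.mem_filter.2 ⟨hm, by simp [Node.children]⟩, rfl⟩
  have := (Finset.card_le_card sub).trans (List.toFinset_card_le _)
  rw [Finset.card_image_of_injective _ inj, List.length_map] at this
  simpa using this.trans (length_filter_le_size G)

end LowerBound

open Asymptotics

/-! ### The upper bound -/

section UpperBound

variable {i : ℕ∞} {j n : ℕ} {S S' : Store}

/-- The vertex of the store is a decision vertex that represents a system of chains. -/
def DecSolves (S : Store) (v : ℕ) (L : List (List ℕ × Bool)) : Prop :=
  (∃ x lo hi, (v, Node.dec x lo hi) ∈ S.diagram) ∧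
    ∀ ω, eval ω (theta S.diagram v) = true ↔ Solves ω L

theorem DecSolves.mem_names {v : ℕ} {L : List (List ℕ × Bool)} (h : DecSolves S v L) :
    v ∈ names S.diagram := by
  obtain ⟨⟨x, lo, hi, h⟩, -⟩ := h
  exact mem_names_of_mem h

theorem DecSolves.of_extends {k v : ℕ} {L : List (List ℕ × Bool)} (h : DecSolves S v L)
    (he : Extends i k S S') : DecSolves S' v L := by
  refine ⟨?_, ?_⟩
  · obtain ⟨⟨x, lo, hi, hm⟩, -⟩ := h
    exact ⟨x, lo, hi, he.sub hm⟩
  · rw [he.theta v h.mem_names]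
    exact h.2

theorem DecSolves.exists_mem {v x : ℕ} {L : List (List ℕ × Bool)} (h : DecSolves S v L)
    (hS : StoreInv i S) (hx : x ∈ (theta S.diagram v).vars) : ∃ p ∈ L, x ∈ p.1 :=
  exists_mem_of_mem_vars (hS.good.canon.tight h.mem_names) h.2 hx

/-- A decision vertex for a rigid system of chains can be added to the store. -/
theorem exists_dec (hS : StoreInv i S) {x lo hi : ℕ} (hlo : lo ∈ names S.diagram)
    (hhi : hi ∈ names S.diagram)
    (hx : ∀ y, y ∈ (theta S.diagram lo).vars ∨ y ∈ (theta S.diagram hi).vars → x < y)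
    {L : List (List ℕ × Bool)} (hL : Proper L)
    (h : ∀ ω, eval ω (choice x (theta S.diagram lo) (theta S.diagram hi)) = true ↔ Solves ω L)
    (hxL : ∃ p ∈ L, x ∈ p.1) (hl : (∃ p, L = [p]) ∨ ∀ p ∈ L, i < (p.1.length : ℕ∞)) :
    ∃ S' k v, Extends i k S S' ∧ S'.diagram.size ≤ S.diagram.size + 2 ∧ DecSolves S' v L := by
  have hG := hS.good
  have nlo : x ∉ (theta S.diagram lo).vars := fun h => (hx x (Or.inl h)).false
  have nhi : x ∉ (theta S.diagram hi).vars := fun h => (hx x (Or.inr h)).false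
  have hne : ¬ (theta S.diagram lo).Equivalent (theta S.diagram hi) := by
    intro e
    obtain ⟨p, hp, hxp⟩ := hxL
    obtain ⟨ω, hω⟩ := hL.exists_solves
    have h1 := (h ω).2 hω
    have h2 : eval (Function.update ω x !ω x)
        (choice x (theta S.diagram lo) (theta S.diagram hi)) = true := by
      rw [eval_choice, e, ite_self] at h1
      rw [eval_choice, e, ite_self, eval_update_of_not_mem nhi, h1]
    have h3 := (h _).1 h2 p hp
    rw [chainVal_flip (hL.nodup p hp) hxp, hω p hp] at h3
    simp at h3
  have ht := tight_choice (hG.canon.tight hlo) (hG.canon.tight hhi) nlo nhi hne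
  obtain ⟨he, hs, hm⟩ := (vertex_dec_spec (N := S.length + 2) hS le_rfl (x := x) (lo := lo)
    (hi := hi) ⟨hlo, hhi, fun e => hne (e ▸ fun _ => rfl), hx, hL.rigid h ht hl⟩).1
  refine ⟨_, _, _, he, hs, ⟨_, _, _, hm⟩, ?_⟩
  rw [he.theta_dec hm hlo hhi]
  exact h

/-- The two vertices for a chain and for its negation. -/
theorem exists_chain (l : List ℕ) (hl : l.Pairwise (· < ·)) (hS : StoreInv i S) :
    ∃ S' k, Extends i k S S' ∧ S'.diagram.size ≤ S.diagram.size + 4 * l.length ∧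
      ∀ b, ∃ v ∈ names S'.diagram, (l ≠ [] → DecSolves S' v [(l, b)]) ∧
        ∀ ω, eval ω (theta S'.diagram v) = true ↔ chainVal ω l = b := by
  induction l with
  | nil =>
    have leaf : ∀ {S : Store}, StoreInv i S → ∀ b, ∃ S' k v, Extends i k S S' ∧
        S'.diagram.size ≤ S.diagram.size ∧ (v, Node.leaf b) ∈ S'.diagram := by
      intro S hS b
      obtain ⟨he, hs, nd, hm, hid⟩ := (vertex_spec (N := S.length + 2) hS le_rfl
        (nd := .leaf b) trivial).1
      rcases nd with b' | _ | _
      · obtain rfl : b = b' := hid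
        exact ⟨_, _, _, he, hs, hm⟩
      · exact hid.elim
      · exact hid.elim
    obtain ⟨S₁, k₁, v₁, he₁, hs₁, hm₁⟩ := leaf hS false
    obtain ⟨S₂, k₂, v₂, he₂, hs₂, hm₂⟩ := leaf he₁.inv true
    refine ⟨S₂, _, he₁.trans he₂, by simp; omega, fun b => ?_⟩
    have hm : (if b then v₂ else v₁, Node.leaf b) ∈ S₂.diagram := by
      cases b
      · exact he₂.sub hm₁
      · exact hm₂
    refine ⟨_, mem_names_of_mem hm, fun h => absurd rfl h, fun ω => ?_⟩
    rw [he₂.inv.good.wf.theta_eq hm]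
    cases b <;> simp [nodeTheta, eval, chainVal]
  | cons x l ih =>
    obtain ⟨hxl, hl⟩ := List.pairwise_cons.1 hl
    obtain ⟨S₁, k₁, he₁, hs₁, h₁⟩ := ih hl
    have key : ∀ {S : Store} {k : ℕ}, Extends i k S₁ S → ∀ b, ∃ S' k' v, Extends i k' S S' ∧
        S'.diagram.size ≤ S.diagram.size + 2 ∧ DecSolves S' v [(x :: l, b)] := by
      intro S k he b
      obtain ⟨lo, hlo, -, elo⟩ := h₁ !b
      obtain ⟨hi, hhi, -, ehi⟩ := h₁ b
      rw [← he.theta lo hlo] at elo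
      rw [← he.theta hi hhi] at ehi
      replace hlo := he.mem_names hlo
      replace hhi := he.mem_names hhi
      have lt : ∀ v ∈ names S.diagram, ∀ c,
          (∀ ω, eval ω (theta S.diagram v) = true ↔ chainVal ω l = c) →
          ∀ y ∈ (theta S.diagram v).vars, x < y := by
        intro v hv c e y hy
        obtain ⟨p, hp, hyp⟩ := exists_mem_of_mem_vars (L := [(l, c)])
          (he.inv.good.canon.tight hv) (by simpa [Solves] using e) hy
        obtain rfl := List.mem_singleton.1 hp
        exact hxl y hyp
      refine exists_dec he.inv hlo hhi
        (fun y hy => hy.elim (lt lo hlo _ elo y) (lt hi hhi _ ehi y)) ?_ ?_ ⟨(x :: l, b), by simp, by simp⟩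
        (Or.inl ⟨_, rfl⟩)
      · refine ⟨by simp, ?_, by simp⟩
        simpa using ⟨fun h => (hxl x h).false, hl.imp fun h => h.ne⟩
      · intro ω
        rw [eval_choice]
        have e1 := elo ω
        have e2 := ehi ω
        cases h : ω x <;> simp [Solves, chainVal, h, e1, e2]
    obtain ⟨S₂, k₂, v₂, he₂, hs₂, d₂⟩ := key (Extends.refl he₁.inv) false
    obtain ⟨S₃, k₃, v₃, he₃, hs₃, d₃⟩ := key he₂ true
    refine ⟨S₃, _, he₁.trans (he₂.trans he₃), by simp; omega, fun b => ?_⟩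
    have d : DecSolves S₃ (if b then v₃ else v₂) [(x :: l, b)] := by
      cases b
      · exact d₂.of_extends he₃
      · exact d₃
    exact ⟨_, d.mem_names, fun _ => d, by simpa [Solves] using d.2⟩

/-- The conjunction of decision vertices without common variables. -/
theorem exists_conj (hS : StoreInv i S) {F : List ℕ} (hF : FactorList i S.diagram F)
    (hne : F ≠ []) : ∃ S' k v, Extends i k S S' ∧
      S'.diagram.size ≤ S.diagram.size + F.length ∧ v ∈ names S'.diagram ∧
      ∀ ω, eval ω (theta S'.diagram v) = true ↔
        ∀ w ∈ F, eval ω (theta S.diagram w) = true := by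
  rcases F with _ | ⟨w, _ | ⟨w', l⟩⟩
  · exact absurd rfl hne
  · obtain ⟨x, lo, hi, h⟩ := hF.isDec w (by simp)
    exact ⟨S, 0, w, Extends.refl hS, by simp, mem_names_of_mem h, by simp⟩
  · obtain ⟨he, hs, hm, e⟩ := (vertex_conj_spec (N := S.length + 2) hS le_rfl
      (ch := w :: w' :: l) ⟨by simp, hF⟩).1
    exact ⟨_, _, _, he, hs, hm, fun ω => by rw [e, eval_map]⟩

theorem card_vars_le (hS : StoreInv i S) {v : ℕ} {l : List ℕ} {b : Bool}
    (h : DecSolves S v [(l, b)]) : (theta S.diagram v).vars.card ≤ l.length := by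
  refine (Finset.card_le_card fun y hy => ?_).trans (List.toFinset_card_le l)
  obtain ⟨p, hp, hyp⟩ := h.exists_mem hS hy
  obtain rfl := List.mem_singleton.1 hp
  exact List.mem_toFinset.2 hyp

theorem solves_map {ω : ℕ → Bool} {Ls : List (List ℕ)} :
    Solves ω (Ls.map fun l => (l, true)) ↔ ∀ l ∈ Ls, chainVal ω l = true := by
  simp [Solves]

/-- If all chains have at most `i` variables, then they are the factors of their conjunction. -/
theorem exists_factors (hS : StoreInv i S) {m : ℕ} (hm : (m : ℕ∞) ≤ i) (Ls : List (List ℕ))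
    (hlen : ∀ l ∈ Ls, l.length = m) (hne : ∀ l ∈ Ls, l ≠ [])
    (hs : ∀ l ∈ Ls, l.Pairwise (· < ·)) (hd : Ls.Pairwise fun l l' => ∀ x ∈ l, x ∉ l') :
    ∃ S' k F, Extends i k S S' ∧ S'.diagram.size ≤ S.diagram.size + 4 * m * Ls.length ∧
      F.length = Ls.length ∧ FactorList i S'.diagram F ∧
      (∀ w ∈ F, ∃ l ∈ Ls, DecSolves S' w [(l, true)]) ∧
      ∀ ω, (∀ w ∈ F, eval ω (theta S'.diagram w) = true) ↔ ∀ l ∈ Ls, chainVal ω l = true := by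
  induction Ls with
  | nil =>
    exact ⟨S, 0, [], Extends.refl hS, by simp, rfl, ⟨by simp, by simp, by simp, by simp⟩,
      by simp, by simp⟩
  | cons l Ls ih =>
    obtain ⟨hdl, hd⟩ := List.pairwise_cons.1 hd
    obtain ⟨S₁, k₁, F, he₁, hs₁, hFl, hF, hw₁, e₁⟩ := ih
      (fun l h => hlen l (List.mem_cons_of_mem _ h)) (fun l h => hne l (List.mem_cons_of_mem _ h))
      (fun l h => hs l (List.mem_cons_of_mem _ h)) hd
    obtain ⟨S₂, k₂, he₂, hs₂, h₂⟩ := exists_chain l (hs l (by simp)) he₁.inv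
    obtain ⟨v, -, hv, ev⟩ := h₂ true
    replace hv := hv (hne l (by simp))
    have hw₂ : ∀ w ∈ F, ∃ l' ∈ Ls, DecSolves S₂ w [(l', true)] := fun w hw => by
      obtain ⟨l', hl', h⟩ := hw₁ w hw
      exact ⟨l', hl', h.of_extends he₂⟩
    have hw : ∀ w ∈ v :: F, ∃ l' ∈ l :: Ls, DecSolves S₂ w [(l', true)] := by
      intro w hw
      rcases List.mem_cons.1 hw with rfl | hw
      · exact ⟨l, by simp, hv⟩
      · obtain ⟨l', hl', h⟩ := hw₂ w hw
        exact ⟨l', List.mem_cons_of_mem _ hl', h⟩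
    have small : ∀ w ∈ v :: F, ((theta S₂.diagram w).vars.card : ℕ∞) ≤ i := by
      intro w h
      obtain ⟨l', hl', h⟩ := hw w h
      refine le_trans (Nat.cast_le.2 ?_) hm
      rw [← hlen l' hl']
      exact card_vars_le he₂.inv h
    have dis : ∀ w ∈ F, Disjoint (theta S₂.diagram v).vars (theta S₂.diagram w).vars := by
      intro w hw
      obtain ⟨l', hl', h⟩ := hw₂ w hw
      refine Finset.disjoint_left.2 fun y hy hy' => ?_
      obtain ⟨p, hp, hyp⟩ := hv.exists_mem he₂.inv hy
      obtain ⟨q, hq, hyq⟩ := h.exists_mem he₂.inv hy'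
      obtain rfl := List.mem_singleton.1 hp
      obtain rfl := List.mem_singleton.1 hq
      exact hdl l' hl' y hyp hyq
    have hvar : (theta S₂.diagram v).vars.Nonempty := by
      obtain ⟨⟨x, lo, hi, h⟩, -⟩ := hv
      exact he₂.inv.good.canon.vars_nonempty h (by simp)
    refine ⟨S₂, _, v :: F, he₁.trans he₂, ?_, by simp [hFl], ⟨?_, ?_, ?_, ?_⟩, hw, fun ω => ?_⟩
    · have := hlen l (by simp)
      rw [List.length_cons, Nat.mul_succ]
      rw [this] at hs₂
      omega
    · refine List.nodup_cons.2 ⟨fun h => ?_, hF.nodup⟩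
      exact hvar.ne_empty (by simpa using dis v h)
    · intro w h
      obtain ⟨l', -, h⟩ := hw w h
      exact h.1
    · intro a ha b hb hab
      rcases List.mem_cons.1 ha with rfl | ha' <;> rcases List.mem_cons.1 hb with rfl | hb'
      · exact absurd rfl hab
      · exact dis b hb'
      · exact (dis a ha').symm
      · rw [he₂.theta a (hF.mem_names ha'), he₂.theta b (hF.mem_names hb')]
        exact hF.disjoint a ha' b hb' hab
    · exact fun a ha _ _ h _ => absurd (small a ha) h.not_ge
    · rw [List.forall_mem_cons, List.forall_mem_cons, ev, ← e₁]
      refine and_congr_right fun _ => forall₂_congr fun w hw => ?_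
      rw [he₂.theta w (hF.mem_names hw)]

/-- If all chains have `i + 1` variables, then their conjunction is rigid, and it is represented
by a decision vertex: deciding the first variable of a chain leaves a chain with `i` variables,
which is a factor. -/
theorem exists_rigid {m : ℕ} (hS : StoreInv ((m + 1 : ℕ) : ℕ∞) S) (Ls : List (List ℕ))
    (hLs : Ls ≠ []) (hlen : ∀ l ∈ Ls, l.length = m + 2) (hs : ∀ l ∈ Ls, l.Pairwise (· < ·))
    (hd : Ls.Pairwise fun l l' => (∀ x ∈ l, x ∉ l') ∧ ∀ y ∈ l', l.headI < y) :
    ∃ S' k v, Extends ((m + 1 : ℕ) : ℕ∞) k S S' ∧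
      S'.diagram.size ≤ S.diagram.size + (4 * m + 10) * Ls.length ∧
      DecSolves S' v (Ls.map fun l => (l, true)) := by
  induction Ls with
  | nil => exact absurd rfl hLs
  | cons l Ls ih =>
    have hll := hlen l (by simp)
    have hsl := hs l (by simp)
    obtain ⟨hdl, hd'⟩ := List.pairwise_cons.1 hd
    by_cases hLs : Ls = []
    · subst hLs
      obtain ⟨S₁, k₁, he₁, hs₁, h₁⟩ := exists_chain l hsl hS
      obtain ⟨v, -, hv, -⟩ := h₁ true
      refine ⟨S₁, k₁, v, he₁, ?_, hv (by
        rintro rfl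
        simp at hll)⟩
      rw [hll] at hs₁
      simp only [List.length_cons, List.length_nil]
      omega
    · obtain ⟨S₁, k₁, r, he₁, hs₁, hr⟩ := ih hLs
        (fun l h => hlen l (List.mem_cons_of_mem _ h))
        (fun l h => hs l (List.mem_cons_of_mem _ h)) hd'
      obtain ⟨x, t, rfl⟩ := List.exists_cons_of_length_pos (by omega : 0 < l.length)
      obtain ⟨hxt, hst⟩ := List.pairwise_cons.1 hsl
      have htl : t.length = m + 1 := by simpa using hll
      have htne : t ≠ [] := by
        rintro rfl
        simp at htl
      obtain ⟨S₂, k₂, he₂, hs₂, h₂⟩ := exists_chain t hst he₁.inv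
      -- The conjunction of the tail of the chain, or of its negation, and the other chains.
      have conj : ∀ {S : Store} {k : ℕ}, Extends ((m + 1 : ℕ) : ℕ∞) k S₂ S → ∀ b, ∃ S' k' v,
          Extends ((m + 1 : ℕ) : ℕ∞) k' S S' ∧ S'.diagram.size ≤ S.diagram.size + 2 ∧
          v ∈ names S'.diagram ∧ ∀ ω, eval ω (theta S'.diagram v) = true ↔
            Solves ω ((t, b) :: Ls.map fun l => (l, true)) := by
        intro S k he b
        obtain ⟨c, -, hc, -⟩ := h₂ b
        replace hc := (hc htne).of_extends he
        have hr' := hr.of_extends (he₂.trans he)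
        have dis : Disjoint (theta S.diagram c).vars (theta S.diagram r).vars := by
          refine Finset.disjoint_left.2 fun y hy hy' => ?_
          obtain ⟨p, hp, hyp⟩ := hc.exists_mem he.inv hy
          obtain ⟨q, hq, hyq⟩ := hr'.exists_mem he.inv hy'
          obtain rfl := List.mem_singleton.1 hp
          obtain ⟨l', hl', rfl⟩ := List.mem_map.1 hq
          exact (hdl l' hl').1 y (List.mem_cons_of_mem _ hyp) hyq
        have hcard : ((theta S.diagram c).vars.card : ℕ∞) ≤ ((m + 1 : ℕ) : ℕ∞) :=
          Nat.cast_le.2 (htl ▸ card_vars_le he.inv hc)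
        have hcr : c ≠ r := by
          rintro rfl
          obtain ⟨⟨x, lo, hi, h⟩, -⟩ := hc
          exact (he.inv.good.canon.vars_nonempty h (by simp)).ne_empty (by simpa using dis)
        obtain ⟨S', k', v, he', hs', hv, e⟩ := exists_conj he.inv (F := [c, r]) ⟨by simpa using hcr,
          by simpa using ⟨hc.1, hr'.1⟩, by simpa [hcr, hcr.symm] using ⟨dis, dis.symm⟩,
          fun a ha b hb h h' => by
            simp only [List.mem_cons, List.not_mem_nil, or_false] at ha hb
            rcases ha with rfl | rfl
            · exact absurd hcard h.not_ge
            · rcases hb with rfl | rfl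
              · exact absurd hcard h'.not_ge
              · rfl⟩ (by simp)
        refine ⟨S', k', v, he', hs', hv, fun ω => ?_⟩
        rw [e]
        simp only [List.mem_cons, List.not_mem_nil, or_false, forall_eq_or_imp, forall_eq]
        rw [hc.2, hr'.2]
        simp [Solves]
      obtain ⟨S₃, k₃, lo, he₃, hs₃, hlo, elo⟩ := conj (Extends.refl he₂.inv) false
      obtain ⟨S₄, k₄, hi, he₄, hs₄, hhi, ehi⟩ := conj he₃ true
      rw [← he₄.theta lo hlo] at elo
      replace hlo := he₄.mem_names hlo
      have lt : ∀ v ∈ names S₄.diagram, ∀ b, (∀ ω, eval ω (theta S₄.diagram v) = true ↔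
          Solves ω ((t, b) :: Ls.map fun l => (l, true))) →
          ∀ y ∈ (theta S₄.diagram v).vars, x < y := by
        intro v hv b e y hy
        obtain ⟨p, hp, hyp⟩ := exists_mem_of_mem_vars (he₄.inv.good.canon.tight hv) e hy
        rcases List.mem_cons.1 hp with rfl | hp
        · exact hxt y hyp
        · obtain ⟨l', hl', rfl⟩ := List.mem_map.1 hp
          exact (hdl l' hl').2 y hyp
      have hL : Proper (((x :: t) :: Ls).map fun l => (l, true)) := by
        refine ⟨?_, ?_, ?_⟩
        · intro p hp
          obtain ⟨l', hl', rfl⟩ := List.mem_map.1 hp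
          have := hlen l' hl'
          rintro (rfl : l' = [])
          simp at this
        · intro p hp
          obtain ⟨l', hl', rfl⟩ := List.mem_map.1 hp
          exact (hs l' hl').imp fun h => h.ne
        · intro p hp q hq y hyp hyq
          obtain ⟨a, ha, rfl⟩ := List.mem_map.1 hp
          obtain ⟨b, hb, rfl⟩ := List.mem_map.1 hq
          have : Std.Symm fun l l' : List ℕ => ∀ x ∈ l, x ∉ l' :=
            ⟨fun _ _ h x hx hx' => h x hx' hx⟩
          have pw : ((x :: t) :: Ls).Pairwise fun l l' : List ℕ => ∀ x ∈ l, x ∉ l' :=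
            List.pairwise_cons.2 ⟨fun l' hl' => (hdl l' hl').1, hd'.imp fun h => h.1⟩
          by_contra hne
          exact pw.forall ha hb (fun h => hne (by rw [h])) y hyp hyq
      obtain ⟨S₅, k₅, v, he₅, hs₅, hv⟩ := exists_dec he₄.inv hlo hhi
        (fun y hy => hy.elim (lt lo hlo _ elo y) (lt hi hhi _ ehi y)) hL (fun ω => by
          rw [eval_choice]
          have e1 := elo ω
          have e2 := ehi ω
          cases h : ω x <;> simp [e1, e2, Solves, chainVal, h])
        ⟨(x :: t, true), by simp, by simp⟩ (Or.inr fun p hp => by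
          obtain ⟨l', hl', rfl⟩ := List.mem_map.1 hp
          rw [hlen l' hl']
          exact Nat.cast_lt.2 (by omega))
      refine ⟨S₅, _, v, he₁.trans (he₂.trans (he₃.trans (he₄.trans he₅))), ?_, hv⟩
      rw [List.length_cons, Nat.mul_succ]
      omega

/-- If the bound is `j + 1`, then the conjunction of the chains with their `j + 2` variables is rigid;
with a larger bound, the chains are its factors. -/
theorem exists_mem_robddHat_chains (hij : (j : ℕ∞) < i) (hn : 1 ≤ n) :
    ∃ G ∈ ROBDDHat i, G.Represents (chains j n) ∧ G.size ≤ (4 * j + 10) * n := by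
  have hlen : ∀ l ∈ (List.range n).map (chainVars j n), l.length = j + 2 := by
    simp [chainVars]
  have hs : ∀ l ∈ (List.range n).map (chainVars j n), l.Pairwise (· < ·) := by
    intro l hl
    obtain ⟨k, -, rfl⟩ := List.mem_map.1 hl
    exact pairwise_chainVars hn
  have hd : ((List.range n).map (chainVars j n)).Pairwise
      fun l l' => (∀ x ∈ l, x ∉ l') ∧ ∀ y ∈ l', l.headI < y := by
    refine List.pairwise_map.2 (List.pairwise_lt_range.imp_of_mem fun {k l} hk hl h => ⟨?_, ?_⟩)
    · intro x hx hx'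
      have := eq_of_mem_chainVars (List.mem_range.1 hk) (List.mem_range.1 hl) hx hx'
      omega
    · intro y hy
      have := succ_le_of_mem_chainVars hy
      rw [chainVars_eq, List.headI_cons]
      omega
  obtain ⟨S, k, v, he, hsize, hv, e⟩ : ∃ S k v, Extends i k [] S ∧
      S.diagram.size ≤ (4 * j + 10) * n ∧ v ∈ names S.diagram ∧
      ∀ ω, eval ω (theta S.diagram v) = true ↔
        ∀ l ∈ (List.range n).map (chainVars j n), chainVal ω l = true := by
    have hj : ((j + 1 : ℕ) : ℕ∞) ≤ i := by exact_mod_cast Order.add_one_le_of_lt hij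
    rcases hj.eq_or_lt with rfl | hj
    · obtain ⟨S, k, v, he, hs, hv⟩ := exists_rigid storeInv_nil _ (by simp; omega) hlen hs hd
      refine ⟨S, k, v, he, by simpa [Store.diagram, size] using hs, hv.mem_names, fun ω => ?_⟩
      rw [hv.2, solves_map]
    · have hj' : ((j + 2 : ℕ) : ℕ∞) ≤ i := by exact_mod_cast Order.add_one_le_of_lt hj
      obtain ⟨S₁, k₁, F, he₁, hs₁, hFl, hF, -, e₁⟩ := exists_factors storeInv_nil hj' _ hlen
        (fun l hl h => by
          have := hlen l hl
          simp [h] at this) hs (hd.imp fun h => h.1)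
      obtain ⟨S₂, k₂, v, he₂, hs₂, hv, e₂⟩ := exists_conj he₁.inv hF (by
        rintro rfl
        simp at hFl
        omega)
      refine ⟨S₂, _, v, he₁.trans he₂, ?_, hv, fun ω => by rw [e₂, e₁]⟩
      rw [hFl, List.length_map, List.length_range] at hs₂
      rw [List.length_map, List.length_range] at hs₁
      have : (4 * j + 10) * n = 4 * (j + 2) * n + n + n := by ring
      simp only [Store.diagram, size, List.map_nil, List.sum_nil] at hs₁ hs₂ ⊢
      omega
  obtain ⟨h1, h2, h3, -⟩ := (collect_root_spec he.inv le_rfl hv).1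
  refine ⟨_, h1, fun ω => ?_, h3.trans hsize⟩
  rw [h2, Bool.eq_iff_iff, e, eval_chains]
  simp

end UpperBound

/-! ### Succinctness -/

theorem mem_obddAnd_of_mem_robddHat {i : ℕ∞} {G : Diagram} (hG : G ∈ ROBDDHat i) :
    G ∈ OBDDAnd i :=
  ⟨hG.1, hG.2.1, fun v ch h => (hG.2.2.2.1 v ch h).1⟩

theorem exists_lt_two_pow (p : Polynomial ℕ) (C : ℕ) : ∃ n, 1 ≤ n ∧ p.eval (C * n) < 2 ^ n := by
  have key : (fun n : ℕ => ((p.eval (C * n) : ℕ) : ℝ)) =o[Filter.atTop]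
      fun n => (2 : ℝ) ^ n := by
    induction p using Polynomial.induction_on' with
    | add p q hp hq => simpa using hp.add hq
    | monomial k a =>
      refine ((isLittleO_pow_const_const_pow_of_one_lt k (one_lt_two (α := ℝ))).const_mul_left
        (a * C ^ k : ℝ)).congr_left fun n => ?_
      simp
      ring
  obtain ⟨n, h, hn⟩ := ((key.def one_half_pos).and (Filter.eventually_ge_atTop 1)).exists
  refine ⟨n, hn, ?_⟩
  rw [Real.norm_of_nonneg (by positivity), Real.norm_of_nonneg (by positivity)] at h
  have : (0 : ℝ) < 2 ^ n := by positivity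
  exact_mod_cast (by linarith : ((p.eval (C * n) : ℕ) : ℝ) < 2 ^ n)

theorem notMoreSuccinct_iff {i j : ℕ∞} :
    NotMoreSuccinct (ROBDDHat i) (ROBDDHat j) ↔ i ≤ j := by
  constructor
  · rintro ⟨p, hp⟩
    by_contra! hij
    lift j to ℕ using hij.ne_top
    obtain ⟨n, hn, hlt⟩ := exists_lt_two_pow p (4 * j + 10)
    obtain ⟨G, hG, hrep, hsize⟩ := exists_mem_robddHat_chains hij hn
    obtain ⟨G', hG', e, hsize'⟩ := hp G hG
    have h1 := two_pow_le_size hG' hn (e.trans hrep)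
    have h2 : p.eval G.size ≤ p.eval ((4 * j + 10) * n) := by
      rw [Polynomial.eval_eq_sum, Polynomial.eval_eq_sum]
      exact Finset.sum_le_sum fun k _ =>
        Nat.mul_le_mul_left _ (Nat.pow_le_pow_left hsize _)
    omega
  · intro hij
    refine ⟨.C 300 * (.C 5 * .X + .C 13) ^ 4, fun G hG => ?_⟩
    obtain ⟨h1, h2, h3⟩ := (decompose_spec
      (input_of_mem_obddAnd hij (mem_obddAnd_of_mem_robddHat hG)) hG.1.rooted).1
    exact ⟨_, h1, h2, by simpa using h3⟩

end AndBDD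

theorem proposition4 :
    -- the succinctness relation
    (∀ i j : ℕ∞, NotMoreSuccinct (ROBDDHat i) (ROBDDHat j) ↔ i ≤ j) ∧
    -- correctness and running time of Decompose
    (∃ p : Polynomial ℕ, ∀ i j : ℕ∞, i ≤ j → ∀ G ∈ OBDDAnd i,
      (decompose j G).val ∈ ROBDDHat j ∧
      (decompose j G).val.formula.Equivalent G.formula ∧
      (decompose j G).time ≤ p.eval G.size) ∧
    -- the separating family
    (∀ j : ℕ,
      (∃ C : ℕ, ∀ i : ℕ∞, (j : ℕ∞) < i → ∀ n : ℕ, 1 ≤ n →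
        ∃ G ∈ ROBDDHat i, G.Represents (Formula.chains j n) ∧ G.size ≤ C * n) ∧
      (∀ n : ℕ, 1 ≤ n →
        (∃ G ∈ ROBDDHat (j : ℕ∞), G.Represents (Formula.chains j n)) ∧
        ∀ G ∈ ROBDDHat (j : ℕ∞), G.Represents (Formula.chains j n) → 2 ^ n ≤ G.size)) := by
  refine ⟨fun i j => notMoreSuccinct_iff, ⟨.C 300 * (.C 5 * .X + .C 13) ^ 4, ?_⟩, fun j =>
    ⟨⟨4 * j + 10, fun i hij n hn => exists_mem_robddHat_chains hij hn⟩, fun n hn =>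
      ⟨exists_mem_robddHat j _, fun G hG h => two_pow_le_size hG hn h⟩⟩⟩
  intro i j hij G hG
  obtain ⟨⟨h1, h2, -⟩, h3⟩ := decompose_spec (input_of_mem_obddAnd hij hG) hG.1.rooted
  exact ⟨h1, h2, by simpa using h3⟩
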